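/- **Conventions.** For $M\in\mathbb Z_{\ge1}$, $j\in\mathbb Z_{\ge0}$ and an $M$-periodic function $f:\mathbb Z\to\mathbb C$, put $$\Theta(\tau;j,f,M)=\sum_{n\ge1}n^jf(n)e^{i\pi n^2\tau/M}\quad(\operatorname{Im}\tau>0),\qquad \widehat f(n)=\frac1{\sqrt M}\sum_{\ell\bmod M}f(\ell)e^{-2\pi i\ell n/M},\qquad \langle f\rangle=\frac1M\sum_{m=1}^Mf(m),$$ $$\widetilde\Theta_{j,f,0,M}(\tau)=\sum_{p\ge0}\frac1{p!}L(-2p-j,f)\Big(\frac{\pi i}{M}\Big)^p\tau^p,$$ where $L(s,f)$ is the meromorphic continuation of $\sum_{m\ge1}f(m)m^{-s}$. For a formal series $\widetilde\varphi=\sum_{p\ge0}a_p\tau^p$, the Borel transform is $\widehat\varphi(\xi)=\sum_{p\ge0}a_{p+1}\xi^p/p!$, and the Borel sum in the direction $\theta$ is $\mathcal S^\theta\widetilde\varphi(\tau)=a_0+\int_0^{e^{i\theta}\infty}e^{-\xi/\tau}\widehat\varphi(\xi)\,d\xi$ for $\arg\tau\in(\theta-\frac\pi2,\theta+\frac\pi2)$,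 when $\widehat\varphi$ converges near $0$ and extends analytically, with at most exponential growth, to a neighbourhood of uniform width of the ray. For $\omega\ne0$, $\Delta_\omega$ is the alien derivation: $\Delta_\omega\widetilde\varphi$ is the weighted mean, with weights $\frac{p!\,q!}{(p+q+1)!}$, of the singularities at $\omega$ of the branches of $\widehat\varphi$ continued along the segment $(0,\omega)$, where $p$ and $q$ are the numbers of singular points circumvented to the right and to the left; the singularity of $\frac{(\xi-\omega)^{s-1}}{(1-e^{-2\pi is})\Gamma(s)}$ (for $s\notin\mathbb Z$, with $\arg(\xi-\omega)=\arg\omega-\pi$ on the segment, and modulo functions regular at $\omega$) is identified with $\tau^s$. All roots are principal: $i^{1/2}=e^{i\pi/4}$, and $\arg(\tau^{1/2})\in(0,\frac\pi2)$ for $\operatorname{Im}\tau>0$. **Proposition.** The formulas $$P_0(x)=1,\quad P_1(x)=-x,\quad P_j(x)=\big(2x^2-(j-1)\big)P_{j-2}(x)-xP_{j-2}'(x)\quad(j\ge2)$$ inductively define a sequence of integer polynomials of the form $$P_j(x)=\sum_{\substack{0\le\nu\le j\\ \nu\equiv j\,[2]}}P_{j,\nu}\,x^\nu\in\mathbb Z[x],\qquad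 P_{j,j}=(-1)^j2^{[j/2]}.$$ Let $M\in\mathbb Z_{\ge1}$, $j\in\mathbb Z_{\ge0}$, and let $f$ be $M$-periodic such that either $j$ is even and $f$ is odd, or $j$ is odd and $f$ is even. Then, for every integer $n\ge1$, $$\Delta_{\frac{\pi in^2}M}\widetilde\Theta_{j,f,0,M}(\tau)=A_{j,M}\,\widehat f(n)\,\tau^{-\frac{j+1}2}\,P_j\Big(n\Big(\frac{\pi i}M\Big)^{1/2}\tau^{-1/2}\Big),\qquad A_{j,M}=2^{-[j/2]+1}\,i^{1/2}\Big(\frac M{\pi i}\Big)^{j/2}.$$ If moreover $\langle f\rangle=0$, then for each choice of sign, every $\tau$ with $\operatorname{Im}\tau>0$, and every $\epsilon\in(0,\pi)$ such that $\arg\tau$ lies within $\frac\pi2$ of $\frac\pi2\mp\epsilon$ (in particular every sufficiently small $\epsilon>0$), $\widetilde\Theta_{j,f,0,M}$ is Borel summable in the direction $\frac\pi2\mp\epsilon$ at $\tau$ and $$\Theta(\tau;j,f,M)=\mathcal S^{\frac\pi2\mp\epsilon}\widetilde\Theta_{j,f,0,M}(\tau)\mp2^{-[j/2]}\,i^{1/2}\sum_{\substack{0\le\nu\le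 j\\ \nu\equiv j\,[2]}}\Big(\frac M{\pi i}\Big)^{\frac{j-\nu}2}P_{j,\nu}\,\tau^{-\frac{j+\nu+1}2}\,\Theta(-\tau^{-1};\nu,\widehat f,M).$$ -/

import Mathlib

noncomputable section

namespace PartialTheta

open Complex Polynomial Filter Topology MeasureTheory

/-! ### Partial theta series, discrete Fourier transform, mean value -/

/-- The partial theta series `Θ(τ; j, f, M) = ∑_{n ≥ 1} n ^ j f(n) exp(iπ n² τ / M)`. -/
def theta (τ : ℂ) (j : ℕ) (f : ℤ → ℂ) (M : ℕ) : ℂ :=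
  ∑' n : ℕ, ((n : ℂ) + 1) ^ j * f ((n : ℤ) + 1) *
    exp (I * (Real.pi : ℂ) * ((n : ℂ) + 1) ^ 2 * τ / (M : ℂ))

/-- The normalized discrete Fourier transform
`f̂(n) = M ^ (-1/2) ∑_{ℓ mod M} f(ℓ) exp(-2πi ℓ n / M)` of an `M`-periodic function. -/
def dft (M : ℕ) (f : ℤ → ℂ) (n : ℤ) : ℂ :=
  (1 / (Real.sqrt M : ℂ)) * ∑ l ∈ Finset.range M,
    f (l : ℤ) * exp (-2 * I * (Real.pi : ℂ) * (l : ℂ) * (n : ℂ) / (M : ℂ))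

/-- The mean value `⟨f⟩` of an `M`-periodic function. -/
def mean (M : ℕ) (f : ℤ → ℂ) : ℂ :=
  (1 / (M : ℂ)) * ∑ m ∈ Finset.Icc 1 M, f (m : ℤ)

/-- `j` and `f` have opposite parities. -/
def OppositeParity (j : ℕ) (f : ℤ → ℂ) : Prop :=
  (Even j ∧ Function.Odd f) ∨ (Odd j ∧ Function.Even f)

/-- The `L`-function `L(s, f)` of an `M`-periodic function: the meromorphic continuation of
`∑_{m ≥ 1} f(m) m ^ (-s)`, as provided by Mathlib for functions on `ZMod M`. -/
def Lfun (M : ℕ) [NeZero M] (f : ℤ → ℂ) (s : ℂ) : ℂ :=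
  ZMod.LFunction (fun a : ZMod M => f (a.val : ℤ)) s

/-- The formal series `∑_{p ≥ 0} (1 / p!) L(-2p - j, f) (πi / M) ^ p τ ^ p`. -/
def thetaTilde (j : ℕ) (f : ℤ → ℂ) (M : ℕ) [NeZero M] : PowerSeries ℂ :=
  PowerSeries.mk fun p =>
    (1 / (p.factorial : ℂ)) * Lfun M f (-2 * (p : ℂ) - (j : ℂ)) *
      ((Real.pi : ℂ) * I / (M : ℂ)) ^ p

/-! ### The polynomials -/

/-- The sequence of polynomials `P_0 = 1`, `P_1 = -x`,
`P_j = (2x² - (j - 1)) P_{j-2} - x P'_{j-2}` (here `j = k + 2`). -/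
def poly : ℕ → ℤ[X]
  | 0 => 1
  | 1 => -X
  | k + 2 => (2 * X ^ 2 - C ((k : ℤ) + 1)) * poly k - X * derivative (poly k)

/-! ### Borel transform and Borel sums -/

/-- `g` represents near `0` the (convergent) Borel transform `∑_{p ≥ 0} a_{p+1} ξ ^ p / p!` of the
formal series `φ = ∑_{p ≥ 0} a_p τ ^ p`. -/
def IsBorelTransform (φ : PowerSeries ℂ) (g : ℂ → ℂ) : Prop :=
  ∀ᶠ ξ in 𝓝 (0 : ℂ),
    HasSum (fun p : ℕ => PowerSeries.coeff (p + 1) φ * ξ ^ p / (p.factorial : ℂ)) (g ξ)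

/-- The open `δ`-neighbourhood of the closed half-line `ℝ≥0 · exp(iθ)`. -/
def rayNhd (θ δ : ℝ) : Set ℂ :=
  {ζ | ∃ r : ℝ, 0 ≤ r ∧ ‖ζ - r * exp (I * θ)‖ < δ}

/-- `φ = ∑ a_p τ ^ p` is Borel summable in the direction `θ`, with Borel sum
`a_0 + ∫_0^{exp(iθ)∞} exp(-ξ/τ) φ̂(ξ) dξ` equal to `v` at the point `τ`: the Borel transform
converges near `0`, extends analytically to a neighbourhood of uniform width of the ray, with at
most exponential growth of a type `B < Re (exp(iθ)/τ)`. -/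
def HasBorelSum (θ : ℝ) (φ : PowerSeries ℂ) (τ v : ℂ) : Prop :=
  ∃ (g : ℂ → ℂ) (δ A B : ℝ), 0 < δ ∧ 0 ≤ B ∧ B < (exp (I * θ) / τ).re ∧
    IsBorelTransform φ g ∧
    AnalyticOnNhd ℂ g (rayNhd θ δ) ∧
    (∀ ζ ∈ rayNhd θ δ, ‖g ζ‖ ≤ A * Real.exp (B * ‖ζ‖)) ∧
    v = PowerSeries.coeff 0 φ +
      ∫ r in Set.Ioi (0 : ℝ), exp (-(r * exp (I * θ)) / τ) * g (r * exp (I * θ)) * exp (I * θ)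

/-! ### Alien derivatives

A finite sum of monomials `c_s τ ^ s`, with rational exponents `s`, is an element of the algebra
`AddMonoidAlgebra ℂ ℚ`; such sums may be multiplied formally. -/

/-- The formal monomial `c τ ^ s`. -/
def mono (s : ℚ) (c : ℂ) : AddMonoidAlgebra ℂ ℚ := AddMonoidAlgebra.single s c

/-- The major, i.e. the representative on the universal cover of the punctured disc, of the
singularity at `0` that corresponds to `τ ^ s`; its argument is `w = log ζ`.
For `s ∉ {1, 2, …}` it is `exp(iπs) Γ(1 - s) ζ ^ (s - 1) / (2πi)`, which for `s ∉ ℤ` is the same as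
`ζ ^ (s - 1) / ((1 - exp(-2πis)) Γ(s))`; for `s ∈ {1, 2, …}` it is
`ζ ^ (s - 1) log ζ / (2πi (s - 1)!)`. In all cases the variation
`major(ζ) - major(ζ exp(-2πi))` is `ζ ^ (s - 1) / Γ(s)`. -/
def monoMajor (s : ℚ) (w : ℂ) : ℂ :=
  if s.den = 1 ∧ 0 < s.num then
    exp (((s : ℂ) - 1) * w) * w / (2 * Real.pi * I * Gamma (s : ℂ))
  else
    exp (I * Real.pi * (s : ℂ)) * Gamma (1 - (s : ℂ)) * exp (((s : ℂ) - 1) * w) /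
      (2 * Real.pi * I)

/-- The major of a finite sum of monomials, as a function of `w = log ζ`. -/
def major (ψ : AddMonoidAlgebra ℂ ℚ) (w : ℂ) : ℂ :=
  ψ.coeff.sum fun s c => c * monoMajor s w

/-- A simply connected neighbourhood of the half-open segment from `0` to `ω`, slit at the points
`s ω`, `s ∈ S`: it is made of the points `ω (x + i y)` with `-η < x < 1`, `|y| < η` where, on the
line `x = s`, only the side `y < 0` (to the right when moving from `0` to `ω`) is kept for
`s ∈ R`, and only the side `y > 0` (to the left) is kept for `s ∉ R`.
Continuation in this domain is continuation along the path from `0` towards `ω` that stays close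
to the segment and circumvents `s ω` to the right if `s ∈ R`, and to the left otherwise. -/
def slitStrip (ω : ℂ) (S R : Finset ℝ) (η : ℝ) : Set ℂ :=
  {ζ | ∃ x y : ℝ, ζ = ω * ((x : ℂ) + (y : ℂ) * I) ∧ -η < x ∧ x < 1 ∧ |y| < η ∧
    ∀ s ∈ S, x = s → (s ∈ R → y < 0) ∧ (s ∉ R → 0 < y)}

/-- The alien derivative of the formal series `φ` at the point `ω ≠ 0` is `ψ`, that is
`Δ_ω φ = ψ`.
Here `s ω`, `s ∈ S`, are the (finitely many) possible singular points on the open segment from `0`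
to `ω`. For each way `R ⊆ S` of circumventing them, with `p = #R` to the right and `q = #S - #R` to
the left, `G R` is the corresponding branch of the continuation of the Borel transform of `φ`, and
`w ↦ H R w` is its continuation to the universal cover of a punctured disc of radius `ρ` about `ω`,
parametrized by `w = log (ξ - ω)`, where on the segment `arg (ξ - ω) = arg ω - π`.
The mean of the `H R` with weights `p! q! / (p + q + 1)!` has to represent the same singularity as
`ψ`, that is, to differ from the major of `ψ` by a function that is holomorphic at `ω`. -/
def HasAlienDerivative (ω : ℂ) (φ : PowerSeries ℂ) (ψ : AddMonoidAlgebra ℂ ℚ) : Prop :=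
  ω ≠ 0 ∧
  ∃ (S : Finset ℝ) (η ρ : ℝ) (G H : Finset ℝ → ℂ → ℂ),
    (∀ s ∈ S, 0 < s ∧ s < 1) ∧ 0 < η ∧ 0 < ρ ∧
    (∀ R ⊆ S,
      IsBorelTransform φ (G R) ∧
      AnalyticOnNhd ℂ (G R) (slitStrip ω S R η) ∧
      AnalyticOnNhd ℂ (H R) {w : ℂ | w.re < Real.log ρ} ∧
      ∀ t : ℝ, 0 < t → t < ρ →
        H R ((Real.log t : ℂ) + ((arg ω - Real.pi : ℝ) : ℂ) * I) =
          G R (ω - t * (ω / (‖ω‖ : ℂ)))) ∧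
    ∃ h : ℂ → ℂ, AnalyticOnNhd ℂ h (Metric.ball 0 ρ) ∧
      ∀ w : ℂ, w.re < Real.log ρ →
        ∑ R ∈ S.powerset,
          ((R.card.factorial : ℂ) * ((S.card - R.card).factorial : ℂ) /
            ((S.card + 1).factorial : ℂ)) * H R w =
          major ψ w + h (exp w)

end PartialTheta

end

/-! ### Hermite polynomials and the polynomials `P_j`. -/

noncomputable section

namespace PartialTheta

open Complex Polynomial Filter Topology MeasureTheory

/-! Write ω_n = πi n²/M. For opposite parities, the functional equation expresses each L(-2p-j, f)
with 2p+j ≥ 1 by the absolutely convergent series of f̂(n)/n^(2p+j+1) (`hasSum_Lfun_neg`). Summing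
over p first, the Borel transform becomes a convergent superposition over n of one elementary
function of x = ξ/ω_n, namely ∂_x ∂_b^j (b² - x)^(-1/2) at b = 1, which is v^(-1/2) times a
polynomial in 1/v for v = 1 - x (`isBorelTransform_borelBranch`).

Alien derivatives. Along every path towards ω_n only the n-th summand is singular at the end point,
and its branch there does not depend on the path; since the weights add up to 1, the mean reproduces
this one singularity. Differentiation in ξ corresponds to multiplication by τ⁻¹, so the recursion in
j that comes from the b-derivatives becomes the three-term recursion of (-1)^j H_j
(`singToMono_singPoly`), and H_j is P_j up to sign and a power of 2 (`signedHermite_eq_poly`).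

The identities. Poisson summation is applied to n^j exp(iπn²τ/M), extended from the half-line with
the parity of f. This parity is the wrong one for x^j, so the Fourier transform is not a Hermite
function but a half-line Gaussian moment. For j = 0 this moment and the Laplace integral of (k² -
x)^(-1/2) along a ray solve the same first-order linear equation in the frequency k; they differ by
a multiple of exp(-μk²), found by letting k → 0, whose sign depends on the side on which the ray
passes the singularity (`gaussMoment_zero_eq`). A common recursion carries this to all j
(`I_pow_mul_gaussMoment`). With μ = ω_n/τ, summation over n turns the Laplace integrals into the
Borel sum and the terms exp(-μ) into theta series at -1/τ.

The condition ⟨f⟩ = 0 removes the zero frequency. For j = 0 the extended summand would jump at the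
origin; a triangle function is subtracted to make it continuous, and the sum of f against the
triangle is L(0, f), the constant term of the formal series (`Lfun_zero`). -/

/-- The Hermite polynomials `(-1) ^ j H_j`, by their three-term recursion. -/
def signedHermite : ℕ → ℤ[X]
  | 0 => 1
  | 1 => -(2 * X)
  | k + 2 => -(2 * X) * signedHermite (k + 1) - 2 * C ((k : ℤ) + 1) * signedHermite k

lemma derivative_signedHermite (k : ℕ) :
    derivative (signedHermite (k + 1)) = -2 * C ((k : ℤ) + 1) * signedHermite k := by
  induction k using Nat.strong_induction_on with
  | _ k ih =>
    match k with
    | 0 => simp [signedHermite]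
    | 1 =>
      simp [signedHermite]
      ring
    | k + 2 =>
      have h1 := ih (k + 1) (by omega)
      have h0 := ih k (by omega)
      rw [signedHermite, derivative_sub, derivative_mul, derivative_mul, h1, h0]
      simp only [signedHermite, derivative_mul, derivative_X, derivative_C, derivative_neg]
      simp
      ring

/-- The derivative formula eliminates the middle term of the three-term recursion; what remains is
twice the recursion that defines `poly`. -/
lemma signedHermite_two_step (k : ℕ) :
    signedHermite (k + 2) =
      2 * ((2 * X ^ 2 - C ((k : ℤ) + 1)) * signedHermite k
        - X * derivative (signedHermite k)) := by
  match k with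
  | 0 => simp [signedHermite]; ring
  | k + 1 =>
    rw [derivative_signedHermite]
    simp only [signedHermite]
    simp
    ring

/-- Each double step costs one factor 2, and so does the first step from index 0 to index 1; hence
the exponent ⌈j/2⌉. -/
lemma signedHermite_eq_poly (j : ℕ) : signedHermite j = 2 ^ ((j + 1) / 2) * poly j := by
  induction j using Nat.strong_induction_on with
  | _ j ih =>
    match j with
    | 0 => simp [signedHermite, poly]
    | 1 => simp [signedHermite, poly]
    | k + 2 =>
      rw [signedHermite_two_step, ih k (by omega), poly,
        show (k + 2 + 1) / 2 = (k + 1) / 2 + 1 by omega]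
      have : derivative ((2 : ℤ[X]) ^ ((k + 1) / 2) * poly k)
          = 2 ^ ((k + 1) / 2) * derivative (poly k) := by
        rw [show (2 : ℤ[X]) ^ ((k + 1) / 2) = C (2 ^ ((k + 1) / 2)) by simp, derivative_C_mul]
      rw [this]
      ring

lemma coeff_poly_succ_succ (k ν : ℕ) :
    (poly (k + 2)).coeff (ν + 2) =
      2 * (poly k).coeff ν - ((k : ℤ) + 1 + (ν + 2)) * (poly k).coeff (ν + 2) := by
  rw [poly, coeff_sub, sub_mul, coeff_sub, coeff_X_mul, coeff_derivative, coeff_C_mul,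
    show (2 : ℤ[X]) * X ^ 2 * poly k = C 2 * (X ^ 2 * poly k) by simp; ring, coeff_C_mul,
    show ν + 2 = ν + 2 from rfl, coeff_X_pow_mul]
  push_cast
  ring

lemma coeff_poly_one (k : ℕ) :
    (poly (k + 2)).coeff 1 = -((k : ℤ) + 2) * (poly k).coeff 1 := by
  rw [poly, coeff_sub, sub_mul, coeff_sub, coeff_X_mul, coeff_derivative, coeff_C_mul,
    show (2 : ℤ[X]) * X ^ 2 * poly k = C 2 * (X ^ 2 * poly k) by simp; ring, coeff_C_mul,
    coeff_X_pow_mul']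
  simp
  ring

lemma coeff_poly_zero (k : ℕ) :
    (poly (k + 2)).coeff 0 = -((k : ℤ) + 1) * (poly k).coeff 0 := by
  rw [poly, coeff_sub, sub_mul, coeff_sub, coeff_C_mul,
    show (2 : ℤ[X]) * X ^ 2 * poly k = C 2 * (X ^ 2 * poly k) by simp; ring, coeff_C_mul,
    coeff_X_pow_mul']
  simp
  ring

lemma coeff_poly_eq_zero (j : ℕ) :
    ∀ ν, (j < ν ∨ ¬ ν ≡ j [MOD 2]) → (poly j).coeff ν = 0 := by
  induction j using Nat.strong_induction_on with
  | _ j ih =>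
    intro ν hν
    match j, ih with
    | 0, _ =>
      have : ν ≠ 0 := by
        rintro rfl
        simp [Nat.ModEq] at hν
      simp [poly, coeff_one, this]
    | 1, _ =>
      have : 1 ≠ ν := by
        rintro rfl
        simp [Nat.ModEq] at hν
      simp [poly, coeff_X, this]
    | k + 2, ih =>
      simp only [Nat.ModEq] at hν ih
      match ν with
      | 0 => rw [coeff_poly_zero, ih k (by omega) 0 (by omega), mul_zero]
      | 1 => rw [coeff_poly_one, ih k (by omega) 1 (by omega), mul_zero]
      | ν + 2 =>
        rw [coeff_poly_succ_succ, ih k (by omega) ν (by omega), ih k (by omega) (ν + 2) (by omega)]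
        ring

lemma coeff_poly_self (j : ℕ) : (poly j).coeff j = (-1) ^ j * 2 ^ (j / 2) := by
  induction j using Nat.strong_induction_on with
  | _ j ih =>
    match j with
    | 0 => simp [poly]
    | 1 => simp [poly]
    | k + 2 =>
      rw [coeff_poly_succ_succ, ih k (by omega), coeff_poly_eq_zero k (k + 2) (Or.inl (by omega)),
        show (k + 2) / 2 = k / 2 + 1 by omega]
      ring

lemma poly_eq_sum (j : ℕ) :
    poly j = ∑ ν ∈ (Finset.range (j + 1)).filter (fun ν => ν ≡ j [MOD 2]),
      C ((poly j).coeff ν) * X ^ ν := by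
  ext m
  simp only [finsetSum_coeff, coeff_C_mul, coeff_X_pow, mul_ite, mul_one, mul_zero]
  rw [Finset.sum_ite_eq]
  split_ifs with h
  · rfl
  · apply coeff_poly_eq_zero
    simp only [Finset.mem_filter, Finset.mem_range, not_and_or] at h
    exact h.imp_left (by omega)

lemma aeval_poly_eq_sum {A : Type*} [CommRing A] [Algebra ℤ A] (j : ℕ) (x : A) :
    aeval x (poly j) = ∑ ν ∈ (Finset.range (j + 1)).filter (fun ν => ν ≡ j [MOD 2]),
      ((poly j).coeff ν : A) * x ^ ν := by
  conv_lhs => rw [poly_eq_sum j]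
  simp [map_sum]

/-! ### Singularities of the Borel transform -/

/-- The derivative of `v ^ (-1/2) p(1/v)` is `-v ^ (-1/2) q(1/v)` with `q = opD p`. -/
def opD (p : ℂ[X]) : ℂ[X] := X * (C (1 / 2) * p + X * derivative p)

lemma opD_sub (p q : ℂ[X]) : opD (p - q) = opD p - opD q := by
  simp only [opD, derivative_sub]; ring

lemma opD_C_mul (a : ℂ) (p : ℂ[X]) : opD (C a * p) = C a * opD p := by
  simp only [opD, derivative_C_mul]; ring

/-- The polynomials `C_j` such that the `j`-th derivative with respect to `b` at `b = 1` of
`(b ^ 2 - x) ^ (-1/2)` is `v ^ (-1/2) C_j(1/v)`, `v = 1 - x`. -/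
def singPoly : ℕ → ℂ[X]
  | 0 => 1
  | 1 => -X
  | k + 2 => C (-2) * opD (singPoly (k + 1)) - C (2 * ((k : ℂ) + 1)) * opD (singPoly k)

lemma singPoly_one : singPoly 1 = C (-2) * opD (singPoly 0) := by
  simp only [singPoly, opD]
  rw [show -(X : ℂ[X]) = C (-2) * C (1 / 2) * X by rw [← C_mul]; norm_num]
  simp
  ring

lemma opD_iterate_one (p : ℕ) :
    opD^[p] 1 = C (((2 * p).factorial : ℂ) / (4 ^ p * p.factorial)) * X ^ p := by
  induction p with
  | zero => simp
  | succ p ih =>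
    rw [Function.iterate_succ_apply', ih, opD_C_mul, opD]
    have : X * (C (1 / 2) * X ^ p + X * derivative (X ^ p)) =
        C ((1 / 2 : ℂ) + p) * X ^ (p + 1) := by
      rw [C_add, derivative_X_pow]
      rcases p with _ | p
      · simp
      · simp; ring
    rw [this, ← mul_assoc, ← C_mul]
    congr 2
    rw [show 2 * (p + 1) = 2 * p + 1 + 1 by ring, Nat.factorial_succ, Nat.factorial_succ,
      Nat.factorial_succ]
    have := Nat.factorial_ne_zero p
    push_cast
    field_simp
    ring

/-- These numbers are the p-th x-derivatives at 0 of ∂_b^j (b² - x)^(-1/2) at b = 1: expand in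
binomial series and differentiate b^(-2p-1) j times. The recursion of `singPoly` comes from ∂_b F =
-2b ∂_x F and the Leibniz rule, `opD` playing the role of ∂_x. -/
lemma eval_one_opD_iterate_singPoly (j p : ℕ) :
    (opD^[p] (singPoly j)).eval 1 =
      (-1) ^ j * ((2 * p + j).factorial : ℂ) / (4 ^ p * p.factorial) := by
  have hC : ∀ (p : ℕ) (a : ℂ) (q : ℂ[X]), opD^[p] (C a * q) = C a * opD^[p] q := by
    intro p a q
    induction p with
    | zero => simp
    | succ p ih => rw [Function.iterate_succ_apply', ih, opD_C_mul, Function.iterate_succ_apply']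
  have hS : ∀ (p : ℕ) (q r : ℂ[X]), opD^[p] (q - r) = opD^[p] q - opD^[p] r := by
    intro p q r
    induction p with
    | zero => simp
    | succ p ih => simp only [Function.iterate_succ_apply', ih, opD_sub]
  have h0 : ∀ p : ℕ, (opD^[p] (singPoly 0)).eval 1 =
      ((2 * p).factorial : ℂ) / (4 ^ p * p.factorial) := by
    intro p
    rw [singPoly, opD_iterate_one]
    simp
  induction j using Nat.strong_induction_on generalizing p with
  | _ j ih =>
    have hp := Nat.cast_ne_zero (R := ℂ).mpr (Nat.factorial_ne_zero p)
    have hp1 : (p : ℂ) + 1 ≠ 0 := by exact_mod_cast Nat.succ_ne_zero p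
    match j with
    | 0 => rw [h0]; simp
    | 1 =>
      rw [singPoly_one, hC, eval_C_mul, ← Function.iterate_succ_apply, h0,
        show 2 * (p + 1) = 2 * p + 1 + 1 by ring, Nat.factorial_succ, Nat.factorial_succ p, Nat.succ_eq_add_one, pow_succ (4 : ℂ)]
      push_cast
      field_simp
      ring
    | k + 2 =>
      rw [singPoly, hS, hC, hC, eval_sub, eval_C_mul, eval_C_mul, ← Function.iterate_succ_apply,
        ← Function.iterate_succ_apply, ih (k + 1) (by omega), ih k (by omega),
        show 2 * (p + 1) + (k + 1) = 2 * p + (k + 2) + 1 by ring,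
        show 2 * (p + 1) + k = 2 * p + (k + 2) by ring, Nat.factorial_succ, Nat.factorial_succ p, Nat.succ_eq_add_one, pow_succ (4 : ℂ)]
      push_cast
      field_simp
      ring

/-- The function `v ^ (-1/2) p(1/v)`, with the branch of the logarithm that is cut along
the half-line `-e⁻¹ ℝ≥0`. -/
def germ (p : ℂ[X]) (e v : ℂ) : ℂ := exp (-(log (e * v) - log e) / 2) * p.eval v⁻¹

lemma germ_C_mul (a : ℂ) (p : ℂ[X]) (e v : ℂ) : germ (C a * p) e v = a * germ p e v := by
  simp [germ]; ring

lemma germ_sub (p q : ℂ[X]) (e v : ℂ) : germ (p - q) e v = germ p e v - germ q e v := by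
  simp [germ]; ring

lemma hasDerivAt_germ (p : ℂ[X]) {e v : ℂ} (h : e * v ∈ slitPlane) :
    HasDerivAt (germ p e) (-germ (opD p) e v) v := by
  have hev := slitPlane_ne_zero h
  have he : e ≠ 0 := left_ne_zero_of_mul hev
  have hv : v ≠ 0 := right_ne_zero_of_mul hev
  have h1 : HasDerivAt (fun v => -(log (e * v) - log e) / 2) (-(e / (e * v)) / 2) v := by
    have := ((((hasDerivAt_id v).const_mul e).clog h).sub_const (log e)).neg.div_const 2
    simpa using this
  have h2 : HasDerivAt (fun v : ℂ => p.eval v⁻¹) ((derivative p).eval v⁻¹ * (-(v ^ 2)⁻¹)) v :=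
    (p.hasDerivAt v⁻¹).comp v (hasDerivAt_inv hv)
  refine (h1.cexp.mul h2).congr_deriv ?_
  simp only [germ, opD, eval_mul, eval_add, eval_X, eval_C]
  field_simp
  ring

lemma analyticAt_germ (p : ℂ[X]) {e v : ℂ} (h : e * v ∈ slitPlane) :
    AnalyticAt ℂ (germ p e) v := by
  have hv : v ≠ 0 := right_ne_zero_of_mul (slitPlane_ne_zero h)
  unfold germ
  have h1 : AnalyticAt ℂ (fun v : ℂ => log (e * v)) v := by fun_prop (disch := assumption)
  have h2 : AnalyticAt ℂ (fun v : ℂ => p.eval v⁻¹) v := by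
    have := (AnalyticAt.aeval_polynomial (analyticAt_inv hv) p : AnalyticAt ℂ
      (fun z : ℂ => aeval (z⁻¹) p) v)
    simpa using this
  fun_prop

/-- The exponent -1/2 is real, so the modulus of v^(-1/2) depends only on ‖v‖. This makes the bound
uniform over all positions of the cut. -/
lemma norm_germ_le (p : ℂ[X]) {c : ℝ} (hc : 0 < c) :
    ∃ B : ℝ, 0 ≤ B ∧ ∀ e v : ℂ, ‖e‖ = 1 → c ≤ ‖v‖ → ‖germ p e v‖ ≤ B := by
  refine ⟨Real.exp (-Real.log c / 2) * ∑ i ∈ Finset.range (p.natDegree + 1),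
    ‖p.coeff i‖ * c⁻¹ ^ i, by positivity, fun e v he hv => ?_⟩
  have hv0 : 0 < ‖v‖ := hc.trans_le hv
  rw [germ, norm_mul, norm_exp, eval_eq_sum_range]
  gcongr
  · rw [show (-(log (e * v) - log e) / 2).re = -((log (e * v)).re - (log e).re) / 2 by
      simp, log_re, log_re, norm_mul, he]
    have := Real.log_le_log hc hv
    simp
    linarith
  · refine (norm_sum_le _ _).trans (Finset.sum_le_sum fun i _ => ?_)
    rw [norm_mul, norm_pow, norm_inv]
    gcongr

/-- For these three values of `e` the cut lies in the closed left half-plane, and all branches are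
normalized to be 1 at v = 1 when p = 1. -/
lemma germ_eq_germ_one (p : ℂ[X]) {e v : ℂ} (he : e = 1 ∨ e = I ∨ e = -I) (hv : 0 < v.re) :
    germ p e v = germ p 1 v := by
  have hv0 : v ≠ 0 := by rintro rfl; simp at hv
  have harg := abs_lt.mp (abs_arg_lt_pi_div_two_iff.mpr (Or.inl hv))
  have key : log (e * v) - log e = log v := by
    rcases he with rfl | rfl | rfl
    · simp
    · rw [log_mul I_ne_zero hv0]
      · ring
      · rw [arg_I]; constructor <;> linarith [Real.pi_pos]
    · rw [log_mul (neg_ne_zero.mpr I_ne_zero) hv0]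
      · ring
      · rw [arg_neg_I]; constructor <;> linarith [Real.pi_pos]
  simp [germ, key]

lemma iteratedDeriv_germ (p : ℂ[X]) (n : ℕ) {x : ℂ} (hx : 1 - x ∈ slitPlane) :
    iteratedDeriv n (fun x => germ p 1 (1 - x)) x = germ (opD^[n] p) 1 (1 - x) := by
  induction n generalizing x with
  | zero => simp
  | succ n ih =>
    rw [iteratedDeriv_succ, Function.iterate_succ_apply']
    have hopen : ∀ᶠ y in 𝓝 x, 1 - y ∈ slitPlane :=
      (continuous_const.sub continuous_id).continuousAt.eventually_mem
        (isOpen_slitPlane.mem_nhds hx)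
    rw [Filter.EventuallyEq.deriv_eq (hopen.mono fun y hy => ih hy)]
    have h := (hasDerivAt_germ (opD^[n] p) (e := 1) (v := 1 - x) (by simpa using hx)).comp x
      ((hasDerivAt_id x).const_sub 1)
    rw [show (fun y => germ (opD^[n] p) 1 (1 - y)) =
      (germ (opD^[n] p) 1) ∘ (fun y => 1 - y) from rfl]
    rw [HasDerivAt.deriv h]
    ring

lemma one_sub_mem_slitPlane {x : ℂ} (hx : ‖x‖ < 1) : 1 - x ∈ slitPlane := by
  left
  have := (abs_re_le_norm x).trans_lt hx
  rw [abs_lt] at this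
  simp
  linarith

/-- Each x-derivative of v^(-1/2) p(1/v), v = 1 - x, applies `opD` to p; at x = 0 the factor
v^(-1/2) is 1. -/
lemma hasSum_germ (p : ℂ[X]) {x : ℂ} (hx : ‖x‖ < 1) :
    HasSum (fun n : ℕ => (opD^[n] p).eval 1 / n.factorial * x ^ n) (germ p 1 (1 - x)) := by
  have hd : DifferentiableOn ℂ (fun x => germ p 1 (1 - x)) (Metric.ball 0 1) := by
    intro y hy
    have := (hasDerivAt_germ p (e := 1) (v := 1 - y)
      (by simpa using one_sub_mem_slitPlane (by simpa using hy))).comp y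
      ((hasDerivAt_id y).const_sub 1)
    exact this.differentiableAt.differentiableWithinAt
  have h := hasSum_taylorSeries_on_ball hd (z := x) (by simpa using hx)
  have e : ∀ n : ℕ, (n.factorial : ℂ)⁻¹ • (x - 0) ^ n • iteratedDeriv n
      (fun x => germ p 1 (1 - x)) 0 = (opD^[n] p).eval 1 / n.factorial * x ^ n := by
    intro n
    rw [iteratedDeriv_germ p n (by simp)]
    simp [germ]
    ring
  simpa only [e] using h

/-! ### The discrete Fourier transform and the functional equation -/

section Fourier

lemma intCast_val_apply {M : ℕ} [NeZero M] {f : ℤ → ℂ} (hf : Function.Periodic f (M : ℤ))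
    (n : ℤ) : f ((n : ZMod M).val : ℤ) = f n := by
  rw [ZMod.val_intCast]
  have := hf.sub_zsmul_eq (n / M) (x := n)
  rw [← this]
  congr 1
  rw [Int.emod_def]
  simp [mul_comm]

lemma sum_zmod_eq_sum_range {M : ℕ} [NeZero M] {E : Type*} [AddCommMonoid E] (g : ZMod M → E) :
    ∑ a, g a = ∑ l ∈ Finset.range M, g (l : ZMod M) := by
  refine Finset.sum_nbij' (fun a => a.val) (fun l => (l : ZMod M)) ?_ ?_ ?_ ?_ ?_
  · intro a _; simpa using ZMod.val_lt a
  · intro l _; simp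
  · intro a _; simp
  · intro l hl; exact ZMod.val_cast_of_lt (by simpa using hl)
  · intro a _; simp

variable {M : ℕ} [NeZero M] {f : ℤ → ℂ}

lemma dft_eq_zmod_dft (n : ℤ) :
    dft M f n = (1 / (Real.sqrt M : ℂ)) * ZMod.dft (fun a : ZMod M => f (a.val : ℤ)) n := by
  rw [dft, ZMod.dft_apply, sum_zmod_eq_sum_range]
  congr 1
  refine Finset.sum_congr rfl fun l hl => ?_
  have h := ZMod.stdAddChar_coe (N := M) (-((l : ℤ) * n))
  push_cast at h
  rw [h, ZMod.val_cast_of_lt (by simpa using hl), smul_eq_mul, mul_comm]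
  congr 2
  ring

lemma sqrt_mul_dft (n : ℤ) :
    (Real.sqrt M : ℂ) * dft M f n = ZMod.dft (fun a : ZMod M => f (a.val : ℤ)) n := by
  have : (Real.sqrt M : ℂ) ≠ 0 := by
    simp [NeZero.ne M]
  rw [dft_eq_zmod_dft]
  field_simp

omit [NeZero M] in
lemma norm_dft_le (n : ℤ) :
    ‖dft M f n‖ ≤ ‖1 / (Real.sqrt M : ℂ)‖ * ∑ l ∈ Finset.range M, ‖f (l : ℤ)‖ := by
  rw [dft, norm_mul]
  gcongr
  refine (norm_sum_le _ _).trans (Finset.sum_le_sum fun l _ => ?_)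
  rw [norm_mul, show -2 * I * (Real.pi : ℂ) * (l : ℂ) * (n : ℂ) / (M : ℂ) =
    ((-2 * Real.pi * l * n / M : ℝ) : ℂ) * I by push_cast; ring, norm_exp_ofReal_mul_I, mul_one]

lemma exists_norm_dft_le (M : ℕ) [NeZero M] (f : ℤ → ℂ) :
    ∃ B : ℝ, 0 ≤ B ∧ ∀ n : ℤ, ‖dft M f n‖ ≤ B :=
  ⟨_, by positivity, norm_dft_le⟩

lemma comp_neg_val (hf : Function.Periodic f (M : ℤ)) (a : ZMod M) :
    f ((-a).val : ℤ) = f (-(a.val : ℤ)) := by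
  rw [← intCast_val_apply hf (-(a.val : ℤ))]
  simp

lemma OppositeParity.apply_neg {j : ℕ} (h : OppositeParity j f) (n : ℤ) :
    f (-n) = -(-1) ^ j * f n := by
  rcases h with ⟨hj, h⟩ | ⟨hj, h⟩
  · rw [hj.neg_one_pow, h]; ring
  · rw [hj.neg_one_pow, h]; ring

lemma dft_neg {j : ℕ} (hf : Function.Periodic f (M : ℤ)) (h : OppositeParity j f) (n : ℤ) :
    dft M f (-n) = -(-1) ^ j * dft M f n := by
  rw [dft_eq_zmod_dft, dft_eq_zmod_dft, Int.cast_neg,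
    ← congrFun (ZMod.dft_comp_neg (fun a : ZMod M => f (a.val : ℤ))) (n : ZMod M)]
  have : (fun a : ZMod M => f ((-a).val : ℤ)) = fun a => -(-1) ^ j * f (a.val : ℤ) := by
    funext a
    rw [comp_neg_val hf, h.apply_neg]
  rw [this, ZMod.dft_const_mul]
  ring

omit [NeZero M] in
lemma sum_range_eq_sum_Icc (hf : Function.Periodic f (M : ℤ)) :
    ∑ l ∈ Finset.range M, f (l : ℤ) = ∑ m ∈ Finset.Icc 1 M, f (m : ℤ) := by
  have h1 := Finset.sum_range_succ (fun l : ℕ => f (l : ℤ)) M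
  have h2 := Finset.sum_range_succ' (fun l : ℕ => f (l : ℤ)) M
  have h3 : f (M : ℤ) = f 0 := by simpa using hf 0
  have h4 : ∑ m ∈ Finset.Icc 1 M, f (m : ℤ) = ∑ l ∈ Finset.range M, f ((l + 1 : ℕ) : ℤ) := by
    rw [Finset.range_eq_Ico, Finset.sum_Ico_add' (fun l : ℕ => f (l : ℤ)) 0 M 1]
    congr 1
  rw [h4]
  rw [h1, h3] at h2
  exact add_right_cancel h2

/-- This discards the zero frequency in Poisson summation, the only place where the Fourier
transform of the summand is not a Laplace integral. -/
lemma dft_zero (hf : Function.Periodic f (M : ℤ)) (h0 : mean M f = 0) : dft M f 0 = 0 := by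
  rw [mean, ← sum_range_eq_sum_Icc hf] at h0
  have : (M : ℂ) ≠ 0 := Nat.cast_ne_zero.mpr (NeZero.ne M)
  simp [this] at h0
  simp [dft, h0]

lemma LFunction_nat_add_one (Ψ : ZMod M → ℂ) {m : ℕ} (hm : 1 ≤ m) :
    HasSum (fun k : ℕ => Ψ ((k + 1 : ℕ) : ZMod M) / ((k : ℂ) + 1) ^ (m + 1))
      (ZMod.LFunction Ψ (m + 1)) := by
  have hs : 1 < ((m : ℂ) + 1).re := by
    simp; omega
  have h := (ZMod.LSeriesSummable_of_one_lt_re Ψ hs).hasSum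
  rw [← LSeries, ← ZMod.LFunction_eq_LSeries Ψ hs, ← hasSum_nat_add_iff' 1] at h
  have e : ∀ k : ℕ, LSeries.term (fun n : ℕ => Ψ n) ((m : ℂ) + 1) (k + 1) =
      Ψ ((k + 1 : ℕ) : ZMod M) / ((k : ℂ) + 1) ^ (m + 1) := by
    intro k
    rw [LSeries.term_of_ne_zero (by omega)]
    congr 1
    rw [show (m : ℂ) + 1 = ((m + 1 : ℕ) : ℂ) by push_cast; ring, cpow_natCast]
    push_cast
    rfl
  simp only [e] at h
  simpa using h

/-- The functional equation at s = 2p + j + 1, where s ≥ 2 ensures absolute convergence of the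
Dirichlet series of the dual function. The excluded value p = j = 0 is treated by Abel summation in
`Lfun_zero`. -/
lemma hasSum_Lfun_neg {j p : ℕ} (hf : Function.Periodic f (M : ℤ)) (h : OppositeParity j f)
    (hm : 1 ≤ 2 * p + j) :
    HasSum (fun k : ℕ => (Real.sqrt M : ℂ) * I / Real.pi * (I * M / (2 * Real.pi)) ^ (2 * p + j) *
      (2 * p + j).factorial * (dft M f ((k : ℤ) + 1) / ((k : ℂ) + 1) ^ (2 * p + j + 1)))
      (Lfun M f (-2 * (p : ℂ) - j)) := by
  set Φ : ZMod M → ℂ := fun a => f (a.val : ℤ) with hΦ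
  set m := 2 * p + j with hmdef
  have hM : (M : ℂ) ≠ 0 := Nat.cast_ne_zero.mpr (NeZero.ne M)
  have hpi : (Real.pi : ℂ) ≠ 0 := ofReal_ne_zero.mpr Real.pi_ne_zero
  have hneg : (fun a : ZMod M => Φ (-a)) = fun a => -(-1) ^ j * Φ a := by
    funext a
    simp only [hΦ]
    rw [comp_neg_val hf, h.apply_neg]
  have hFE := ZMod.LFunction_one_sub Φ (s := (m : ℂ) + 1)
    (by
      intro n hn
      have : ((m + 1 + n : ℕ) : ℂ) = 0 := by push_cast; rw [hn]; ring
      exact absurd (Nat.cast_eq_zero.mp this) (by omega))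
    (Or.inr (by
      intro hn
      have : (m : ℂ) = 0 := by linear_combination hn
      exact absurd (Nat.cast_eq_zero.mp this) (by omega)))
  have hL : Lfun M f (-2 * (p : ℂ) - j) = ZMod.LFunction Φ (1 - ((m : ℂ) + 1)) := by
    rw [Lfun]
    congr 1
    simp only [hmdef]
    push_cast
    ring
  have hs := LFunction_nat_add_one (ZMod.dft Φ) hm
  have hneg' : ZMod.LFunction (fun a => -(-1) ^ j * ZMod.dft Φ a) ((m : ℂ) + 1) =
      -(-1) ^ j * ZMod.LFunction (ZMod.dft Φ) ((m : ℂ) + 1) := by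
    simp only [ZMod.LFunction, Finset.mul_sum]
    refine Finset.sum_congr rfl fun a _ => ?_
    ring
  have hE1 : cexp (Real.pi * I * ((m : ℂ) + 1) / 2) = I ^ (m + 1) := by
    rw [show (Real.pi : ℂ) * I * ((m : ℂ) + 1) / 2 = ((m + 1 : ℕ) : ℂ) * (Real.pi / 2 * I) by
      push_cast; ring, exp_nat_mul, exp_pi_div_two_mul_I]
  have hE2 : cexp (-Real.pi * I * ((m : ℂ) + 1) / 2) = (-I) ^ (m + 1) := by
    rw [show -(Real.pi : ℂ) * I * ((m : ℂ) + 1) / 2 = ((m + 1 : ℕ) : ℂ) * (-(Real.pi / 2 * I)) by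
      push_cast; ring, exp_nat_mul, exp_neg, exp_pi_div_two_mul_I, inv_I]
  rw [hL, hFE, hneg, ZMod.dft_const_mul, hneg', hE1, hE2, add_sub_cancel_right, cpow_natCast,
    cpow_neg, show (m : ℂ) + 1 = ((m + 1 : ℕ) : ℂ) by push_cast; ring, cpow_natCast]
  rw [show ((m + 1 : ℕ) : ℂ) = (m : ℂ) + 1 by push_cast; ring, Gamma_nat_eq_factorial]
  -- Opposite parities make the two exponential terms of the functional equation equal, so that they
  -- add up to 2 I^(m+1) instead of cancelling.
  have hsign : (-I) ^ (m + 1) * (-(-1) ^ j) = I ^ (m + 1) := by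
    rw [neg_pow, hmdef]
    have : ((-1 : ℂ)) ^ (2 * p + j + 1) * (-(-1) ^ j) = 1 := by
      rw [pow_succ, pow_add, pow_mul]
      have : ((-1 : ℂ)) ^ j * (-1) ^ j = 1 := by rw [← mul_pow]; simp
      simp [this]
    linear_combination I ^ (2 * p + j + 1) * this
  have := hs.mul_left ((M : ℂ) ^ m * ((2 * (Real.pi : ℂ)) ^ (m + 1))⁻¹ * m.factorial * (2 * I ^ (m + 1)))
  convert! this using 1
  · funext k
    rw [show ZMod.dft Φ ((k + 1 : ℕ) : ZMod M) = (Real.sqrt M : ℂ) * dft M f ((k : ℤ) + 1) by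
      rw [sqrt_mul_dft]; push_cast; rfl]
    rw [div_pow, mul_pow, mul_pow, pow_succ I, mul_pow 2 _ (m + 1), pow_succ 2,
      pow_succ (Real.pi : ℂ)]
    field_simp
  · linear_combination (M : ℂ) ^ m * ((2 * (Real.pi : ℂ)) ^ (m + 1))⁻¹ * m.factorial *
      ZMod.LFunction (ZMod.dft Φ) ((m : ℂ) + 1) * hsign

end Fourier

/-! ### The Borel transform -/

/-- The singular point `πi n² / M` of the Borel transform, for `n = k + 1`. -/
def singPoint (M k : ℕ) : ℂ := Real.pi * I * ((k : ℂ) + 1) ^ 2 / M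

/-- The constant factor of the Borel transform. -/
def borelConst (j M : ℕ) : ℂ := I * Real.sqrt M / Real.pi * (M / (2 * Real.pi * I)) ^ j

/-- The coefficients of the expansion of the Borel transform into singular functions. -/
def borelCoeff (j : ℕ) (f : ℤ → ℂ) (M k : ℕ) : ℂ :=
  borelConst j M * (dft M f ((k : ℤ) + 1) / ((k : ℂ) + 1) ^ (j + 1))

/-- A sum of singular functions with given branches of the square roots. -/
def singSum (P : ℂ[X]) (M : ℕ) (a e : ℕ → ℂ) (ξ : ℂ) : ℂ :=
  ∑' k, a k / singPoint M k * germ P (e k) (1 - ξ / singPoint M k)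

/-- A branch of the Borel transform. -/
def borelBranch (j : ℕ) (f : ℤ → ℂ) (M : ℕ) (e : ℕ → ℂ) : ℂ → ℂ :=
  singSum (opD (singPoly j)) M (borelCoeff j f M) e

section

variable {M : ℕ} [NeZero M] {f : ℤ → ℂ} {j : ℕ}

lemma natCast_add_one_ne_zero (k : ℕ) : (k : ℂ) + 1 ≠ 0 := by exact_mod_cast Nat.succ_ne_zero k

lemma cast_M_ne_zero : (M : ℂ) ≠ 0 := Nat.cast_ne_zero.mpr (NeZero.ne M)

lemma cast_M_pos : (0 : ℝ) < M := Nat.cast_pos.mpr (NeZero.pos M)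

lemma pi_ne_zero' : (Real.pi : ℂ) ≠ 0 := ofReal_ne_zero.mpr Real.pi_ne_zero

lemma singPoint_ne_zero (k : ℕ) : singPoint M k ≠ 0 := by
  have := natCast_add_one_ne_zero k
  have := cast_M_ne_zero (M := M)
  simp [singPoint, *]

omit [NeZero M] in
lemma norm_singPoint (k : ℕ) : ‖singPoint M k‖ = Real.pi * ((k : ℝ) + 1) ^ 2 / M := by
  have h : ‖(k : ℂ) + 1‖ = (k : ℝ) + 1 := by
    rw [show (k : ℂ) + 1 = ((k + 1 : ℕ) : ℂ) by push_cast; ring, norm_natCast]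
    push_cast; ring
  rw [singPoint, norm_div, norm_mul, norm_mul, norm_pow, h]
  simp [abs_of_pos Real.pi_pos]

lemma norm_singPoint_ge (k : ℕ) : Real.pi / M * (k + 1) ≤ ‖singPoint M k‖ := by
  rw [norm_singPoint, mul_div_right_comm]
  have : (0 : ℝ) ≤ k := k.cast_nonneg
  have := cast_M_pos (M := M)
  gcongr
  nlinarith

lemma pi_div_le_norm_singPoint (k : ℕ) : Real.pi / M ≤ ‖singPoint M k‖ := by
  have h : (1 : ℝ) ≤ k + 1 := by
    have : (0 : ℝ) ≤ k := k.cast_nonneg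
    linarith
  have h2 : 0 < Real.pi / M := div_pos Real.pi_pos cast_M_pos
  nlinarith [norm_singPoint_ge (M := M) k]

/-- The factorial (2p + j)! from the functional equation, divided by p!, is exactly what the Taylor
coefficients of the singular functions supply; the remaining powers assemble into ω_k^(-p). -/
lemma hasSum_coeff_thetaTilde {p : ℕ} (hf : Function.Periodic f (M : ℤ)) (h : OppositeParity j f)
    (hm : 1 ≤ 2 * p + j) :
    HasSum (fun k : ℕ => borelCoeff j f M k * ((opD^[p] (singPoly j)).eval 1 / singPoint M k ^ p))
      (PowerSeries.coeff p (thetaTilde j f M)) := by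
  have h1 := (hasSum_Lfun_neg hf h hm).mul_left
    ((1 / (p.factorial : ℂ)) * ((Real.pi : ℂ) * I / (M : ℂ)) ^ p)
  rw [thetaTilde, PowerSeries.coeff_mk]
  convert! h1 using 1
  · funext k
    have hk := natCast_add_one_ne_zero k
    have hM := cast_M_ne_zero (M := M)
    have hp := pi_ne_zero'
    rw [eval_one_opD_iterate_singPoly, borelCoeff, borelConst, singPoint]
    have e1 : (I * M / (2 * Real.pi) : ℂ) ^ (2 * p + j) =
        (-(M : ℂ) ^ 2 / (4 * Real.pi ^ 2)) ^ p * ((-1) ^ j * (M / (2 * Real.pi * I)) ^ j) := by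
      rw [pow_add, pow_mul, ← mul_pow]
      congr 2
      · field_simp
        rw [I_sq]; ring
      · field_simp
        rw [I_sq]
    rw [e1]
    have e2 : (-(M : ℂ) ^ 2 / (4 * Real.pi ^ 2)) ^ p * ((Real.pi : ℂ) * I / (M : ℂ)) ^ p =
        1 / (4 ^ p * ((Real.pi : ℂ) * I / M) ^ p) := by
      rw [← mul_pow, ← mul_pow, ← one_div_pow]
      congr 1
      field_simp
      rw [I_sq]; ring
    rw [show ((Real.pi : ℂ) * I * ((k : ℂ) + 1) ^ 2 / M) ^ p =
      ((Real.pi : ℂ) * I / M) ^ p * ((k : ℂ) + 1) ^ (2 * p) by rw [pow_mul, ← mul_pow]; ring]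
    rw [show 2 * p + j + 1 = 2 * p + (j + 1) by ring, pow_add _ (2 * p) (j + 1)]
    have hne : ((Real.pi : ℂ) * I / M) ^ p ≠ 0 := by simp [hM]
    have hfac : (p.factorial : ℂ) ≠ 0 := Nat.cast_ne_zero.mpr p.factorial_ne_zero
    generalize ((Real.pi : ℂ) * I / M) ^ p = c at *
    generalize (-(M : ℂ) ^ 2 / (4 * Real.pi ^ 2)) ^ p = c' at *
    have e3 : c' = 1 / (4 ^ p * c * c) := by
      field_simp at e2 ⊢
      linear_combination e2
    rw [e3]
    field_simp
  · ring

lemma exists_borelCoeff_le (j : ℕ) (f : ℤ → ℂ) (M : ℕ) [NeZero M] :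
    ∃ B : ℝ, 0 ≤ B ∧ ∀ k, ‖borelCoeff j f M k‖ ≤ B / ((k : ℝ) + 1) ^ (j + 1) := by
  obtain ⟨B, hB, h⟩ := exists_norm_dft_le M f
  refine ⟨‖borelConst j M‖ * B, by positivity, fun k => ?_⟩
  have hk : ‖(k : ℂ) + 1‖ = (k : ℝ) + 1 := by
    rw [show (k : ℂ) + 1 = ((k + 1 : ℕ) : ℂ) by push_cast; ring, norm_natCast]
    push_cast; ring
  rw [borelCoeff, norm_mul, norm_div, norm_pow, hk, mul_div_assoc]
  gcongr
  exact h _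

lemma summable_norm_borelCoeff_div (j : ℕ) (f : ℤ → ℂ) (M : ℕ) [NeZero M] :
    Summable (fun k => ‖borelCoeff j f M k / singPoint M k‖) := by
  obtain ⟨B, hB, h⟩ := exists_borelCoeff_le j f M
  have hs : Summable (fun k : ℕ => B * (M / Real.pi) * (1 / ((k : ℝ) + 1) ^ 2)) := by
    have := (summable_nat_add_iff 1).mpr (Real.summable_one_div_nat_pow.mpr (one_lt_two))
    refine Summable.mul_left _ ?_
    simpa using this
  refine hs.of_nonneg_of_le (fun _ => norm_nonneg _) fun k => ?_
  have hM := cast_M_pos (M := M)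
  have hk : (1 : ℝ) ≤ (k : ℝ) + 1 := by
    have : (0 : ℝ) ≤ k := k.cast_nonneg
    linarith
  rw [norm_div, norm_singPoint]
  have h1 : ‖borelCoeff j f M k‖ ≤ B := (h k).trans (div_le_self hB (one_le_pow₀ hk))
  calc ‖borelCoeff j f M k‖ / (Real.pi * ((k : ℝ) + 1) ^ 2 / M)
      ≤ B / (Real.pi * ((k : ℝ) + 1) ^ 2 / M) := by gcongr
    _ = _ := by field_simp

/-- Near the origin all branches coincide and represent the Borel transform. -/
lemma isBorelTransform_borelBranch (hf : Function.Periodic f (M : ℤ)) (h : OppositeParity j f)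
    {e : ℕ → ℂ} (he : ∀ k, e k = 1 ∨ e k = I ∨ e k = -I) :
    IsBorelTransform (thetaTilde j f M) (borelBranch j f M e) := by
  have hpos : 0 < Real.pi / M := div_pos Real.pi_pos cast_M_pos
  filter_upwards [Metric.ball_mem_nhds (0 : ℂ) hpos] with ξ hξ
  rw [mem_ball_zero_iff] at hξ
  obtain ⟨P, hP⟩ : ∃ P, P = opD (singPoly j) := ⟨_, rfl⟩
  set r : ℝ := ‖ξ‖ / (Real.pi / M) with hr
  have hr1 : r < 1 := (div_lt_one hpos).mpr hξ
  have hr0 : 0 ≤ r := by positivity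
  have hquot : ∀ k, ‖ξ / singPoint M k‖ ≤ r := by
    intro k
    rw [norm_div, hr]
    gcongr
    exact pi_div_le_norm_singPoint k
  have hkey : ∀ k, HasSum (fun p : ℕ => (opD^[p] P).eval 1 / p.factorial * (ξ / singPoint M k) ^ p)
      (germ P (e k) (1 - ξ / singPoint M k)) := by
    intro k
    have hlt : ‖ξ / singPoint M k‖ < 1 := (hquot k).trans_lt hr1
    rw [germ_eq_germ_one P (he k)]
    · exact hasSum_germ P hlt
    · have := (abs_re_le_norm (ξ / singPoint M k)).trans_lt hlt
      rw [abs_lt] at this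
      simp only [sub_re, one_re]
      linarith
  -- The modulus of every ratio ξ/ω_k is at most r < 1, so one absolutely convergent Taylor series
  -- at r dominates all terms of the double series.
  have habs : Summable fun p : ℕ => ‖(opD^[p] P).eval 1 / (p.factorial : ℂ)‖ * r ^ p := by
    have hrn : ‖(r : ℂ)‖ < 1 := by rw [norm_real]; simpa [abs_of_nonneg hr0] using hr1
    have := (hasSum_germ P hrn).summable.norm
    simpa [abs_of_nonneg hr0] using this
  set F : ℕ × ℕ → ℂ := fun x => borelCoeff j f M x.1 / singPoint M x.1 *
    ((opD^[x.2] P).eval 1 / x.2.factorial * (ξ / singPoint M x.1) ^ x.2) with hF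
  have hFs : Summable F := by
    refine Summable.of_norm_bounded ((summable_norm_borelCoeff_div j f M).mul_of_nonneg habs
      (fun _ => norm_nonneg _) (fun _ => by positivity)) fun x => ?_
    rw [hF, norm_mul, norm_mul, norm_pow]
    gcongr
    exact hquot _
  have h1 : HasSum F (borelBranch j f M e ξ) := by
    have hfib : ∀ k, HasSum (fun p => F (k, p)) (borelCoeff j f M k / singPoint M k *
        germ P (e k) (1 - ξ / singPoint M k)) :=
      fun k => HasSum.mul_left (borelCoeff j f M k / singPoint M k) (hkey k)
    have hS := hFs.hasSum
    have hfib' := HasSum.prod_fiberwise hS hfib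
    rw [borelBranch, singSum, ← hP, hfib'.tsum_eq]
    exact hS
  have h2 : HasSum (fun x : ℕ × ℕ => F (x.2, x.1)) (borelBranch j f M e ξ) :=
    (Equiv.prodComm ℕ ℕ).hasSum_iff.mpr h1
  have h3 : ∀ p : ℕ, HasSum (fun k : ℕ => F (k, p))
      (PowerSeries.coeff (p + 1) (thetaTilde j f M) * ξ ^ p / (p.factorial : ℂ)) := by
    intro p
    -- The Borel transform uses the coefficient of index p + 1. This accounts for one extra `opD`,
    -- and it keeps the index away from the exceptional value L(0, f).
    have h4 := (hasSum_coeff_thetaTilde (p := p + 1) hf h (by omega)).mul_right (ξ ^ p / p.factorial)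
    have h5 : ∀ k, F (k, p) = borelCoeff j f M k * ((opD^[p + 1] (singPoly j)).eval 1 /
        singPoint M k ^ (p + 1)) * (ξ ^ p / p.factorial) := by
      intro k
      have := singPoint_ne_zero (M := M) k
      simp only [hF, hP, Function.iterate_succ_apply]
      rw [div_pow, pow_succ]
      field_simp
    rw [mul_div_assoc]
    simpa only [h5] using h4
  exact h2.prod_fiberwise h3

/-! ### Convergence and analyticity of the sums of singular functions. -/

lemma exists_norm_div_singPoint_le (M : ℕ) [NeZero M] (ξ₀ : ℂ) :
    ∃ K : ℕ, ∀ ξ ∈ Metric.ball ξ₀ 1, ∀ k, K ≤ k → ‖ξ / singPoint M k‖ ≤ 1 / 2 := by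
  obtain ⟨K, hK⟩ := exists_nat_ge (2 * (‖ξ₀‖ + 1) * (M / Real.pi))
  refine ⟨K, fun ξ hξ k hk => ?_⟩
  have h1 : ‖ξ‖ ≤ ‖ξ₀‖ + 1 := by
    have h2 : ‖ξ - ξ₀‖ < 1 := by simpa [dist_eq_norm] using hξ
    have h3 := norm_add_le (ξ - ξ₀) ξ₀
    rw [sub_add_cancel] at h3
    linarith
  have h4 : 2 * (‖ξ₀‖ + 1) ≤ ‖singPoint M k‖ := by
    refine le_trans ?_ (norm_singPoint_ge k)
    have h5 : (K : ℝ) ≤ k := by exact_mod_cast hk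
    have h6 : 2 * (‖ξ₀‖ + 1) * (M / Real.pi) ≤ k + 1 := by linarith
    have hM := cast_M_pos (M := M)
    have hpi := Real.pi_pos
    calc 2 * (‖ξ₀‖ + 1) = Real.pi / M * (2 * (‖ξ₀‖ + 1) * (M / Real.pi)) := by field_simp
      _ ≤ _ := by gcongr
  rw [norm_div, div_le_iff₀ (norm_pos_iff.mpr (singPoint_ne_zero k))]
  linarith

/-- The points ω_k tend to infinity, so for large k the argument 1 - ξ/ω_k has modulus at least 1/2,
uniformly for ξ in a unit ball. -/
lemma exists_norm_term_le (P : ℂ[X]) (a : ℕ → ℂ) {e : ℕ → ℂ} (he : ∀ k, ‖e k‖ = 1) (ξ₀ : ℂ) :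
    ∃ (K : ℕ) (B : ℝ), ∀ ξ ∈ Metric.ball ξ₀ 1, ∀ k, K ≤ k →
      ‖a k / singPoint M k * germ P (e k) (1 - ξ / singPoint M k)‖ ≤
        ‖a k / singPoint M k‖ * B := by
  obtain ⟨K, hK⟩ := exists_norm_div_singPoint_le M ξ₀
  obtain ⟨B, hB, hBle⟩ := norm_germ_le P (c := 1 / 2) (by norm_num)
  refine ⟨K, B, fun ξ hξ k hk => ?_⟩
  rw [norm_mul]
  gcongr
  apply hBle _ _ (he k)
  have h1 := norm_sub_norm_le (1 : ℂ) (ξ / singPoint M k)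
  have h2 := hK ξ hξ k hk
  rw [norm_one] at h1
  linarith

lemma summable_singSum (P : ℂ[X]) {a e : ℕ → ℂ} (ha : Summable fun k => ‖a k / singPoint M k‖)
    (he : ∀ k, ‖e k‖ = 1) (ξ : ℂ) :
    Summable fun k => a k / singPoint M k * germ P (e k) (1 - ξ / singPoint M k) := by
  obtain ⟨K, B, h⟩ := exists_norm_term_le (M := M) P a he ξ
  rw [← summable_nat_add_iff K]
  exact Summable.of_norm_bounded (((summable_nat_add_iff K).mpr ha).mul_right B)
    fun k => h ξ (Metric.mem_ball_self one_pos) _ (by omega)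

/-- The branches are analytic away from their cuts. -/
lemma analyticAt_singSum (P : ℂ[X]) {a e : ℕ → ℂ} (ha : Summable fun k => ‖a k / singPoint M k‖)
    (he : ∀ k, ‖e k‖ = 1) {N : ℕ} (heN : ∀ k, N ≤ k → e k = 1) {ξ₀ : ℂ}
    (h : ∀ k, a k = 0 ∨ e k * (1 - ξ₀ / singPoint M k) ∈ slitPlane) :
    AnalyticAt ℂ (singSum P M a e) ξ₀ := by
  obtain ⟨K₁, B, hbound'⟩ := exists_norm_term_le (M := M) P a he ξ₀
  obtain ⟨K₀, hhalf'⟩ := exists_norm_div_singPoint_le M ξ₀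
  obtain ⟨K, hK₁, hK₀, hKN⟩ : ∃ K, K₁ ≤ K ∧ K₀ ≤ K ∧ N ≤ K :=
    ⟨K₁ + K₀ + N, by omega, by omega, by omega⟩
  set F : ℕ → ℂ → ℂ := fun k ξ => a k / singPoint M k *
    germ P (e k) (1 - ξ / singPoint M k) with hF
  have hanF : ∀ k ξ, e k * (1 - ξ / singPoint M k) ∈ slitPlane → AnalyticAt ℂ (F k) ξ := by
    intro k ξ hk
    have h1 : AnalyticAt ℂ (fun ξ : ℂ => 1 - ξ / singPoint M k) ξ := by
      have := singPoint_ne_zero (M := M) k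
      fun_prop (disch := assumption)
    exact analyticAt_const.mul (AnalyticAt.comp (g := germ P (e k))
      (f := fun ξ : ℂ => 1 - ξ / singPoint M k) (analyticAt_germ P hk) h1)
  -- Only finitely many cuts can come near ξ₀: the tail is a normally convergent series of
  -- holomorphic functions on the unit ball, and the finite head is treated term by term.
  have htail : DifferentiableOn ℂ (fun ξ => ∑' k, F (k + K) ξ) (Metric.ball ξ₀ 1) := by
    refine differentiableOn_tsum_of_summable_norm
      (u := fun k => ‖a (k + K) / singPoint M (k + K)‖ * B) ?_ ?_
      Metric.isOpen_ball fun k ξ hξ => hbound' ξ hξ _ (by omega)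
    · exact ((summable_nat_add_iff K).mpr ha).mul_right B
    · intro k ξ hξ
      refine (hanF _ _ ?_).differentiableAt.differentiableWithinAt
      rw [heN _ (by omega), one_mul]
      apply one_sub_mem_slitPlane
      have := hhalf' ξ hξ (k + K) (by omega)
      linarith
  have htail' : AnalyticAt ℂ (fun ξ => ∑' k, F (k + K) ξ) ξ₀ :=
    htail.analyticAt (Metric.ball_mem_nhds _ one_pos)
  have hhead : AnalyticAt ℂ (fun ξ => ∑ k ∈ Finset.range K, F k ξ) ξ₀ := by
    refine Finset.analyticAt_fun_sum _ fun k _ => ?_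
    rcases h k with h0 | h0
    · simp only [hF, h0, zero_div, zero_mul]
      exact analyticAt_const
    · exact hanF k ξ₀ h0
  refine (hhead.add htail').congr (Eventually.of_forall fun ξ => ?_)
  exact Summable.sum_add_tsum_nat_add K (summable_singSum P ha he ξ)

end

/-! ### Singularities and formal monomials -/

lemma major_add (ψ χ : AddMonoidAlgebra ℂ ℚ) (w : ℂ) :
    major (ψ + χ) w = major ψ w + major χ w := by
  rw [major, AddMonoidAlgebra.coeff_add]
  exact Finsupp.sum_add_index' (fun _ => by simp) (fun _ _ _ => by ring)

lemma major_smul (c : ℂ) (ψ : AddMonoidAlgebra ℂ ℚ) (w : ℂ) :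
    major (c • ψ) w = c * major ψ w := by
  rw [major, AddMonoidAlgebra.coeff_smul, Finsupp.sum_smul_index' (fun _ => by simp), major,
    Finsupp.sum, Finsupp.sum, Finset.mul_sum]
  refine Finset.sum_congr rfl fun _ _ => ?_
  rw [smul_eq_mul]; ring

lemma major_single (s : ℚ) (c : ℂ) (w : ℂ) :
    major (AddMonoidAlgebra.single s c) w = c * monoMajor s w := by
  rw [major, AddMonoidAlgebra.coeff_single, Finsupp.sum_single_index (by simp)]

/-- The finite sum of monomials that corresponds to the singularity `v ^ (-1/2) p(1/v)`,
`v = 1 - ξ / d ^ 2`, at the point `d ^ 2`. -/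
def singToMono (d : ℂ) : ℂ[X] →ₗ[ℂ] AddMonoidAlgebra ℂ ℚ :=
  Polynomial.lsum fun i => LinearMap.toSpanSingleton ℂ (AddMonoidAlgebra ℂ ℚ)
    (AddMonoidAlgebra.single (1 / 2 - (i : ℚ))
      (-2 * Real.pi * I * d ^ (2 * i + 1) / Gamma (1 / 2 + i)))

lemma singToMono_monomial (d : ℂ) (i : ℕ) (a : ℂ) :
    singToMono d (monomial i a) = AddMonoidAlgebra.single (1 / 2 - (i : ℚ))
      (a * (-2 * Real.pi * I * d ^ (2 * i + 1) / Gamma (1 / 2 + i))) := by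
  rw [singToMono, Polynomial.lsum_apply, sum_monomial_index _ _ (by simp)]
  simp only [LinearMap.toSpanSingleton_apply, AddMonoidAlgebra.smul_single, smul_eq_mul]

lemma opD_monomial (i : ℕ) (a : ℂ) :
    opD (monomial i a) = monomial (i + 1) ((1 / 2 + i) * a) := by
  rw [← C_mul_X_pow_eq_monomial, opD_C_mul, ← C_mul_X_pow_eq_monomial, opD, derivative_X_pow]
  rcases i with _ | i
  · simp; ring
  · simp; ring

lemma opD_add (p q : ℂ[X]) : opD (p + q) = opD p + opD q := by
  simp only [opD, derivative_add]; ring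

/-- `opD` is d² ∂_ξ at the singular point d², and ∂_ξ corresponds to τ⁻¹; together they give the
square of d τ^(-1/2). In coefficients this is Γ(z + 1) = z Γ(z). -/
lemma singToMono_opD (d : ℂ) (p : ℂ[X]) :
    singToMono d (opD p) = (mono (-1 / 2) d) ^ 2 * singToMono d p := by
  induction p using Polynomial.induction_on' with
  | add p q hp hq => rw [opD_add, map_add, map_add, hp, hq, mul_add]
  | monomial i a =>
    rw [opD_monomial, singToMono_monomial, singToMono_monomial, mono, AddMonoidAlgebra.single_pow,
      AddMonoidAlgebra.single_mul_single]
    congr 1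
    · simp; ring
    · have h0 : (1 / 2 + i : ℂ) ≠ 0 := by
        rw [show (1 / 2 + i : ℂ) = ((1 / 2 + i : ℝ) : ℂ) by push_cast; ring]
        exact ofReal_ne_zero.mpr (by positivity)
      rw [show (1 / 2 + ((i + 1 : ℕ) : ℂ)) = (1 / 2 + i) + 1 by push_cast; ring,
        Gamma_add_one _ h0]
      have hG : Gamma (1 / 2 + i : ℂ) ≠ 0 := by
        refine Gamma_ne_zero_of_re_pos ?_
        simp
        positivity
      have h1 : (1 + 2 * i : ℂ) ≠ 0 := fun h => h0 (by linear_combination h / 2)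
      generalize Gamma (1 / 2 + i : ℂ) = G at *
      rw [show (1 / 2 + i : ℂ) = (1 + 2 * i) / 2 by ring]
      field_simp
      ring

lemma aeval_signedHermite_succ_succ {A : Type*} [CommRing A] [Algebra ℤ A] (k : ℕ) (x : A) :
    aeval x (signedHermite (k + 2)) = -2 * x * aeval x (signedHermite (k + 1)) -
      2 * ((k : A) + 1) * aeval x (signedHermite k) := by
  simp [signedHermite, map_ofNat (aeval x) 2]

/-- Since `opD` acts as multiplication by y², y = d τ^(-1/2), the recursion of `singPoly` is the
Hermite recursion for y^j times the j-th signed Hermite polynomial at y. -/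
lemma singToMono_singPoly (d : ℂ) (j : ℕ) :
    singToMono d (singPoly j) = mono (-1 / 2) d ^ j * aeval (mono (-1 / 2) d) (signedHermite j) *
      singToMono d 1 := by
  induction j using Nat.strong_induction_on with
  | _ j ih =>
    match j with
    | 0 => simp [signedHermite, singPoly]
    | 1 =>
      rw [singPoly_one, ← smul_eq_C_mul, map_smul, singToMono_opD, singPoly, Algebra.smul_def,
        map_neg, map_ofNat]
      simp only [signedHermite, map_neg, map_mul, aeval_X, map_ofNat (aeval (mono (-1 / 2) d)) 2]
      ring
    | k + 2 =>
      rw [singPoly, map_sub, ← smul_eq_C_mul, ← smul_eq_C_mul, map_smul, map_smul, singToMono_opD,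
        singToMono_opD, ih k (by omega), ih (k + 1) (by omega), aeval_signedHermite_succ_succ,
        Algebra.smul_def, Algebra.smul_def]
      simp only [map_neg, map_ofNat, map_mul, map_add, map_natCast, map_one]
      ring

/-- The exponents are half-integers, so the logarithmic case of `monoMajor` never occurs. -/
lemma half_sub_den_ne_one (i : ℕ) : ((1 / 2 : ℚ) - i).den ≠ 1 := by
  intro h
  have h1 := Rat.den_eq_one_iff _ |>.mp h
  have h2 : (1 : ℚ) = ((2 * (((1 / 2 : ℚ) - i).num + i) : ℤ) : ℚ) := by
    push_cast
    rw [h1]; ring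
  have h3 : (1 : ℤ) = 2 * (((1 / 2 : ℚ) - i).num + i) := by exact_mod_cast h2
  omega

/-- Here z is a logarithm of the singular point ω = d², and w - z + πi is a logarithm of v = -(ξ -
ω)/ω, so the right-hand side is v^(-1/2) p(1/v) on the universal cover. -/
lemma major_singToMono {d z : ℂ} (w : ℂ) (hd : exp (z / 2) = d) (p : ℂ[X]) :
    major (singToMono d p) w =
      exp (-(w - z + Real.pi * I) / 2) * p.eval (exp (-(w - z + Real.pi * I))) := by
  induction p using Polynomial.induction_on' with
  | add p q hp hq => rw [map_add, major_add, hp, hq, eval_add, mul_add]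
  | monomial i a =>
    have hG : Gamma (1 / 2 + i : ℂ) ≠ 0 := by
      refine Gamma_ne_zero_of_re_pos ?_
      simp
      positivity
    rw [singToMono_monomial, major_single, monoMajor,
      if_neg (fun h => half_sub_den_ne_one i h.1), eval_monomial, ← exp_nat_mul, ← hd,
      ← exp_nat_mul]
    push_cast
    rw [show (1 : ℂ) - (1 / 2 - i) = 1 / 2 + i by ring]
    have hpi := pi_ne_zero'
    have key : exp ((2 * i + 1) * (z / 2)) * exp (I * Real.pi * (1 / 2 - i)) *
        exp ((1 / 2 - i - 1) * w) = -(exp (-(w - z + Real.pi * I) / 2) *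
          exp (i * -(w - z + Real.pi * I))) := by
      rw [← exp_add, ← exp_add, ← exp_add, ← neg_one_mul, ← exp_pi_mul_I, ← exp_add]
      congr 1
      ring
    generalize Gamma (1 / 2 + i : ℂ) = G at *
    calc _ = -a * (exp ((2 * i + 1) * (z / 2)) * exp (I * Real.pi * (1 / 2 - i)) *
        exp ((1 / 2 - i - 1) * w)) := by field_simp
      _ = _ := by rw [key]; ring

/-! ### The alien derivatives -/

/-- Each of the |S| + 1 possible values of #R contributes 1/(|S| + 1), because the binomial
coefficient cancels the two factorials. -/
lemma sum_weights (S : Finset ℝ) :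
    ∑ R ∈ S.powerset, ((R.card.factorial : ℂ) * ((S.card - R.card).factorial : ℂ) /
      ((S.card + 1).factorial : ℂ)) = 1 := by
  rw [Finset.sum_powerset_apply_card (fun m => ((m.factorial : ℂ) *
    ((S.card - m).factorial : ℂ) / ((S.card + 1).factorial : ℂ)))]
  have h : ∀ m ∈ Finset.range (S.card + 1), S.card.choose m • ((m.factorial : ℂ) *
      ((S.card - m).factorial : ℂ) / ((S.card + 1).factorial : ℂ)) = 1 / ((S.card : ℂ) + 1) := by
    intro m hm
    have h1 := Nat.choose_mul_factorial_mul_factorial (Finset.mem_range_succ_iff.mp hm)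
    have h2 : (S.card.factorial : ℂ) ≠ 0 := Nat.cast_ne_zero.mpr (Nat.factorial_ne_zero _)
    have h3 := natCast_add_one_ne_zero S.card
    rw [Nat.factorial_succ, nsmul_eq_mul]
    push_cast
    rw [← h1] at h2 ⊢
    push_cast at h2 ⊢
    field_simp
    exact div_self h2
  rw [Finset.sum_congr rfl h, Finset.sum_const, Finset.card_range, nsmul_eq_mul]
  have h3 := natCast_add_one_ne_zero S.card
  push_cast
  field_simp

section

variable {M : ℕ} [NeZero M] {f : ℤ → ℂ} {j : ℕ}

/-- A square root of `πi n² / M`, `n = k + 1`. -/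
def sqrtPoint (M k : ℕ) : ℂ := ((k : ℂ) + 1) * (Real.pi * I / M) ^ (1 / 2 : ℂ)

lemma pi_mul_I_div_ne_zero : (Real.pi * I / M : ℂ) ≠ 0 := by
  have := cast_M_ne_zero (M := M)
  have := pi_ne_zero'
  simp [*]

omit [NeZero M] in
lemma pi_mul_I_div_cpow_half_sq : ((Real.pi * I / M : ℂ) ^ (1 / 2 : ℂ)) ^ 2 = Real.pi * I / M := by
  rw [← cpow_nat_mul]
  norm_num

omit [NeZero M] in
lemma sqrtPoint_sq (k : ℕ) : sqrtPoint M k ^ 2 = singPoint M k := by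
  rw [sqrtPoint, mul_pow, pi_mul_I_div_cpow_half_sq, singPoint]
  ring

lemma exp_half_log_singPoint (k : ℕ) : exp (log (singPoint M k) / 2) = sqrtPoint M k := by
  have h : singPoint M k = (((k : ℝ) + 1) ^ 2 : ℝ) * (Real.pi * I / M) := by
    rw [singPoint]; push_cast; ring
  have hk : (0 : ℝ) < (k : ℝ) + 1 := by positivity
  rw [h, log_ofReal_mul (by positivity) pi_mul_I_div_ne_zero, add_div, exp_add, sqrtPoint,
    cpow_def_of_ne_zero pi_mul_I_div_ne_zero, Real.log_pow]
  congr 1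
  · rw [show (((2 : ℕ) * Real.log ((k : ℝ) + 1) : ℝ) : ℂ) / 2 = (Real.log ((k : ℝ) + 1) : ℂ) by
      push_cast; ring, ← ofReal_exp, Real.exp_log hk]
    push_cast
    ring
  · congr 1
    ring

lemma singPoint_div (m k : ℕ) :
    singPoint M m / singPoint M k = (((m : ℝ) + 1) ^ 2 / ((k : ℝ) + 1) ^ 2 : ℝ) := by
  have := natCast_add_one_ne_zero k
  have := cast_M_ne_zero (M := M)
  have := pi_ne_zero'
  rw [singPoint, singPoint]
  push_cast
  field_simp

open Classical in
/-- The directions of the cuts at `ω_k` that correspond to a way `R` of circumventing the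
singular points on the segment from `0` to `ω_m`. -/
def cutDir (m : ℕ) (R : Finset ℝ) (k : ℕ) : ℂ :=
  if k < m then (if (((k : ℝ) + 1) ^ 2 / ((m : ℝ) + 1) ^ 2) ∈ R then -I else I) else 1

lemma cutDir_cases (m : ℕ) (R : Finset ℝ) (k : ℕ) :
    cutDir m R k = 1 ∨ cutDir m R k = I ∨ cutDir m R k = -I := by
  unfold cutDir
  split_ifs <;> simp

lemma norm_cutDir (m : ℕ) (R : Finset ℝ) (k : ℕ) : ‖cutDir m R k‖ = 1 := by
  rcases cutDir_cases m R k with h | h | h <;> simp [h]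

lemma cutDir_of_le {m k : ℕ} (R : Finset ℝ) (h : m ≤ k) : cutDir m R k = 1 :=
  if_neg (by omega)

/-- The singular points on the segment from `0` to `ω_m`, relative to `ω_m`. -/
def singRatios (m : ℕ) : Finset ℝ :=
  (Finset.range m).image fun k : ℕ => ((k : ℝ) + 1) ^ 2 / ((m : ℝ) + 1) ^ 2

lemma singRatios_bounds {m : ℕ} {s : ℝ} (hs : s ∈ singRatios m) : 0 < s ∧ s < 1 := by
  simp only [singRatios, Finset.mem_image, Finset.mem_range] at hs
  obtain ⟨k, hk, rfl⟩ := hs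
  have hk' : (k : ℝ) < m := by exact_mod_cast hk
  refine ⟨by positivity, ?_⟩
  rw [div_lt_one (by positivity)]
  have : (0 : ℝ) ≤ k := k.cast_nonneg
  gcongr

lemma analyticOnNhd_borelBranch (m : ℕ) (R : Finset ℝ) (η : ℝ) :
    AnalyticOnNhd ℂ (borelBranch j f M (cutDir m R))
      (slitStrip (singPoint M m) (singRatios m) R η) := by
  rintro ζ ⟨x, y, rfl, -, hx1, -, hS⟩
  refine analyticAt_singSum _ (summable_norm_borelCoeff_div j f M) (norm_cutDir m R)
    (fun k => cutDir_of_le R) fun k => Or.inr ?_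
  set s : ℝ := ((k : ℝ) + 1) ^ 2 / ((m : ℝ) + 1) ^ 2 with hs
  have hs0 : 0 < s := by positivity
  have hv : 1 - singPoint M m * (x + y * I) / singPoint M k =
      ((1 - x / s : ℝ) : ℂ) + ((-y / s : ℝ) : ℂ) * I := by
    rw [mul_div_right_comm, singPoint_div, show ((m : ℝ) + 1) ^ 2 / ((k : ℝ) + 1) ^ 2 = s⁻¹ by
      rw [hs, inv_div]]
    push_cast
    field_simp
    ring
  rw [hv]
  by_cases hk : k < m
  · have hmem : s ∈ singRatios m := Finset.mem_image.mpr ⟨k, by simpa using hk, rfl⟩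
    have hsx := hS s hmem
    rw [cutDir, if_pos hk, ← hs]
    rw [mem_slitPlane_iff]
    -- For k < m the cut starts at ω_k, perpendicular to the segment, on the side that the path does
    -- not take. It lies on the line x = s, where only the other side belongs to the strip.
    by_cases hxs : x = s
    · left
      by_cases hR : s ∈ R
      · have := (hsx hxs).1 hR
        rw [if_pos hR]
        simp
        exact div_pos (neg_pos.mpr this) hs0
      · have := (hsx hxs).2 hR
        rw [if_neg hR]
        simp
        exact div_neg_of_neg_of_pos (neg_neg_of_pos this) hs0
    · right
      have h1 : 1 - x / s ≠ 0 := by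
        intro h
        apply hxs
        field_simp at h
        linarith
      split_ifs
      · simp
        intro h
        apply h1
        linarith
      · simp
        intro h
        apply h1
        linarith
  · rw [cutDir, if_neg hk, one_mul]
    left
    have hs1 : 1 ≤ s := by
      rw [hs, one_le_div (by positivity)]
      have : (m : ℝ) ≤ k := by exact_mod_cast not_lt.mp hk
      have : (0 : ℝ) ≤ m := m.cast_nonneg
      gcongr
    have : x / s < 1 := by
      rw [div_lt_one hs0]
      linarith
    simpa using this

/-- Near `ω_m` the terms with `k ≠ m` are analytic. -/
lemma cutDir_mul_mem_slitPlane {m k : ℕ} (R : Finset ℝ) (hk : k ≠ m) {z : ℂ}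
    (hz : ‖z‖ < Real.pi / M) :
    cutDir m R k * (1 - (singPoint M m + z) / singPoint M k) ∈ slitPlane := by
  have hk0 : (0 : ℝ) < (k : ℝ) + 1 := by positivity
  have hz' : ‖z / singPoint M k‖ < 1 / ((k : ℝ) + 1) ^ 2 := by
    rw [norm_div, norm_singPoint]
    have hM := cast_M_pos (M := M)
    have := Real.pi_pos
    calc ‖z‖ / (Real.pi * ((k : ℝ) + 1) ^ 2 / M) < (Real.pi / M) /
        (Real.pi * ((k : ℝ) + 1) ^ 2 / M) := by gcongr
      _ = _ := by field_simp
  have hre := abs_lt.mp ((abs_re_le_norm _).trans_lt hz')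
  have hv : 1 - (singPoint M m + z) / singPoint M k =
      ((1 - ((m : ℝ) + 1) ^ 2 / ((k : ℝ) + 1) ^ 2 : ℝ) : ℂ) - z / singPoint M k := by
    rw [add_div, singPoint_div]
    push_cast
    ring
  have hvre : (1 - (singPoint M m + z) / singPoint M k).re =
      1 - ((m : ℝ) + 1) ^ 2 / ((k : ℝ) + 1) ^ 2 - (z / singPoint M k).re := by
    rw [hv, sub_re, ofReal_re]
  have hm0 : (0 : ℝ) ≤ m := m.cast_nonneg
  have hk0' : (0 : ℝ) ≤ k := k.cast_nonneg
  generalize (1 - (singPoint M m + z) / singPoint M k) = v at *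
  rcases lt_or_gt_of_ne hk with h | h
  · have h1 : (k : ℝ) + 1 ≤ m := by exact_mod_cast h
    have h2 : v.re < 0 := by
      -- Squares of distinct positive integers differ by at least 1, while the perturbation z moves
      -- the real part by less than 1/(k+1)². Hence that real part keeps its sign; this is where the
      -- radius π/M comes from.
      have h3 : 1 + 1 / ((k : ℝ) + 1) ^ 2 ≤ ((m : ℝ) + 1) ^ 2 / ((k : ℝ) + 1) ^ 2 := by
        rw [le_div_iff₀ (by positivity)]
        field_simp
        nlinarith
      linarith
    right
    rw [cutDir, if_pos h]
    split_ifs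
    · simpa using h2.ne
    · simpa using h2.ne
  · have h1 : (m : ℝ) + 1 ≤ k := by exact_mod_cast h
    rw [cutDir_of_le R h.le, one_mul]
    left
    have h3 : ((m : ℝ) + 1) ^ 2 / ((k : ℝ) + 1) ^ 2 + 1 / ((k : ℝ) + 1) ^ 2 ≤ 1 := by
      rw [← add_div, div_le_one (by positivity)]
      nlinarith
    linarith

/-- The part of a branch of the Borel transform that is regular at `ω_m`. -/
def regularPart (j : ℕ) (f : ℤ → ℂ) (M m : ℕ) (R : Finset ℝ) (z : ℂ) : ℂ :=
  singSum (opD (singPoly j)) M (Function.update (borelCoeff j f M) m 0) (cutDir m R)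
    (singPoint M m + z)

lemma analyticOnNhd_regularPart (m : ℕ) (R : Finset ℝ) :
    AnalyticOnNhd ℂ (regularPart j f M m R) (Metric.ball 0 (Real.pi / M)) := by
  intro z hz
  rw [mem_ball_zero_iff] at hz
  refine AnalyticAt.comp (g := singSum (opD (singPoly j)) M
    (Function.update (borelCoeff j f M) m 0) (cutDir m R)) (f := fun z => singPoint M m + z) ?_
    (by fun_prop)
  refine analyticAt_singSum _ ?_ (norm_cutDir m R) (fun k => cutDir_of_le R) fun k => ?_
  · refine (summable_norm_borelCoeff_div j f M).of_nonneg_of_le (fun _ => norm_nonneg _) fun k => ?_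
    by_cases hk : k = m
    · subst hk
      simp
      positivity
    · rw [Function.update_of_ne hk]
  · by_cases hk : k = m
    · left; subst hk; simp
    · exact Or.inr (cutDir_mul_mem_slitPlane R hk hz)

/-- The point ω_m is never circumvented, so its own summand has the standard cut for every R and is
the common singular part of all branches. -/
lemma borelBranch_eq_add_regularPart (m : ℕ) (R : Finset ℝ) (z : ℂ) :
    borelBranch j f M (cutDir m R) (singPoint M m + z) =
      borelCoeff j f M m / singPoint M m *
        germ (opD (singPoly j)) 1 (-z / singPoint M m) + regularPart j f M m R z := by
  have h := (summable_singSum (opD (singPoly j)) (summable_norm_borelCoeff_div j f M)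
    (norm_cutDir m R) (singPoint M m + z)).tsum_eq_add_tsum_ite m
  have h0 := singPoint_ne_zero (M := M) m
  rw [borelBranch, singSum, h, cutDir_of_le R le_rfl, regularPart, singSum]
  congr 3
  · field_simp
    ring
  · funext k
    split_ifs with hk
    · subst hk; simp
    · rw [Function.update_of_ne hk]

/-- The continuation of a branch of the Borel transform to the universal cover of a punctured
disc about `ω_m`. -/
def localBranch (j : ℕ) (f : ℤ → ℂ) (M m : ℕ) (R : Finset ℝ) (w : ℂ) : ℂ :=
  borelCoeff j f M m / singPoint M m *
    (exp (-(w - log (singPoint M m) + Real.pi * I) / 2) *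
      (opD (singPoly j)).eval (exp (-(w - log (singPoint M m) + Real.pi * I)))) +
    regularPart j f M m R (exp w)

lemma norm_exp_lt_of_re_lt_log {ρ : ℝ} (hρ : 0 < ρ) {w : ℂ} (hw : w.re < Real.log ρ) :
    ‖exp w‖ < ρ := by
  rw [norm_exp]
  exact (Real.lt_log_iff_exp_lt hρ).mp hw

lemma pi_div_M_pos : 0 < Real.pi / M := div_pos Real.pi_pos cast_M_pos

lemma analyticOnNhd_localBranch (m : ℕ) (R : Finset ℝ) :
    AnalyticOnNhd ℂ (localBranch j f M m R) {w : ℂ | w.re < Real.log (Real.pi / M)} := by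
  intro w hw
  have h1 : AnalyticAt ℂ (regularPart j f M m R) (exp w) :=
    analyticOnNhd_regularPart m R _
      (mem_ball_zero_iff.mpr (norm_exp_lt_of_re_lt_log pi_div_M_pos hw))
  have h2 : AnalyticAt ℂ (fun w => regularPart j f M m R (exp w)) w :=
    AnalyticAt.comp (g := regularPart j f M m R) (f := exp) h1 (by fun_prop)
  have h3 : AnalyticAt ℂ (fun w => (opD (singPoly j)).eval
      (exp (-(w - log (singPoint M m) + Real.pi * I)))) w := by
    have h4 : AnalyticAt ℂ (fun w => exp (-(w - log (singPoint M m) + Real.pi * I))) w := by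
      fun_prop
    simpa using AnalyticAt.aeval_polynomial h4 (opD (singPoly j))
  unfold localBranch
  fun_prop

lemma localBranch_eq_borelBranch (m : ℕ) (R : Finset ℝ) {t : ℝ} (ht : 0 < t) :
    localBranch j f M m R
        ((Real.log t : ℂ) + ((arg (singPoint M m) - Real.pi : ℝ) : ℂ) * I) =
      borelBranch j f M (cutDir m R)
        (singPoint M m - t * (singPoint M m / (‖singPoint M m‖ : ℂ))) := by
  have h0 := singPoint_ne_zero (M := M) m
  set ω := singPoint M m with hω
  have hn : 0 < ‖ω‖ := norm_pos_iff.mpr h0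
  have hexp : exp ((Real.log t : ℂ) + ((arg ω - Real.pi : ℝ) : ℂ) * I) =
      -(t * (ω / (‖ω‖ : ℂ))) := by
    rw [exp_add, ← ofReal_exp, Real.exp_log ht, ofReal_sub, sub_mul, exp_sub, exp_pi_mul_I]
    have := norm_mul_exp_arg_mul_I ω
    have hn' : (‖ω‖ : ℂ) ≠ 0 := ofReal_ne_zero.mpr hn.ne'
    field_simp
    linear_combination -(t : ℂ) * this
  -- With arg(ξ - ω) = arg ω - π on the segment, this logarithm of v is real. It therefore selects
  -- the principal square root used by `germ`.
  have hlog : (Real.log t : ℂ) + ((arg ω - Real.pi : ℝ) : ℂ) * I - log ω + Real.pi * I =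
      ((Real.log (t / ‖ω‖) : ℝ) : ℂ) := by
    rw [Real.log_div ht.ne' hn.ne', log]
    push_cast
    ring
  rw [sub_eq_add_neg ω, borelBranch_eq_add_regularPart, localBranch, hexp, ← hω, hlog]
  congr 2
  have hdiv : -(-(t * (ω / (‖ω‖ : ℂ)))) / ω = ((t / ‖ω‖ : ℝ) : ℂ) := by
    push_cast
    field_simp
  have hpos : 0 < t / ‖ω‖ := div_pos ht hn
  rw [hdiv, germ, log_one, one_mul, sub_zero, ← ofReal_log hpos.le, exp_neg, ← ofReal_exp,
    Real.exp_log hpos]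

/-- The value of the alien derivative, in terms of the singularity at `ω_m`. -/
lemma hasAlienDerivative_singToMono (hf : Function.Periodic f (M : ℤ)) (h : OppositeParity j f)
    (m : ℕ) :
    HasAlienDerivative (singPoint M m) (thetaTilde j f M)
      ((borelCoeff j f M m / singPoint M m) •
        singToMono (sqrtPoint M m) (opD (singPoly j))) := by
  -- The width η = 1 has no significance: for k < m the cuts are avoided on the whole line x = s,
  -- and for k ≥ m they lie in x ≥ 1.
  refine ⟨singPoint_ne_zero m, singRatios m, 1, Real.pi / M, fun R => borelBranch j f M (cutDir m R),
    localBranch j f M m, fun s hs => singRatios_bounds hs, one_pos, pi_div_M_pos, fun R _ => ⟨?_,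
    analyticOnNhd_borelBranch m R 1, analyticOnNhd_localBranch m R,
    fun t ht _ => localBranch_eq_borelBranch m R ht⟩,
    fun z => ∑ R ∈ (singRatios m).powerset, ((R.card.factorial : ℂ) *
      (((singRatios m).card - R.card).factorial : ℂ) / (((singRatios m).card + 1).factorial : ℂ)) *
      regularPart j f M m R z, ?_, fun w _ => ?_⟩
  · exact isBorelTransform_borelBranch hf h (cutDir_cases m R)
  · intro z hz
    exact Finset.analyticAt_fun_sum _ fun R _ =>
      analyticAt_const.mul (analyticOnNhd_regularPart m R z hz)
  -- The singular term does not depend on R, so the mean leaves it unchanged; the means of the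
  -- regular parts form the holomorphic remainder.
  · rw [major_smul, major_singToMono w (exp_half_log_singPoint m)]
    simp only [localBranch, mul_add, Finset.sum_add_distrib]
    rw [← Finset.sum_mul, sum_weights, one_mul]

/-! ### Principal square roots and the constant of the alien derivative. -/

lemma ofReal_mul_cpow {r : ℝ} (hr : 0 < r) {x : ℂ} (hx : x ≠ 0) (s : ℂ) :
    ((r : ℂ) * x) ^ s = (r : ℂ) ^ s * x ^ s := by
  have hr0 : (r : ℂ) ≠ 0 := ofReal_ne_zero.mpr hr.ne'
  rw [cpow_def_of_ne_zero (mul_ne_zero hr0 hx), cpow_def_of_ne_zero hr0, cpow_def_of_ne_zero hx,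
    log_ofReal_mul hr hx, ofReal_log hr.le, add_mul, exp_add]

lemma ofReal_cpow_half {r : ℝ} (hr : 0 ≤ r) : (r : ℂ) ^ (1 / 2 : ℂ) = (Real.sqrt r : ℂ) := by
  rw [Real.sqrt_eq_rpow, ofReal_cpow hr]
  norm_num

lemma pi_mul_I_div_cpow_half :
    (Real.pi * I / M : ℂ) ^ (1 / 2 : ℂ) = Real.sqrt Real.pi / Real.sqrt M * I ^ (1 / 2 : ℂ) := by
  rw [show (Real.pi * I / M : ℂ) = ((Real.pi / M : ℝ) : ℂ) * I by push_cast; ring,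
    ofReal_mul_cpow pi_div_M_pos I_ne_zero, ofReal_cpow_half pi_div_M_pos.le,
    Real.sqrt_div Real.pi_pos.le]
  push_cast
  rfl

lemma div_pi_mul_I_cpow (s : ℂ) :
    ((M : ℂ) / (Real.pi * I)) ^ (s / 2) = ((Real.pi * I / M : ℂ) ^ (s / 2))⁻¹ := by
  rw [show ((M : ℂ) / (Real.pi * I)) = (Real.pi * I / M)⁻¹ by rw [inv_div], inv_cpow]
  rw [show (Real.pi * I / M : ℂ) = ((Real.pi / M : ℝ) : ℂ) * I by push_cast; ring,
    arg_real_mul _ (pi_div_M_pos), arg_I]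
  linarith [Real.pi_pos]

lemma two_pow_ceil_div (j : ℕ) :
    (2 : ℂ) ^ ((j + 1) / 2) / 2 ^ j = 2 ^ (-((j / 2 : ℕ) : ℤ)) := by
  rw [zpow_neg, zpow_natCast, div_eq_iff (pow_ne_zero _ two_ne_zero)]
  have : (2 : ℂ) ^ j = 2 ^ (j / 2) * 2 ^ ((j + 1) / 2) := by
    rw [← pow_add]; congr 1; omega
  rw [this]
  field_simp

/-- The constant `A_{j,M}`, in terms of the constant of the Borel transform. -/
lemma alien_constant (j M m : ℕ) [NeZero M] (z : ℂ) :
    borelConst j M * (z / ((m : ℂ) + 1) ^ (j + 1)) / singPoint M m *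
      (2 ^ ((j + 1) / 2) * (sqrtPoint M m ^ (j + 2) *
        (-2 * Real.pi * I * sqrtPoint M m / Gamma (1 / 2)))) =
    (2 : ℂ) ^ (1 - ((j / 2 : ℕ) : ℤ)) * I ^ (1 / 2 : ℂ) *
      ((M : ℂ) / (Real.pi * I)) ^ ((j : ℂ) / 2) * z := by
  have hM := cast_M_ne_zero (M := M)
  have hpi := pi_ne_zero'
  have hm := natCast_add_one_ne_zero m
  have hc := pi_mul_I_div_ne_zero (M := M)
  set g : ℂ := (Real.pi * I / M) ^ (1 / 2 : ℂ) with hg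
  have hg2 : g ^ 2 = Real.pi * I / M := pi_mul_I_div_cpow_half_sq
  have hg0 : g ≠ 0 := by
    intro h
    rw [h] at hg2
    exact hc (by simpa using hg2.symm)
  have hgI : g = Real.sqrt Real.pi / Real.sqrt M * I ^ (1 / 2 : ℂ) := pi_mul_I_div_cpow_half
  have hinv : ((M : ℂ) / (Real.pi * I)) ^ ((j : ℂ) / 2) = (g ^ j)⁻¹ := by
    rw [div_pi_mul_I_cpow, show (j : ℂ) / 2 = j * (1 / 2) by ring, cpow_nat_mul]
  have hM2 : (Real.sqrt M : ℂ) ≠ 0 := by simp [NeZero.ne M]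
  have hsM : (Real.sqrt M : ℂ) ^ 2 = M := by
    rw [← ofReal_pow, Real.sq_sqrt M.cast_nonneg]; simp
  have hsp : (Real.sqrt Real.pi : ℂ) ^ 2 = Real.pi := by
    rw [← ofReal_pow, Real.sq_sqrt Real.pi_pos.le]
  have hp2 : (Real.sqrt Real.pi : ℂ) ≠ 0 := by
    intro h
    rw [h] at hsp
    exact hpi (by simpa using hsp.symm)
  have hK : ((M : ℂ) / (2 * Real.pi * I)) ^ j = (2 ^ j)⁻¹ * (g ^ j * g ^ j)⁻¹ := by
    rw [← mul_pow, ← mul_inv, ← mul_pow, ← inv_pow, ← sq, hg2]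
    congr 1
    field_simp
  have h2 : (2 : ℂ) ^ (1 - ((j / 2 : ℕ) : ℤ)) = 2 * (2 ^ ((j + 1) / 2) / 2 ^ j) := by
    rw [two_pow_ceil_div, sub_eq_add_neg, zpow_add₀ two_ne_zero, zpow_one]
  have hI : I ^ (1 / 2 : ℂ) = g * Real.sqrt M / Real.sqrt Real.pi := by
    rw [hgI]; field_simp
  rw [hinv, h2, hI, Gamma_one_half_eq, ofReal_cpow_half Real.pi_pos.le, borelConst, hK,
    ← sqrtPoint_sq, sqrtPoint, ← hg, ← hsp]
  simp only [mul_pow]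
  field_simp
  rw [I_sq]
  ring

/-- The alien derivatives of the formal series. -/
lemma hasAlienDerivative_thetaTilde (hf : Function.Periodic f (M : ℤ)) (h : OppositeParity j f)
    {n : ℕ} (hn : 1 ≤ n) :
    HasAlienDerivative (Real.pi * I * (n : ℂ) ^ 2 / (M : ℂ)) (thetaTilde j f M)
      (((2 : ℂ) ^ (1 - ((j / 2 : ℕ) : ℤ)) * I ^ (1 / 2 : ℂ) *
          ((M : ℂ) / (Real.pi * I)) ^ ((j : ℂ) / 2) * dft M f (n : ℤ)) •
        (mono (-((j : ℚ) + 1) / 2) 1 *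
          aeval (mono (-1 / 2) ((n : ℂ) * (Real.pi * I / (M : ℂ)) ^ (1 / 2 : ℂ))) (poly j))) := by
  obtain ⟨m, rfl⟩ : ∃ m, n = m + 1 := ⟨n - 1, by omega⟩
  have key := hasAlienDerivative_singToMono hf h m
  rw [show ((m + 1 : ℕ) : ℂ) = (m : ℂ) + 1 by push_cast; ring,
    show ((m + 1 : ℕ) : ℤ) = (m : ℤ) + 1 by push_cast; ring]
  have hd : ((m : ℂ) + 1) * (Real.pi * I / (M : ℂ)) ^ (1 / 2 : ℂ) = sqrtPoint M m := rfl
  have hp : (Real.pi * I * ((m : ℂ) + 1) ^ 2 / (M : ℂ)) = singPoint M m := rfl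
  rw [hd, hp]
  convert! key using 1
  have hb : borelConst j M * (dft M f ((m : ℤ) + 1) / ((m : ℂ) + 1) ^ (j + 1)) =
    borelCoeff j f M m := rfl
  rw [singToMono_opD, singToMono_singPoly, signedHermite_eq_poly, ← alien_constant j M m, hb,
    mul_smul, mul_comm (mono (-((j : ℚ) + 1) / 2) 1)]
  congr 1
  rw [map_mul, map_pow, map_ofNat, ← monomial_zero_one, singToMono_monomial]
  have e1 : mono (-1 / 2) (sqrtPoint M m) ^ 2 * (mono (-1 / 2) (sqrtPoint M m) ^ j *
      (2 ^ ((j + 1) / 2) * aeval (mono (-1 / 2) (sqrtPoint M m)) (poly j)) *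
      AddMonoidAlgebra.single (1 / 2 - ((0 : ℕ) : ℚ)) (1 * (-2 * Real.pi * I *
        sqrtPoint M m ^ (2 * 0 + 1) / Gamma (1 / 2 + ((0 : ℕ) : ℂ))))) =
      aeval (mono (-1 / 2) (sqrtPoint M m)) (poly j) * (2 ^ ((j + 1) / 2) *
      (mono (-1 / 2) (sqrtPoint M m) ^ (j + 2) *
      AddMonoidAlgebra.single (1 / 2 - ((0 : ℕ) : ℚ)) (1 * (-2 * Real.pi * I *
        sqrtPoint M m ^ (2 * 0 + 1) / Gamma (1 / 2 + ((0 : ℕ) : ℂ)))))) := by ring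
  rw [e1, ← mul_smul_comm]
  congr 1
  rw [mono, mono, AddMonoidAlgebra.single_pow, AddMonoidAlgebra.single_mul_single,
    AddMonoidAlgebra.smul_single]
  have e2 : (2 : AddMonoidAlgebra ℂ ℚ) ^ ((j + 1) / 2) =
      AddMonoidAlgebra.single 0 ((2 : ℂ) ^ ((j + 1) / 2)) := by
    have h2 : (2 : AddMonoidAlgebra ℂ ℚ) = AddMonoidAlgebra.single 0 (2 : ℂ) := by
      rw [← one_add_one_eq_two, ← one_add_one_eq_two, AddMonoidAlgebra.one_def,
        ← AddMonoidAlgebra.single_add]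
    rw [h2, AddMonoidAlgebra.single_pow, nsmul_zero]
  rw [e2, AddMonoidAlgebra.single_mul_single]
  congr 1
  · simp
    ring
  · simp

end

/-! ### Half-line Gaussian integrals -/

lemma integral_Ioi_deriv_eq_neg {F F' : ℝ → ℂ} (hF : ∀ x ∈ Set.Ici (0 : ℝ), HasDerivAt F (F' x) x)
    (hi : IntegrableOn F (Set.Ioi 0)) (hi' : IntegrableOn F' (Set.Ioi 0)) :
    ∫ x in Set.Ioi (0 : ℝ), F' x = -F 0 := by
  have h0 := tendsto_zero_of_hasDerivAt_of_integrableOn_Ioi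
    (fun x hx => hF x (Set.Ioi_subset_Ici_self hx)) hi' hi
  rw [integral_Ioi_of_hasDerivAt_of_tendsto' hF hi' h0, zero_sub]

/-- The integrand `s ^ p exp(-q s²) (exp(iks) - (-1) ^ j exp(-iks))`. -/
def gaussWave (q : ℂ) (p j : ℕ) (k s : ℝ) : ℂ :=
  (s : ℂ) ^ p * exp (-q * (s : ℂ) ^ 2) * (exp (I * k * s) - (-1) ^ j * exp (-(I * k * s)))

/-- The integral of `gaussWave` over the positive half-line. -/
def gaussMoment (q : ℂ) (j : ℕ) (k : ℝ) : ℂ := ∫ s in Set.Ioi (0 : ℝ), gaussWave q j j k s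

lemma gaussWave_add_two (q : ℂ) (p j : ℕ) (k s : ℝ) :
    gaussWave q p (j + 2) k s = gaussWave q p j k s := by
  simp [gaussWave, pow_succ]

lemma norm_gaussWave_le (q : ℂ) (p j : ℕ) (k : ℝ) {s : ℝ} (hs : 0 ≤ s) :
    ‖gaussWave q p j k s‖ ≤ 2 * (s ^ (p : ℝ) * Real.exp (-q.re * s ^ 2)) := by
  have h1 : ‖exp (I * k * s) - (-1) ^ j * exp (-(I * k * s))‖ ≤ 2 := by
    refine (norm_sub_le _ _).trans ?_
    rw [norm_mul, norm_exp, norm_exp]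
    simp
    norm_num
  have h2 : (-q * (s : ℂ) ^ 2).re = -q.re * s ^ 2 := by
    rw [← ofReal_pow, re_mul_ofReal, neg_re]
  rw [gaussWave, norm_mul, norm_mul, norm_exp, h2, norm_pow, norm_real, Real.norm_of_nonneg hs,
    Real.rpow_natCast]
  rw [mul_comm (2 : ℝ)]
  gcongr

lemma continuous_gaussWave (q : ℂ) (p j : ℕ) (k : ℝ) : Continuous (gaussWave q p j k) := by
  unfold gaussWave
  fun_prop

lemma integrableOn_gaussBound {q : ℂ} (hq : 0 < q.re) (p : ℕ) :
    IntegrableOn (fun s : ℝ => 2 * (s ^ (p : ℝ) * Real.exp (-q.re * s ^ 2))) (Set.Ioi 0) :=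
  (integrableOn_rpow_mul_exp_neg_mul_sq hq (by linarith [(p.cast_nonneg : (0 : ℝ) ≤ p)])).const_mul 2

lemma integrableOn_gaussWave {q : ℂ} (hq : 0 < q.re) (p j : ℕ) (k : ℝ) :
    IntegrableOn (gaussWave q p j k) (Set.Ioi 0) := by
  refine Integrable.mono' (integrableOn_gaussBound hq p)
    (continuous_gaussWave q p j k).aestronglyMeasurable ?_
  filter_upwards [self_mem_ae_restrict measurableSet_Ioi] with s hs
  exact norm_gaussWave_le q p j k (le_of_lt hs)

lemma hasDerivAt_cexp_mul_ofReal (c : ℂ) (s : ℝ) :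
    HasDerivAt (fun s : ℝ => exp (c * s)) (exp (c * s) * c) s := by
  have h : HasDerivAt (fun s : ℝ => c * (s : ℂ)) c s := by
    simpa using (hasDerivAt_id s).ofReal_comp.const_mul c
  exact h.cexp

lemma hasDerivAt_ofReal_pow (p : ℕ) (s : ℝ) :
    HasDerivAt (fun s : ℝ => (s : ℂ) ^ p) (p * (s : ℂ) ^ (p - 1)) s :=
  (hasDerivAt_pow p (s : ℂ)).comp_ofReal

lemma hasDerivAt_cexp_mul_sq (q : ℂ) (s : ℝ) :
    HasDerivAt (fun s : ℝ => exp (-q * (s : ℂ) ^ 2)) (exp (-q * (s : ℂ) ^ 2) * (-q * (2 * s))) s := by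
  have h : HasDerivAt (fun s : ℝ => -q * (s : ℂ) ^ 2) (-q * (2 * s)) s := by
    simpa using (hasDerivAt_ofReal_pow 2 s).const_mul (-q)
  exact h.cexp

lemma hasDerivAt_wave (j : ℕ) (k s : ℝ) :
    HasDerivAt (fun s : ℝ => exp (I * k * s) - (-1) ^ j * exp (-(I * k * s)))
      (I * k * (exp (I * k * s) - (-1) ^ (j + 1) * exp (-(I * k * s)))) s := by
  have h1 := hasDerivAt_cexp_mul_ofReal (I * k) s
  have h2 := (hasDerivAt_cexp_mul_ofReal (-(I * k)) s).const_mul ((-1 : ℂ) ^ j)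
  have h3 := h1.sub h2
  simp only [neg_mul] at h3
  refine h3.congr_deriv ?_
  ring

lemma hasDerivAt_gaussWave (q : ℂ) (p j : ℕ) (k s : ℝ) :
    HasDerivAt (gaussWave q p j k) (p * gaussWave q (p - 1) j k s +
      I * k * gaussWave q p (j + 1) k s - 2 * q * gaussWave q (p + 1) j k s) s := by
  have h := ((hasDerivAt_ofReal_pow p s).fun_mul (hasDerivAt_cexp_mul_sq q s)).fun_mul
    (hasDerivAt_wave j k s)
  refine h.congr_deriv ?_
  simp only [gaussWave]
  ring

/-- The integral over the half-line of the derivative of `gaussWave`. Differentiating the wave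
factor multiplies it by ik and flips its parity, which raises j by one. -/
lemma gaussWave_integral_by_parts {q : ℂ} (hq : 0 < q.re) (p j : ℕ) (k : ℝ) :
    p * (∫ s in Set.Ioi (0 : ℝ), gaussWave q (p - 1) j k s) +
      I * k * (∫ s in Set.Ioi (0 : ℝ), gaussWave q p (j + 1) k s) -
      2 * q * (∫ s in Set.Ioi (0 : ℝ), gaussWave q (p + 1) j k s) = -gaussWave q p j k 0 := by
  have i0 := (integrableOn_gaussWave hq (p - 1) j k).const_mul (p : ℂ)
  have i1 := (integrableOn_gaussWave hq p (j + 1) k).const_mul (I * k)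
  have i2 := (integrableOn_gaussWave hq (p + 1) j k).const_mul (2 * q)
  have i01 : IntegrableOn (fun s => p * gaussWave q (p - 1) j k s +
    I * k * gaussWave q p (j + 1) k s) (Set.Ioi 0) := i0.add i1
  rw [← integral_Ioi_deriv_eq_neg (fun s _ => hasDerivAt_gaussWave q p j k s)
    (integrableOn_gaussWave hq p j k) (i01.sub i2), ← integral_const_mul, ← integral_const_mul,
    ← integral_const_mul, ← integral_add i0 i1, ← integral_sub i01 i2]

lemma gaussMoment_succ_succ {q : ℂ} (hq : 0 < q.re) (j : ℕ) (k : ℝ) :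
    2 * q * gaussMoment q (j + 2) k =
      (j + 1) * gaussMoment q j k + I * k * gaussMoment q (j + 1) k := by
  have h := gaussWave_integral_by_parts hq (j + 1) j k
  have h0 : gaussWave q (j + 1) j k 0 = 0 := by simp [gaussWave]
  simp only [gaussMoment, gaussWave_add_two]
  rw [h0] at h
  push_cast at h
  linear_combination -h

/-- Unlike in the higher recursion, no power of s kills the boundary term at 0, which contributes
the inhomogeneity 2. -/
lemma gaussMoment_one {q : ℂ} (hq : 0 < q.re) (k : ℝ) :
    2 * q * gaussMoment q 1 k = 2 + I * k * gaussMoment q 0 k := by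
  have h := gaussWave_integral_by_parts hq 0 1 k
  have h0 : gaussWave q 0 1 k 0 = 2 := by simp [gaussWave]; norm_num
  simp only [gaussMoment]
  rw [h0] at h
  simp only [gaussWave_add_two] at h
  push_cast at h
  linear_combination -h

lemma hasDerivAt_gaussMoment_zero {q : ℂ} (hq : 0 < q.re) (k : ℝ) :
    HasDerivAt (gaussMoment q 0) (I * gaussMoment q 1 k) k := by
  have h := hasDerivAt_integral_of_dominated_loc_of_deriv_le
    (μ := volume.restrict (Set.Ioi (0 : ℝ))) (F := fun k s => gaussWave q 0 0 k s)
    (F' := fun k s => I * gaussWave q 1 1 k s) (x₀ := k) (s := Set.univ)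
    (bound := fun s => 2 * (s ^ ((1 : ℕ) : ℝ) * Real.exp (-q.re * s ^ 2))) univ_mem
    (Eventually.of_forall fun k => (continuous_gaussWave q 0 0 k).aestronglyMeasurable)
    (integrableOn_gaussWave hq 0 0 k)
    ((continuous_gaussWave q 1 1 k).const_smul I).aestronglyMeasurable ?_
    (integrableOn_gaussBound hq 1) ?_
  · rw [gaussMoment, ← integral_const_mul]
    exact h.2
  · filter_upwards [self_mem_ae_restrict measurableSet_Ioi] with s hs k _
    rw [norm_mul, norm_I, one_mul]
    exact norm_gaussWave_le q 1 1 k (le_of_lt hs)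
  · refine Eventually.of_forall fun s k _ => ?_
    have h1 := (hasDerivAt_wave 0 s k).const_mul (exp (-q * (s : ℂ) ^ 2))
    have e : (fun k : ℝ => gaussWave q 0 0 k s) = fun k : ℝ => exp (-q * (s : ℂ) ^ 2) *
        (exp (I * s * k) - (-1) ^ 0 * exp (-(I * s * k))) := by
      funext k
      simp only [gaussWave, mul_right_comm I]
      ring
    rw [e]
    refine h1.congr_deriv ?_
    simp only [gaussWave, mul_right_comm I]
    ring

lemma gaussMoment_zero_zero (q : ℂ) : gaussMoment q 0 0 = 0 := by
  simp [gaussMoment, gaussWave]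

/-! ### Laplace integrals along a ray -/

lemma abs_sin_mul_le_norm_sub (α a r : ℝ) :
    |Real.sin α| * |r| ≤ ‖(a : ℂ) - r * exp (I * α)‖ := by
  refine le_trans (le_of_eq ?_) (abs_im_le_norm _)
  rw [mul_comm I, sub_im, ofReal_im, im_ofReal_mul, exp_ofReal_mul_I_im, zero_sub, abs_neg, abs_mul,
    mul_comm]

lemma abs_sin_mul_le_norm_sub' (α a r : ℝ) :
    |Real.sin α| * |a| ≤ ‖(a : ℂ) - r * exp (I * α)‖ := by
  have h1 : ‖(a : ℂ) - r * exp (I * α)‖ = ‖(r : ℂ) - a * exp (I * (-α : ℝ))‖ := by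
    have h2 : (a : ℂ) - r * exp (I * α) = -exp (I * α) * ((r : ℂ) - a * exp (I * (-α : ℝ))) := by
      have h3 : exp (I * α) * exp (I * (-α : ℝ)) = 1 := by
        rw [← exp_add]
        push_cast
        rw [show I * α + I * -(α : ℂ) = 0 by ring, exp_zero]
      linear_combination -a * h3
    rw [h2, norm_mul, norm_neg, mul_comm I (α : ℂ), norm_exp_ofReal_mul_I, one_mul]
  rw [h1]
  simpa using abs_sin_mul_le_norm_sub (-α) r a

lemma sub_mem_slitPlane {α a r : ℝ} (hα : Real.sin α ≠ 0) (h : 0 < a ∨ r ≠ 0) :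
    (a : ℂ) - r * exp (I * α) ∈ slitPlane := by
  by_cases hr : r = 0
  · subst hr
    left
    simpa using h
  · right
    rw [mul_comm I, sub_im, ofReal_im, im_ofReal_mul, exp_ofReal_mul_I_im, zero_sub, neg_ne_zero]
    exact mul_ne_zero hr hα

/-- The integrand of the Laplace integral of `germ p 1 (a - x)` along the ray of direction `α`. -/
def rayFun (μ : ℂ) (α : ℝ) (p : ℂ[X]) (a r : ℝ) : ℂ :=
  exp (-μ * (r * exp (I * α))) * germ p 1 (a - r * exp (I * α)) * exp (I * α)

/-- The Laplace integral of `germ p 1 (a - x)` along the ray of direction `α`. -/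
def rayInt (μ : ℂ) (α : ℝ) (p : ℂ[X]) (a : ℝ) : ℂ :=
  ∫ r in Set.Ioi (0 : ℝ), rayFun μ α p a r

section

variable {μ : ℂ} {α : ℝ}

lemma norm_exp_ray (μ : ℂ) (α r : ℝ) :
    ‖exp (-μ * (r * exp (I * α)))‖ = Real.exp (-(μ * exp (I * α)).re * r) := by
  rw [norm_exp, show -μ * (r * exp (I * α)) = -(μ * exp (I * α)) * r by ring, re_mul_ofReal, neg_re]

lemma norm_exp_I_mul (α : ℝ) : ‖exp (I * α)‖ = 1 := by
  rw [mul_comm, norm_exp_ofReal_mul_I]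

lemma continuousOn_rayFun (hα : Real.sin α ≠ 0) (p : ℂ[X]) (a : ℝ) :
    ContinuousOn (rayFun μ α p a) (Set.Ioi 0) := by
  intro r hr
  have h0 := sub_mem_slitPlane (a := a) hα (Or.inr (ne_of_gt (Set.mem_Ioi.mp hr)))
  have h1 : ContinuousAt (germ p 1) ((a : ℂ) - r * exp (I * α)) :=
    (hasDerivAt_germ p (e := 1) (by simpa using h0)).continuousAt
  have h2 : ContinuousAt (fun r : ℝ => germ p 1 ((a : ℂ) - r * exp (I * α))) r :=
    ContinuousAt.comp (f := fun r : ℝ => (a : ℂ) - r * exp (I * α)) h1 (by fun_prop)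
  refine ContinuousAt.continuousWithinAt ?_
  unfold rayFun
  fun_prop

/-- For a ≥ a₀ the distance from a to the line carrying the ray is at least |sin α| a₀, so the germ
is bounded on it. The constant is independent of μ, as the later summation over the singular points
requires. -/
lemma exists_norm_rayFun_le (hα : Real.sin α ≠ 0) (p : ℂ[X]) {a₀ : ℝ} (ha₀ : 0 < a₀) :
    ∃ B : ℝ, 0 ≤ B ∧ ∀ (μ : ℂ) (a : ℝ), a₀ ≤ a → ∀ r : ℝ,
      ‖rayFun μ α p a r‖ ≤ B * Real.exp (-(μ * exp (I * α)).re * r) := by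
  obtain ⟨B, hB, h⟩ := norm_germ_le p (c := |Real.sin α| * a₀) (by positivity)
  refine ⟨B, hB, fun μ a ha r => ?_⟩
  rw [rayFun, norm_mul, norm_mul, norm_exp_ray, norm_exp_I_mul, mul_one, mul_comm]
  gcongr
  refine h 1 _ norm_one ((mul_le_mul_of_nonneg_left ?_ (abs_nonneg _)).trans
    (abs_sin_mul_le_norm_sub' α a r))
  exact ha.trans (le_abs_self a)

lemma integrableOn_rayFun (hα : Real.sin α ≠ 0) (hμ : 0 < (μ * exp (I * α)).re) (p : ℂ[X])
    {a : ℝ} (ha : 0 < a) : IntegrableOn (rayFun μ α p a) (Set.Ioi 0) := by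
  obtain ⟨B, hB, h⟩ := exists_norm_rayFun_le hα p ha
  exact Integrable.mono' ((exp_neg_integrableOn_Ioi 0 hμ).const_mul B)
    ((continuousOn_rayFun hα p a).aestronglyMeasurable measurableSet_Ioi)
    (Eventually.of_forall fun r => h μ a le_rfl r)

lemma exists_norm_rayInt_le (hα : Real.sin α ≠ 0) (p : ℂ[X]) :
    ∃ B : ℝ, 0 ≤ B ∧ ∀ μ : ℂ, 0 < (μ * exp (I * α)).re →
      ‖rayInt μ α p 1‖ ≤ B / (μ * exp (I * α)).re := by
  obtain ⟨B, hB, h⟩ := exists_norm_rayFun_le hα p one_pos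
  refine ⟨B, hB, fun μ hμ => ?_⟩
  rw [rayInt]
  refine (norm_integral_le_of_norm_le ((exp_neg_integrableOn_Ioi 0 hμ).const_mul B)
    (Eventually.of_forall fun r => h μ 1 le_rfl r)).trans_eq ?_
  rw [integral_const_mul, integral_exp_mul_Ioi (neg_lt_zero.mpr hμ), mul_zero, Real.exp_zero,
    neg_div_neg_eq, mul_one_div]

lemma hasDerivAt_rayFun (hα : Real.sin α ≠ 0) (p : ℂ[X]) {a : ℝ} (ha : 0 < a) (r : ℝ) :
    HasDerivAt (fun a : ℝ => rayFun μ α p a r) (-rayFun μ α (opD p) a r) a := by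
  have h1 := hasDerivAt_germ p (e := 1) (v := (a : ℂ) - r * exp (I * α))
    (by simpa using sub_mem_slitPlane hα (Or.inl ha))
  have h2 : HasDerivAt (fun a : ℝ => (a : ℂ) - r * exp (I * α)) 1 a :=
    ((hasDerivAt_id a).ofReal_comp).sub_const _
  have h3 := (HasDerivAt.comp (h₂ := germ p 1) a h1 h2).const_mul
    (exp (-μ * (r * exp (I * α)))) |>.mul_const (exp (I * α))
  refine h3.congr_deriv ?_
  simp only [rayFun]
  ring

lemma hasDerivAt_rayInt (hα : Real.sin α ≠ 0) (hμ : 0 < (μ * exp (I * α)).re) (p : ℂ[X])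
    {a : ℝ} (ha : 0 < a) : HasDerivAt (rayInt μ α p) (-rayInt μ α (opD p) a) a := by
  obtain ⟨B, hB, h⟩ := exists_norm_rayFun_le hα (opD p) (half_pos ha)
  have hnhds : Set.Ioi (a / 2) ∈ 𝓝 a := Ioi_mem_nhds (half_lt_self ha)
  have key := hasDerivAt_integral_of_dominated_loc_of_deriv_le
    (μ := volume.restrict (Set.Ioi (0 : ℝ))) (F := fun a r => rayFun μ α p a r)
    (F' := fun a r => -rayFun μ α (opD p) a r) (x₀ := a) (s := Set.Ioi (a / 2))
    (bound := fun r => B * Real.exp (-(μ * exp (I * α)).re * r)) hnhds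
    (eventually_of_mem hnhds fun b _ => (continuousOn_rayFun hα p b).aestronglyMeasurable measurableSet_Ioi)
    (integrableOn_rayFun hα hμ p ha)
    (integrableOn_rayFun hα hμ (opD p) ha).aestronglyMeasurable.neg
    (Eventually.of_forall fun r b hb => by rw [norm_neg]; exact h μ b (le_of_lt hb) r)
    ((exp_neg_integrableOn_Ioi 0 hμ).const_mul B)
    (Eventually.of_forall fun r b hb => hasDerivAt_rayFun hα p ((half_pos ha).trans hb) r)
  rw [rayInt, ← integral_neg]
  exact key.2

/-- Integration by parts. -/
lemma mul_rayInt (hα : Real.sin α ≠ 0) (hμ : 0 < (μ * exp (I * α)).re) (p : ℂ[X])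
    {a : ℝ} (ha : 0 < a) :
    μ * rayInt μ α p a = germ p 1 a + rayInt μ α (opD p) a := by
  have hd : ∀ r ∈ Set.Ici (0 : ℝ), HasDerivAt
      (fun r : ℝ => exp (-μ * (r * exp (I * α))) * germ p 1 (a - r * exp (I * α)))
      (rayFun μ α (opD p) a r - μ * rayFun μ α p a r) r := by
    intro r _
    have h1 := hasDerivAt_germ p (e := 1) (v := (a : ℂ) - r * exp (I * α))
      (by simpa using sub_mem_slitPlane hα (Or.inl ha))
    have h2 : HasDerivAt (fun r : ℝ => (a : ℂ) - r * exp (I * α)) (-(1 * exp (I * α))) r :=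
      (((hasDerivAt_id r).ofReal_comp).mul_const _).const_sub _
    have h3 := HasDerivAt.comp (h₂ := germ p 1) r h1 h2
    have h4 := (hasDerivAt_cexp_mul_ofReal (-μ * exp (I * α)) r).fun_mul h3
    have e : (fun r : ℝ => exp (-μ * (r * exp (I * α))) * germ p 1 (a - r * exp (I * α))) =
        fun r : ℝ => exp (-μ * exp (I * α) * r) *
          (germ p 1 ∘ fun r : ℝ => (a : ℂ) - r * exp (I * α)) r := by
      funext r
      simp only [Function.comp]
      congr 2
      ring
    rw [e]
    refine h4.congr_deriv ?_
    simp only [rayFun, Function.comp]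
    rw [show -μ * (r * exp (I * α)) = -μ * exp (I * α) * r by ring]
    ring
  have i1 := integrableOn_rayFun hα hμ (opD p) ha
  have i2 := (integrableOn_rayFun hα hμ p ha).const_mul μ
  have hF : IntegrableOn (fun r : ℝ => exp (-μ * (r * exp (I * α))) *
      germ p 1 (a - r * exp (I * α))) (Set.Ioi 0) := by
    refine ((integrableOn_rayFun hα hμ p ha).mul_const (exp (I * α))⁻¹).congr
      (Eventually.of_forall fun r => ?_)
    simp only [rayFun]
    field_simp [exp_ne_zero]
  have h := integral_Ioi_deriv_eq_neg hd hF (i1.sub i2)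
  rw [integral_sub i1 i2, integral_const_mul] at h
  simp only [ofReal_zero, zero_mul, mul_zero, exp_zero, one_mul, sub_zero] at h
  rw [rayInt, rayInt]
  linear_combination -h

lemma germ_one_one (p : ℂ[X]) : germ p 1 1 = p.eval 1 := by simp [germ]

lemma rayInt_sub (hα : Real.sin α ≠ 0) (hμ : 0 < (μ * exp (I * α)).re) (p q : ℂ[X])
    {a : ℝ} (ha : 0 < a) : rayInt μ α (p - q) a = rayInt μ α p a - rayInt μ α q a := by
  rw [rayInt, rayInt, rayInt, ← integral_sub (integrableOn_rayFun hα hμ p ha)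
    (integrableOn_rayFun hα hμ q ha)]
  congr 1
  funext r
  simp only [rayFun, germ_sub]
  ring

lemma rayInt_C_mul (c : ℂ) (p : ℂ[X]) (a : ℝ) : rayInt μ α (C c * p) a = c * rayInt μ α p a := by
  rw [rayInt, rayInt, ← integral_const_mul]
  congr 1
  funext r
  simp only [rayFun, germ_C_mul]
  ring

/-- Integration by parts removes `opD` at the cost of boundary values; these are (-1)^(j+1) (j+1)!
and (j+1) (-1)^j j!, which cancel. -/
lemma mul_rayInt_singPoly_succ_succ (hα : Real.sin α ≠ 0) (hμ : 0 < (μ * exp (I * α)).re) (j : ℕ) :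
    μ * rayInt μ α (singPoly (j + 2)) 1 = -2 * μ * (μ * rayInt μ α (singPoly (j + 1)) 1 +
      (j + 1) * (μ * rayInt μ α (singPoly j) 1)) := by
  have h1 := mul_rayInt hα hμ (singPoly (j + 1)) one_pos
  have h0 := mul_rayInt hα hμ (singPoly j) one_pos
  rw [singPoly, rayInt_sub hα hμ _ _ one_pos, rayInt_C_mul, rayInt_C_mul]
  have e1 := eval_one_opD_iterate_singPoly (j + 1) 0
  have e0 := eval_one_opD_iterate_singPoly j 0
  simp only [ofReal_one, germ_one_one] at h0 h1
  simp only [Function.iterate_zero, id, mul_zero, zero_add, pow_zero, Nat.factorial_zero,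
    Nat.cast_one, mul_one, div_one] at e1 e0
  rw [e1] at h1
  rw [e0] at h0
  rw [Nat.factorial_succ] at h1
  push_cast at h1
  linear_combination 2 * μ * h1 + 2 * μ * (j + 1) * h0

/-- Here the boundary value 1 is not cancelled; it matches the inhomogeneity in `gaussMoment_one`.
-/
lemma mul_rayInt_singPoly_one (hα : Real.sin α ≠ 0) (hμ : 0 < (μ * exp (I * α)).re) :
    μ * rayInt μ α (singPoly 1) 1 = -2 * μ * (μ * rayInt μ α (singPoly 0) 1 - 1) := by
  have h0 := mul_rayInt hα hμ (singPoly 0) one_pos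
  rw [singPoly_one, rayInt_C_mul]
  simp only [ofReal_one, germ_one_one] at h0
  rw [h0]
  simp [singPoly]
  ring

end

/-! ### Gaussian integrals as Laplace integrals -/

lemma integral_rpow_neg_half_mul_exp {c : ℂ} (hc : 0 < c.re) :
    ∫ r in Set.Ioi (0 : ℝ), ((r ^ (-1 / 2 : ℝ) : ℝ) : ℂ) * exp (-c * r) =
      (Real.pi / c) ^ (1 / 2 : ℂ) := by
  rw [← integral_comp_rpow_Ioi_of_pos (p := 2) two_pos]
  have h : ∀ x ∈ Set.Ioi (0 : ℝ), ((2 : ℝ) * x ^ ((2 : ℝ) - 1)) •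
      ((((x ^ (2 : ℝ)) ^ (-1 / 2 : ℝ) : ℝ) : ℂ) * exp (-c * ((x ^ (2 : ℝ) : ℝ) : ℂ))) =
      2 * exp (-c * (x : ℂ) ^ 2) := by
    intro x hx
    have hx0 : (0 : ℝ) < x := hx
    rw [← Real.rpow_mul hx0.le, show (2 : ℝ) - 1 = 1 by norm_num,
      show (2 : ℝ) * (-1 / 2) = -1 by norm_num, Real.rpow_one, Real.rpow_neg_one, real_smul]
    have : (x : ℂ) ≠ 0 := ofReal_ne_zero.mpr hx0.ne'
    push_cast
    rw [show ((2 : ℝ) : ℝ) = ((2 : ℕ) : ℝ) by norm_num, Real.rpow_natCast]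
    push_cast
    field_simp
  rw [setIntegral_congr_fun measurableSet_Ioi h, integral_const_mul, integral_gaussian_complex_Ioi hc]
  ring

section

variable {μ : ℂ} {σ ε : ℝ}

lemma sin_ne_zero_of_sign (hσ : σ = 1 ∨ σ = -1) (h0 : 0 < ε) (h1 : ε < Real.pi) :
    Real.sin (-σ * ε) ≠ 0 := by
  have := Real.sin_pos_of_pos_of_lt_pi h0 h1
  rcases hσ with rfl | rfl <;> simp <;> linarith

/-- For x on the ray of direction -σε, the argument of -x is σ(π - ε). This is the source of the
sign ∓ in the final identities. -/
lemma log_neg_ray (hσ : σ = 1 ∨ σ = -1) (h0 : 0 < ε) (h1 : ε < Real.pi) {r : ℝ} (hr : 0 < r) :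
    log (-(r * exp (I * (-σ * ε : ℝ)))) = Real.log r + σ * (Real.pi - ε) * I := by
  have e : -(r * exp (I * (-σ * ε : ℝ))) = (r : ℂ) * exp (σ * (Real.pi - ε) * I) := by
    have h2 : exp (σ * Real.pi * I) = -1 := by
      rcases hσ with rfl | rfl
      · simp
      · simp [exp_neg]
    rw [show (σ : ℂ) * (Real.pi - ε) * I = σ * Real.pi * I + I * (-σ * ε : ℝ) by push_cast; ring,
      exp_add, h2]
    ring
  rw [e, log_ofReal_mul hr (exp_ne_zero _), log_exp]
  · rcases hσ with rfl | rfl <;> simp <;> linarith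
  · rcases hσ with rfl | rfl <;> simp <;> linarith

lemma exp_neg_sign_pi_half (hσ : σ = 1 ∨ σ = -1) : exp (-(σ * (Real.pi / 2) * I)) = -(σ * I) := by
  rcases hσ with rfl | rfl
  · simp [exp_neg, exp_pi_div_two_mul_I]
  · simp [exp_pi_div_two_mul_I]

lemma rayFun_one_zero (hσ : σ = 1 ∨ σ = -1) (h0 : 0 < ε) (h1 : ε < Real.pi) {r : ℝ} (hr : 0 < r) :
    rayFun μ (-σ * ε) 1 0 r = -(σ * I) * exp (I * (-σ * ε : ℝ) / 2) *
      (((r ^ (-1 / 2 : ℝ) : ℝ) : ℂ) * exp (-(μ * exp (I * (-σ * ε : ℝ))) * r)) := by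
  have hpow : ((r ^ (-1 / 2 : ℝ) : ℝ) : ℂ) = exp (-(Real.log r) / 2) := by
    rw [Real.rpow_def_of_pos hr, ofReal_exp]
    push_cast
    congr 1
    ring
  rw [rayFun, germ, eval_one, mul_one, ofReal_zero, zero_sub, one_mul, log_one, sub_zero,
    log_neg_ray hσ h0 h1 hr, hpow, ← exp_neg_sign_pi_half hσ]
  have h3 : ∀ a b c d : ℂ, exp a * exp b * (exp c * exp d) = exp (a + b + (c + d)) := by
    intros; simp only [exp_add]
  have h2 : ∀ a b c : ℂ, exp a * exp b * exp c = exp (a + b + c) := by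
    intros; simp only [exp_add]
  rw [h3, h2]
  congr 1
  push_cast
  ring

/-- The point a - x stays at distance at least |sin α| r from 0, so r^(-1/2) dominates uniformly in
a, including a = 0 where the singularity sits at the end point. -/
lemma norm_rayFun_one_le {α : ℝ} (hα : Real.sin α ≠ 0) (a : ℝ) {r : ℝ} (hr : 0 < r) :
    ‖rayFun μ α 1 a r‖ ≤ |Real.sin α| ^ (-1 / 2 : ℝ) *
      (r ^ (-1 / 2 : ℝ) * Real.exp (-(μ * exp (I * α)).re * r)) := by
  have hs : 0 < |Real.sin α| := abs_pos.mpr hα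
  have hv : |Real.sin α| * r ≤ ‖(a : ℂ) - r * exp (I * α)‖ := by
    simpa [abs_of_pos hr] using abs_sin_mul_le_norm_sub α a r
  have hv0 : 0 < |Real.sin α| * r := by positivity
  rw [rayFun, norm_mul, norm_mul, norm_exp_ray, norm_exp_I_mul, mul_one, germ, eval_one, mul_one,
    norm_exp, one_mul, log_one, sub_zero, ← mul_assoc, ← Real.mul_rpow hs.le hr.le, mul_comm]
  gcongr
  rw [Real.rpow_def_of_pos hv0]
  gcongr
  have := Real.log_le_log hv0 hv
  rw [show (-log ((a : ℂ) - r * exp (I * α)) / 2).re =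
    -(log ((a : ℂ) - r * exp (I * α))).re / 2 by simp, log_re]
  linarith

lemma cpow_half_mul_exp (hμ : 0 < μ.re) {α : ℝ} (h1 : -(Real.pi / 2) < arg μ + α)
    (h2 : arg μ + α < Real.pi / 2) :
    (μ * exp (I * α)) ^ (1 / 2 : ℂ) = μ ^ (1 / 2 : ℂ) * exp (I * α / 2) ∧
      arg (μ * exp (I * α)) ≠ Real.pi ∧ 0 < (μ * exp (I * α)).re := by
  have hμ0 : μ ≠ 0 := by rintro rfl; simp at hμ
  have hpi := Real.pi_pos
  have hlog : log (μ * exp (I * α)) = log μ + I * α := by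
    conv_lhs => rw [← exp_log hμ0, ← exp_add]
    rw [log_exp]
    · simp [log_im]; linarith
    · simp [log_im]; linarith
  have harg : arg (μ * exp (I * α)) = arg μ + α := by
    have := congrArg im hlog
    simpa [log_im] using this
  refine ⟨?_, by rw [harg]; linarith, ?_⟩
  · rw [cpow_def_of_ne_zero (mul_ne_zero hμ0 (exp_ne_zero _)), hlog, cpow_def_of_ne_zero hμ0,
      ← exp_add]
    congr 1
    ring
  · have habs : |arg (μ * exp (I * α))| < Real.pi / 2 := by
      rw [harg, abs_lt]; exact ⟨h1, h2⟩
    rcases abs_arg_lt_pi_div_two_iff.mp habs with h | h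
    · exact h
    · exact absurd h (mul_ne_zero hμ0 (exp_ne_zero _))

/-- At a = 0 the integral is a Gamma integral with value Γ(1/2) over a square root. The phase
exp(iα/2) from the ray cancels against the root of μ exp(iα), which is principal because both
arguments stay within π/2 of zero. -/
lemma integral_rayFun_one_zero (hμ : 0 < μ.re) (hσ : σ = 1 ∨ σ = -1) (h0 : 0 < ε)
    (h1 : ε < Real.pi) (h2 : -(Real.pi / 2) < arg μ + -σ * ε) (h3 : arg μ + -σ * ε < Real.pi / 2) :
    2 * I * (μ * rayInt μ (-σ * ε) 1 0) = 2 * σ * Real.sqrt Real.pi * μ ^ (1 / 2 : ℂ) := by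
  obtain ⟨hc, hcarg, hcre⟩ := cpow_half_mul_exp hμ h2 h3
  have hμ0 : μ ≠ 0 := by rintro rfl; simp at hμ
  have hc0 : μ * exp (I * (-σ * ε : ℝ)) ≠ 0 := mul_ne_zero hμ0 (exp_ne_zero _)
  rw [rayInt, setIntegral_congr_fun measurableSet_Ioi
    (fun r hr => rayFun_one_zero hσ h0 h1 hr), integral_const_mul,
    integral_rpow_neg_half_mul_exp hcre,
    div_eq_mul_inv (Real.pi : ℂ) (μ * _), ofReal_mul_cpow Real.pi_pos
    (inv_ne_zero hc0), ofReal_cpow_half Real.pi_pos.le, inv_cpow _ _ hcarg, hc]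
  have hsq : μ ^ (1 / 2 : ℂ) * μ ^ (1 / 2 : ℂ) = μ := by
    rw [← cpow_add _ _ hμ0]; norm_num
  have hr0 : μ ^ (1 / 2 : ℂ) ≠ 0 := by
    intro h; rw [h] at hsq; exact hμ0 (by simpa using hsq.symm)
  have he := exp_ne_zero (I * (-σ * ε : ℝ) / 2)
  generalize exp (I * (-σ * ε : ℝ) / 2) = x at *
  generalize μ ^ (1 / 2 : ℂ) = y at *
  rw [← hsq]
  field_simp
  rw [I_sq]
  ring

lemma tendsto_rayInt_one {α : ℝ} (hα : Real.sin α ≠ 0) (hμ : 0 < (μ * exp (I * α)).re) :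
    Tendsto (rayInt μ α 1) (𝓝[>] 0) (𝓝 (rayInt μ α 1 0)) := by
  refine tendsto_integral_filter_of_dominated_convergence
    (fun r => |Real.sin α| ^ (-1 / 2 : ℝ) *
      (r ^ (-1 / 2 : ℝ) * Real.exp (-(μ * exp (I * α)).re * r)))
    (Eventually.of_forall fun a => (continuousOn_rayFun hα 1 a).aestronglyMeasurable
      measurableSet_Ioi) (Eventually.of_forall fun a => ?_) ?_ ?_
  · filter_upwards [self_mem_ae_restrict measurableSet_Ioi] with r hr
    exact norm_rayFun_one_le hα a hr
  · have := integrableOn_rpow_mul_exp_neg_mul_rpow (s := -1 / 2) (p := 1) (by norm_num) one_pos hμ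
    simp only [Real.rpow_one] at this
    exact this.const_mul _
  · filter_upwards [self_mem_ae_restrict measurableSet_Ioi] with r hr
    have h1 := sub_mem_slitPlane (a := 0) hα (Or.inr (ne_of_gt (Set.mem_Ioi.mp hr)))
    have h2 : ContinuousAt (germ 1 1) (((0 : ℝ) : ℂ) - r * exp (I * α)) :=
      (hasDerivAt_germ 1 (e := 1) (by simpa using h1)).continuousAt
    have h3 : ContinuousAt (fun a : ℝ => germ 1 1 ((a : ℂ) - r * exp (I * α))) 0 :=
      ContinuousAt.comp (f := fun a : ℝ => (a : ℂ) - r * exp (I * α)) h2 (by fun_prop)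
    have h4 : ContinuousAt (fun a : ℝ => rayFun μ α 1 a r) 0 := by
      unfold rayFun
      fun_prop
    exact h4.tendsto.mono_left nhdsWithin_le_nhds

/-- With q = 1/(4μ), both the moment and 2iμ times the Laplace integral at a = k² solve y' + 2μk y =
4iμ for k > 0. Their difference is a multiple of exp(-μk²), identified by the limit k → 0⁺. -/
lemma gaussMoment_zero_eq (hμ : 0 < μ.re) (hσ : σ = 1 ∨ σ = -1) (h0 : 0 < ε)
    (h1 : ε < Real.pi) (h2 : -(Real.pi / 2) < arg μ + -σ * ε) (h3 : arg μ + -σ * ε < Real.pi / 2) :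
    gaussMoment (1 / (4 * μ)) 0 1 = 2 * I * (μ * rayInt μ (-σ * ε) 1 1) -
      2 * σ * Real.sqrt Real.pi * μ ^ (1 / 2 : ℂ) * exp (-μ) := by
  have hμ0 : μ ≠ 0 := by rintro rfl; simp at hμ
  have hα := sin_ne_zero_of_sign hσ h0 h1
  obtain ⟨-, -, hcre⟩ := cpow_half_mul_exp hμ h2 h3
  have hq : 0 < (1 / (4 * μ)).re := by
    rw [one_div, inv_re]
    have : 0 < normSq (4 * μ) := normSq_pos.mpr (by simp [hμ0])
    have h4 : (4 * μ).re = 4 * μ.re := by simp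
    rw [h4]
    positivity
  set α := -σ * ε with hαdef
  -- The factor exp(μk²) is the integrating factor of that equation.
  set D : ℝ → ℂ := fun k => exp (μ * (k : ℂ) ^ 2) *
    (gaussMoment (1 / (4 * μ)) 0 k - 2 * I * (μ * rayInt μ α 1 (k ^ 2))) with hD
  have hexp : ∀ k : ℝ, HasDerivAt (fun k : ℝ => exp (μ * (k : ℂ) ^ 2))
      (exp (μ * (k : ℂ) ^ 2) * (μ * (2 * k))) k := by
    intro k
    simpa using hasDerivAt_cexp_mul_sq (-μ) k
  have hderiv : ∀ k ∈ Set.Ioi (0 : ℝ), HasDerivAt D 0 k := by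
    intro k hk
    have hk0 : (0 : ℝ) < k := hk
    have hk2 : 0 < k ^ 2 := by positivity
    have hkc : (k : ℂ) ≠ 0 := ofReal_ne_zero.mpr hk0.ne'
    have d1 := hasDerivAt_gaussMoment_zero hq k
    have d2 : HasDerivAt (fun k : ℝ => k ^ 2) (2 * k) k := by simpa using hasDerivAt_pow 2 k
    have d3 := (HasDerivAt.scomp (h := fun k : ℝ => k ^ 2) (g₁ := rayInt μ α 1) k
      (hasDerivAt_rayInt hα hcre 1 hk2) d2).const_mul μ |>.const_mul (2 * I)
    refine ((hexp k).fun_mul (d1.fun_sub d3)).congr_deriv ?_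
    have m1 := gaussMoment_one hq k
    have m2 := mul_rayInt hα hcre 1 hk2
    have hg : germ 1 1 ((k ^ 2 : ℝ) : ℂ) = 1 / k := by
      rw [germ, eval_one, mul_one, one_mul, log_one, sub_zero, ← ofReal_log hk2.le, Real.log_pow]
      rw [show -((((2 : ℕ) : ℝ) * Real.log k : ℝ) : ℂ) / 2 = -(Real.log k : ℂ) by push_cast; ring,
        exp_neg, ← ofReal_exp, Real.exp_log hk0, one_div]
    rw [hg] at m2
    have hcancel : ∀ x : ℂ, 2 * μ * (2 * (1 / (4 * μ)) * x) = x := by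
      intro x; field_simp; norm_num
    have m1' : gaussMoment (1 / (4 * μ)) 1 k =
        2 * μ * (2 + I * k * gaussMoment (1 / (4 * μ)) 0 k) := by
      rw [← m1, hcancel]
    have m2' : rayInt μ α (opD 1) (k ^ 2) = μ * rayInt μ α 1 (k ^ 2) - 1 / k := by
      rw [m2]; ring
    simp only [Function.comp, real_smul]
    rw [m1', m2']
    push_cast
    field_simp
    ring_nf
    rw [I_sq]
    ring
  obtain ⟨c, hc⟩ := IsOpen.exists_is_const_of_deriv_eq_zero (isOpen_Ioi (a := (0 : ℝ)))
    isPreconnected_Ioi (fun k hk => (hderiv k hk).differentiableAt.differentiableWithinAt)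
    (fun k hk => (hderiv k hk).deriv)
  have hlim : Tendsto D (𝓝[>] 0) (𝓝 (exp (μ * ((0 : ℝ) : ℂ) ^ 2) *
      (gaussMoment (1 / (4 * μ)) 0 0 - 2 * I * (μ * rayInt μ α 1 0)))) := by
    have t1 : Tendsto (fun k : ℝ => exp (μ * (k : ℂ) ^ 2)) (𝓝[>] 0)
      (𝓝 (exp (μ * ((0 : ℝ) : ℂ) ^ 2))) :=
      (hexp 0).continuousAt.tendsto.mono_left nhdsWithin_le_nhds
    have t2 := (hasDerivAt_gaussMoment_zero hq 0).continuousAt.tendsto.mono_left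
      (nhdsWithin_le_nhds (s := Set.Ioi 0))
    have t3 : Tendsto (fun k : ℝ => k ^ 2) (𝓝[>] 0) (𝓝[>] 0) := by
      refine tendsto_nhdsWithin_iff.mpr ⟨?_, ?_⟩
      · have : Tendsto (fun k : ℝ => k ^ 2) (𝓝 0) (𝓝 (0 ^ 2)) := (continuous_pow 2).tendsto 0
        rw [zero_pow two_ne_zero] at this
        exact this.mono_left nhdsWithin_le_nhds
      · filter_upwards [self_mem_nhdsWithin] with k hk
        exact pow_pos (Set.mem_Ioi.mp hk) 2
    have t4 := (tendsto_rayInt_one hα hcre).comp t3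
    exact t1.mul (t2.sub ((t4.const_mul μ).const_mul (2 * I)))
  have hconst : Tendsto D (𝓝[>] 0) (𝓝 c) :=
    tendsto_const_nhds.congr' (eventually_nhdsWithin_of_forall fun k hk => (hc k hk).symm)
  have heq := tendsto_nhds_unique hlim hconst
  -- The sine integral vanishes at k = 0, so the constant comes entirely from the Laplace integral
  -- at a = 0.
  rw [gaussMoment_zero_zero, integral_rayFun_one_zero hμ hσ h0 h1 h2 h3, ← hc 1 (by simp)] at heq
  simp only [hD, ofReal_zero, ofReal_one] at heq
  rw [exp_neg]
  have he := exp_ne_zero μ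
  rw [zero_pow two_ne_zero, mul_zero, exp_zero, one_pow, one_pow, mul_one] at heq
  generalize gaussMoment (1 / (4 * μ)) 0 1 = x at *
  generalize μ ^ (1 / 2 : ℂ) = y at *
  field_simp
  linear_combination -heq

/-- The half-line Gaussian integrals are Laplace integrals up to a Hermite function. -/
lemma I_pow_mul_gaussMoment (hμ : 0 < μ.re) (hσ : σ = 1 ∨ σ = -1) (h0 : 0 < ε)
    (h1 : ε < Real.pi) (h2 : -(Real.pi / 2) < arg μ + -σ * ε) (h3 : arg μ + -σ * ε < Real.pi / 2)
    (j : ℕ) :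
    I ^ j * gaussMoment (1 / (4 * μ)) j 1 = 2 * I * (μ * rayInt μ (-σ * ε) (singPoly j) 1) -
      2 * σ * Real.sqrt Real.pi * μ ^ (1 / 2 : ℂ) * exp (-μ) *
        ((μ ^ (1 / 2 : ℂ)) ^ j * aeval (μ ^ (1 / 2 : ℂ)) (signedHermite j)) := by
  have hμ0 : μ ≠ 0 := by rintro rfl; simp at hμ
  have hα := sin_ne_zero_of_sign hσ h0 h1
  obtain ⟨-, -, hcre⟩ := cpow_half_mul_exp hμ h2 h3
  have hq : 0 < (1 / (4 * μ)).re := by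
    rw [one_div, inv_re]
    have : 0 < normSq (4 * μ) := normSq_pos.mpr (by simp [hμ0])
    have h4 : (4 * μ).re = 4 * μ.re := by simp
    rw [h4]
    positivity
  have hsq : μ ^ (1 / 2 : ℂ) * μ ^ (1 / 2 : ℂ) = μ := by
    rw [← cpow_add _ _ hμ0]; norm_num
  have hcancel : ∀ x : ℂ, 2 * μ * (2 * (1 / (4 * μ)) * x) = x := by
    intro x; field_simp; norm_num
  have base := gaussMoment_zero_eq hμ hσ h0 h1 h2 h3
  -- The three quantities, including y^j times the signed Hermite polynomial at y = μ^(1/2), satisfy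
  -- X_{j+2} = -2μ (X_{j+1} + (j+1) X_j).
  induction j using Nat.strong_induction_on with
  | _ j ih =>
    match j with
    | 0 => simpa [signedHermite, singPoly] using base
    | 1 =>
      have m1 := gaussMoment_one hq 1
      have m1' : gaussMoment (1 / (4 * μ)) 1 1 =
          2 * μ * (2 + I * gaussMoment (1 / (4 * μ)) 0 1) := by
        rw [ofReal_one, mul_one] at m1
        rw [← m1, hcancel]
      rw [mul_rayInt_singPoly_one hα hcre, m1', base]
      simp only [signedHermite, singPoly, map_neg, map_mul, aeval_X, map_ofNat (aeval _) 2]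
      generalize μ ^ (1 / 2 : ℂ) = y at *
      have h2I : ∀ x : ℂ, I ^ 1 * (2 * μ * (2 + I * x)) = 4 * I * μ - 2 * μ * x := by
        intro x; linear_combination 2 * μ * x * I_sq
      rw [h2I, ← hsq]
      ring
    | k + 2 =>
      have m1 := gaussMoment_succ_succ hq k 1
      have m1' : gaussMoment (1 / (4 * μ)) (k + 2) 1 =
          2 * μ * ((k + 1) * gaussMoment (1 / (4 * μ)) k 1 +
            I * gaussMoment (1 / (4 * μ)) (k + 1) 1) := by
        rw [ofReal_one, mul_one] at m1
        rw [← m1, hcancel]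
      have e : I ^ (k + 2) * gaussMoment (1 / (4 * μ)) (k + 2) 1 =
          -2 * μ * ((k + 1) * (I ^ k * gaussMoment (1 / (4 * μ)) k 1) +
            I ^ (k + 1) * gaussMoment (1 / (4 * μ)) (k + 1) 1) := by
        rw [m1', pow_add, pow_add, I_sq]
        ring
      rw [e, ih k (by omega), ih (k + 1) (by omega), mul_rayInt_singPoly_succ_succ hα hcre,
        aeval_signedHermite_succ_succ]
      generalize μ ^ (1 / 2 : ℂ) = y at *
      rw [← hsq]
      ring

end

/-! ### The value at zero of the `L`-function of a periodic function with zero mean -/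

lemma norm_ofReal_cpow_neg_sub_le {a t : ℝ} (ha : 0 < a) (ht : a ≤ t) (ht' : t ≤ a + 1) {z : ℂ}
    (hz : -1 ≤ z.re) : ‖(t : ℂ) ^ (-z) - (a : ℂ) ^ (-z)‖ ≤ ‖z‖ * a ^ (-z.re - 1) := by
  have hd : ∀ x ∈ Set.Icc a (a + 1), HasDerivWithinAt (fun x : ℝ => (x : ℂ) ^ (-z))
      (-z * (x : ℂ) ^ (-z - 1)) (Set.Icc a (a + 1)) x := by
    intro x hx
    have hx0 : 0 < x := ha.trans_le hx.1
    have h1 : HasDerivAt (fun w : ℂ => w ^ (-z)) (-z * (x : ℂ) ^ (-z - 1)) (x : ℂ) := by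
      simpa using (hasDerivAt_id (x : ℂ)).cpow_const (c := -z) (Or.inl (by simpa using hx0))
    exact h1.comp_ofReal.hasDerivWithinAt
  have hb : ∀ x ∈ Set.Icc a (a + 1), ‖-z * (x : ℂ) ^ (-z - 1)‖ ≤ ‖z‖ * a ^ (-z.re - 1) := by
    intro x hx
    rw [norm_mul, norm_neg, norm_cpow_eq_rpow_re_of_pos (ha.trans_le hx.1)]
    gcongr ?_ * ?_
    simpa using Real.rpow_le_rpow_of_nonpos ha hx.1 (by linarith : -z.re - 1 ≤ 0)
  have h := (convex_Icc a (a + 1)).norm_image_sub_le_of_norm_hasDerivWithin_le hd hb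
    (x := a) (y := t) ⟨le_rfl, by linarith⟩ ⟨ht, ht'⟩
  refine h.trans (mul_le_of_le_one_right (by positivity) ?_)
  rw [Real.norm_eq_abs, abs_of_nonneg (by linarith)]
  linarith

/-- Removing the linear term s a^(-s-1) from the difference gains one more power of decay; this
gives convergence of the Abel-summed series at s = 0. -/
lemma norm_cpow_second_difference_le {a : ℝ} (ha : 0 < a) {s : ℂ} (hs : -2 ≤ s.re) :
    ‖(a : ℂ) ^ (-s) - ((a + 1 : ℝ) : ℂ) ^ (-s) - s * (a : ℂ) ^ (-(s + 1))‖ ≤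
      ‖s‖ * ‖s + 1‖ * a ^ (-s.re - 2) := by
  have hd : ∀ x ∈ Set.Icc a (a + 1), HasDerivWithinAt
      (fun x : ℝ => -(x : ℂ) ^ (-s) - s * (a : ℂ) ^ (-(s + 1)) * x)
      (s * ((x : ℂ) ^ (-(s + 1)) - (a : ℂ) ^ (-(s + 1)))) (Set.Icc a (a + 1)) x := by
    intro x hx
    have hx0 : 0 < x := ha.trans_le hx.1
    have h1 : HasDerivAt (fun w : ℂ => -w ^ (-s) - s * (a : ℂ) ^ (-(s + 1)) * w)
        (-(-s * (x : ℂ) ^ (-s - 1)) - s * (a : ℂ) ^ (-(s + 1)) * 1) (x : ℂ) := by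
      have := (hasDerivAt_id (x : ℂ)).cpow_const (c := -s) (Or.inl (by simpa using hx0))
      simp only [id, mul_one] at this
      exact this.fun_neg.fun_sub ((hasDerivAt_id (x : ℂ)).const_mul _)
    refine (h1.comp_ofReal.congr_deriv ?_).hasDerivWithinAt
    rw [show -s - 1 = -(s + 1) by ring]
    ring
  have hb : ∀ x ∈ Set.Icc a (a + 1), ‖s * ((x : ℂ) ^ (-(s + 1)) - (a : ℂ) ^ (-(s + 1)))‖ ≤
      ‖s‖ * (‖s + 1‖ * a ^ (-s.re - 2)) := by
    intro x hx
    rw [norm_mul]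
    gcongr
    refine (norm_ofReal_cpow_neg_sub_le ha hx.1 hx.2 (by simp; linarith)).trans_eq ?_
    congr 2
    simp; ring
  have h := (convex_Icc a (a + 1)).norm_image_sub_le_of_norm_hasDerivWithin_le hd hb
    (x := a) (y := a + 1) ⟨le_rfl, by linarith⟩ ⟨by linarith, le_rfl⟩
  rw [add_sub_cancel_left, norm_one, mul_one, ← mul_assoc] at h
  refine le_of_eq_of_le (congrArg norm ?_) h
  push_cast
  ring

section

variable {M : ℕ} [NeZero M]

lemma hasSum_LFunction (Ψ : ZMod M → ℂ) {s : ℂ} (hs : 1 < s.re) :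
    HasSum (fun k : ℕ => Ψ ((k + 1 : ℕ) : ZMod M) * ((k : ℂ) + 1) ^ (-s)) (ZMod.LFunction Ψ s) := by
  have h := (ZMod.LSeriesSummable_of_one_lt_re Ψ hs).hasSum
  rw [← LSeries, ← ZMod.LFunction_eq_LSeries Ψ hs, ← hasSum_nat_add_iff' 1] at h
  have e : ∀ k : ℕ, LSeries.term (fun n : ℕ => Ψ n) s (k + 1) =
      Ψ ((k + 1 : ℕ) : ZMod M) * ((k : ℂ) + 1) ^ (-s) := by
    intro k
    rw [LSeries.term_of_ne_zero (by omega), cpow_neg, div_eq_mul_inv]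
    push_cast
    rfl
  simp only [e] at h
  simpa using h

/-- Abel summation gives -Ψ(0) + ∑ Ψ(n) (n^(-s) - (n+1)^(-s)) for Re s > 1. Splitting off s L(s+1,
Ψ), entire times s because Ψ has zero sum, leaves a series that converges near s = 0 and vanishes
there term by term. -/
lemma LFunction_sub_shift_zero {Ψ : ZMod M → ℂ} (hΨ : ∑ a, Ψ a = 0) :
    ZMod.LFunction (fun a => Ψ a - Ψ (a - 1)) 0 = -Ψ 0 := by
  obtain ⟨K, hK⟩ : ∃ K : ℝ, ∀ a, ‖Ψ a‖ ≤ K := by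
    refine ⟨∑ a, ‖Ψ a‖, fun a => ?_⟩
    exact Finset.single_le_sum (f := fun a => ‖Ψ a‖) (fun _ _ => norm_nonneg _) (Finset.mem_univ a)
  have hK0 : 0 ≤ K := (norm_nonneg _).trans (hK 0)
  have hΦ : ∑ a, (Ψ a - Ψ (a - 1)) = 0 := by
    rw [Finset.sum_sub_distrib, sub_eq_zero]
    exact ((Equiv.subRight (1 : ZMod M)).sum_comp Ψ).symm
  set T : ℕ → ℂ → ℂ := fun k s => Ψ ((k + 1 : ℕ) : ZMod M) * (((k : ℂ) + 1) ^ (-s) -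
    ((k : ℂ) + 2) ^ (-s) - s * ((k : ℂ) + 1) ^ (-(s + 1))) with hT
  -- A bounded convex domain containing both 0 and a point of absolute convergence, here 3;
  -- boundedness makes the tail estimate uniform in s.
  set U : Set ℂ := {s | -(1 / 2) < s.re} ∩ Metric.ball 0 5 with hU
  have hUo : IsOpen U := (isOpen_lt continuous_const continuous_re).inter Metric.isOpen_ball
  have hUc : Convex ℝ U := (convex_halfSpace_re_gt _).inter (convex_ball _ _)
  have hk1 : ∀ k : ℕ, (k : ℂ) + 2 ≠ 0 := fun k => by exact_mod_cast (by omega : k + 2 ≠ 0)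
  have hbound : ∀ k, ∀ s ∈ U, ‖T k s‖ ≤ K * (5 * 6) * (1 / ((k : ℝ) + 1) ^ (3 / 2 : ℝ)) := by
    intro k s hs
    have hs1 : -(1 / 2) < s.re := hs.1
    have hs2 : ‖s‖ < 5 := by simpa using hs.2
    have hkpos : (0 : ℝ) < (k : ℝ) + 1 := by positivity
    have h := norm_cpow_second_difference_le hkpos (s := s) (by linarith)
    have e : (k : ℝ) + 1 + 1 = k + 2 := by ring
    rw [e] at h
    push_cast at h
    rw [hT, norm_mul, mul_assoc]
    gcongr
    · exact hK _
    · refine h.trans ?_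
      gcongr
      · calc ‖s + 1‖ ≤ ‖s‖ + ‖(1 : ℂ)‖ := norm_add_le _ _
          _ ≤ 6 := by rw [norm_one]; linarith
      · rw [one_div, ← Real.rpow_neg hkpos.le]
        exact Real.rpow_le_rpow_of_exponent_le (by linarith [k.cast_nonneg (α := ℝ)]) (by linarith)
  have hsum : Summable fun k : ℕ => K * (5 * 6) * (1 / ((k : ℝ) + 1) ^ (3 / 2 : ℝ)) := by
    refine Summable.mul_left _ ?_
    have := (summable_nat_add_iff 1).mpr
      (Real.summable_one_div_nat_rpow.mpr (by norm_num : (1 : ℝ) < 3 / 2))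
    simpa using this
  have hTd : ∀ k, Differentiable ℂ (T k) := by
    intro k s
    have h1 := natCast_add_one_ne_zero k
    have h2 := hk1 k
    simp only [hT]
    have d1 : DifferentiableAt ℂ (fun s : ℂ => ((k : ℂ) + 1) ^ (-s)) s :=
      (differentiableAt_id.neg).const_cpow (Or.inl h1)
    have d2 : DifferentiableAt ℂ (fun s : ℂ => ((k : ℂ) + 2) ^ (-s)) s :=
      (differentiableAt_id.neg).const_cpow (Or.inl h2)
    have d3 : DifferentiableAt ℂ (fun s : ℂ => ((k : ℂ) + 1) ^ (-(s + 1))) s :=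
      ((differentiableAt_id.add_const 1).neg).const_cpow (Or.inl h1)
    fun_prop
  have hR : DifferentiableOn ℂ (fun s => ∑' k, T k s) U :=
    differentiableOn_tsum_of_summable_norm hsum (fun k => (hTd k).differentiableOn) hUo hbound
  have hL1 := ZMod.differentiable_LFunction_of_sum_zero hΦ
  have hL2 := ZMod.differentiable_LFunction_of_sum_zero hΨ
  have han1 : AnalyticOnNhd ℂ (ZMod.LFunction (fun a => Ψ a - Ψ (a - 1))) U :=
    hL1.differentiableOn.analyticOnNhd hUo
  have han2 : AnalyticOnNhd ℂ (fun s => -Ψ 0 + ∑' k, T k s + s * ZMod.LFunction Ψ (s + 1)) U := by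
    refine DifferentiableOn.analyticOnNhd ?_ hUo
    have : Differentiable ℂ fun s => s * ZMod.LFunction Ψ (s + 1) :=
      differentiable_id.mul (hL2.comp (differentiable_id.add_const 1))
    exact (hR.const_add _).add this.differentiableOn
  have hmem : (3 : ℂ) ∈ U := ⟨by simp; norm_num, by simp; norm_num⟩
  have hev : ZMod.LFunction (fun a => Ψ a - Ψ (a - 1)) =ᶠ[𝓝 3]
      fun s => -Ψ 0 + ∑' k, T k s + s * ZMod.LFunction Ψ (s + 1) := by
    have h1 : ∀ᶠ s : ℂ in 𝓝 3, 1 < s.re :=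
      continuous_re.continuousAt.eventually (lt_mem_nhds (by simp))
    filter_upwards [h1, hUo.mem_nhds hmem] with s hs hsU
    have S0 := hasSum_LFunction (fun a => Ψ a - Ψ (a - 1)) hs
    have S1 := hasSum_LFunction Ψ hs
    have S2 := (hasSum_LFunction Ψ (s := s + 1) (by simp; linarith)).mul_left s
    have S3 : HasSum (fun k => T k s) (∑' k, T k s) :=
      (Summable.of_norm_bounded hsum fun k => hbound k s hsU).hasSum
    have S4 := (S1.sub S3).sub S2
    have e4 : ∀ k : ℕ, Ψ ((k + 1 : ℕ) : ZMod M) * ((k : ℂ) + 1) ^ (-s) - T k s -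
        s * (Ψ ((k + 1 : ℕ) : ZMod M) * ((k : ℂ) + 1) ^ (-(s + 1))) =
        Ψ ((k + 1 : ℕ) : ZMod M) * (((k + 1 : ℕ) : ℂ) + 1) ^ (-s) := by
      intro k
      simp only [hT]
      push_cast
      rw [show (k : ℂ) + 1 + 1 = k + 2 by ring]
      ring
    simp only [e4] at S4
    have S5 := (hasSum_nat_add_iff (f := fun k : ℕ => Ψ (k : ZMod M) * ((k : ℂ) + 1) ^ (-s)) 1).mp S4
    have S6 := S1.sub S5
    have e6 : ∀ k : ℕ, Ψ ((k + 1 : ℕ) : ZMod M) * ((k : ℂ) + 1) ^ (-s) -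
        Ψ (k : ZMod M) * ((k : ℂ) + 1) ^ (-s) = (Ψ ((k + 1 : ℕ) : ZMod M) -
          Ψ (((k + 1 : ℕ) : ZMod M) - 1)) * ((k : ℂ) + 1) ^ (-s) := by
      intro k
      push_cast
      rw [add_sub_cancel_right]
      ring
    simp only [e6] at S6
    rw [S0.unique S6]
    simp
    ring
  have := han1.eqOn_of_preconnected_of_eventuallyEq han2 hUc.isPreconnected hmem hev
    (show (0 : ℂ) ∈ U from ⟨by simp, by simp⟩)
  rw [this]
  simp [hT]

/-- Zero mean makes the partial sums of f periodic, so f is the difference of a periodic function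
and its shift. The value is written as the sum of f against the triangle function. -/
lemma Lfun_zero {f : ℤ → ℂ} (hf : Function.Periodic f (M : ℤ)) (h0 : mean M f = 0) :
    Lfun M f 0 = ∑ m ∈ Finset.range M, f ((m : ℤ) + 1) * (1 - ((m : ℂ) + 1) / M) := by
  have hM := cast_M_ne_zero (M := M)
  set A : ℕ → ℂ := fun n => ∑ m ∈ Finset.range n, f ((m : ℤ) + 1) with hA
  have hAM : A M = 0 := by
    have h1 : ∑ m ∈ Finset.Icc 1 M, f (m : ℤ) = A M := by
      simp only [hA]
      rw [Finset.range_eq_Ico]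
      exact (Finset.sum_Ico_add' (fun l : ℕ => f (l : ℤ)) 0 M 1).symm
    rw [mean, h1] at h0
    simpa [hM] using h0
  have hAs : ∀ n, A (n + 1) = A n + f ((n : ℤ) + 1) := fun n => Finset.sum_range_succ _ n
  have hper : Function.Periodic A M := by
    intro n
    induction n with
    | zero => simpa [hA] using hAM
    | succ n ih =>
      rw [add_right_comm, hAs, hAs, ih]
      congr 1
      rw [← hf ((n : ℤ) + 1)]
      congr 1
      push_cast
      ring
  have hval : ∀ n : ℕ, A ((n : ZMod M).val) = A n := by
    intro n
    rw [ZMod.val_natCast, hper.map_mod_nat]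
  have hsumA : ∀ N : ℕ, ∑ n ∈ Finset.range N, A n =
      ∑ m ∈ Finset.range N, f ((m : ℤ) + 1) * ((N : ℂ) - (m + 1)) := by
    intro N
    induction N with
    | zero => simp
    | succ N ih =>
      rw [Finset.sum_range_succ, ih, Finset.sum_range_succ _ N]
      simp only [hA]
      rw [← Finset.sum_add_distrib]
      push_cast
      rw [sub_self, mul_zero, add_zero]
      refine Finset.sum_congr rfl fun m _ => ?_
      ring
  -- Subtracting the mean of the partial sums does not change the difference, and it gives Ψ sum
  -- zero.
  set Ψ : ZMod M → ℂ := fun a => A a.val - 1 / M * ∑ n ∈ Finset.range M, A n with hΨ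
  have hΨ0 : ∑ a, Ψ a = 0 := by
    rw [sum_zmod_eq_sum_range]
    simp only [hΨ, hval, Finset.sum_sub_distrib, Finset.sum_const, Finset.card_range, nsmul_eq_mul]
    field_simp
    ring
  have hΨf : (fun a => Ψ a - Ψ (a - 1)) = fun a : ZMod M => f (a.val : ℤ) := by
    funext a
    have ha : a = (((a - 1).val + 1 : ℕ) : ZMod M) := by simp
    have hA1 : A a.val = A (a - 1).val + f (a.val : ℤ) := by
      have h1 : A a.val = A ((a - 1).val + 1) := by rw [← hval ((a - 1).val + 1), ← ha]
      have h2 : f (a.val : ℤ) = f (((a - 1).val : ℤ) + 1) := by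
        rw [← intCast_val_apply hf (((a - 1).val : ℤ) + 1)]
        simp
      rw [h1, hAs, h2]
    simp only [hΨ, hA1]
    ring
  have h := LFunction_sub_shift_zero hΨ0
  rw [hΨf] at h
  rw [Lfun, h]
  simp only [hΨ, ZMod.val_zero]
  rw [show A 0 = 0 from Finset.sum_range_zero _, hsumA, zero_sub, neg_neg, Finset.mul_sum]
  refine Finset.sum_congr rfl fun m _ => ?_
  field_simp

end

/-! ### Borel sums -/

/-- A nonpositive real value would force r |sin α| = |Im w| < |sin α|/2, hence r < 1/2; then the
real part would still be positive. -/
lemma one_sub_ray_sub_mem {α r : ℝ} {w : ℂ} (hα : Real.sin α ≠ 0) (hr : 0 ≤ r)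
    (hw : ‖w‖ < |Real.sin α| / 2) :
    1 - r * exp (I * α) - w ∈ slitPlane ∧ |Real.sin α| / 2 ≤ ‖1 - r * exp (I * α) - w‖ := by
  have hs : 0 < |Real.sin α| := abs_pos.mpr hα
  have hs1 : |Real.sin α| ≤ 1 := Real.abs_sin_le_one α
  have h1 : |Real.sin α| ≤ ‖1 - r * exp (I * α)‖ := by
    simpa using abs_sin_mul_le_norm_sub' α 1 r
  refine ⟨?_, ?_⟩
  · rw [mem_slitPlane_iff]
    by_contra! hcon
    obtain ⟨hre, him⟩ := hcon
    have e1 : (1 - r * exp (I * α) - w).re = 1 - r * Real.cos α - w.re := by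
      rw [mul_comm I]; simp [exp_ofReal_mul_I_re]
    have e2 : (1 - r * exp (I * α) - w).im = -(r * Real.sin α) - w.im := by
      rw [mul_comm I]; simp [exp_ofReal_mul_I_im]
    rw [e1] at hre
    rw [e2] at him
    have hwi := abs_im_le_norm w
    have hwr := (abs_le.mp (abs_re_le_norm w)).2
    have h3 : r * |Real.sin α| = |w.im| := by
      rw [show w.im = -(r * Real.sin α) by linarith, abs_neg, abs_mul, abs_of_nonneg hr]
    have h4 : r < 1 / 2 := by
      by_contra! h5
      nlinarith
    have h6 : r * Real.cos α ≤ r := mul_le_of_le_one_right hr (Real.cos_le_one α)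
    linarith
  · have := norm_sub_norm_le (1 - r * exp (I * α)) w
    linarith

section

variable {M : ℕ} [NeZero M] {f : ℤ → ℂ} {j : ℕ} {σ ε : ℝ} {τ : ℂ}

lemma exp_I_mul_pi_half_sub (σ ε : ℝ) :
    exp (I * ((Real.pi / 2 - σ * ε : ℝ) : ℂ)) = I * exp (I * (-σ * ε : ℝ)) := by
  rw [show I * ((Real.pi / 2 - σ * ε : ℝ) : ℂ) = Real.pi / 2 * I + I * (-σ * ε : ℝ) by
    push_cast; ring, exp_add, exp_pi_div_two_mul_I]

omit [NeZero M] in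
lemma singPoint_eq_norm_mul_I (k : ℕ) : singPoint M k = ‖singPoint M k‖ * I := by
  rw [norm_singPoint, singPoint]
  push_cast
  ring

lemma singPoint_norm_pos (k : ℕ) : 0 < ‖singPoint M k‖ := norm_pos_iff.mpr (singPoint_ne_zero k)

omit [NeZero M] in
lemma singPoint_div_mul_exp (k : ℕ) (σ ε : ℝ) (τ : ℂ) :
    singPoint M k / τ * exp (I * (-σ * ε : ℝ)) =
      ‖singPoint M k‖ * (exp (I * ((Real.pi / 2 - σ * ε : ℝ) : ℂ)) / τ) := by
  rw [exp_I_mul_pi_half_sub]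
  conv_lhs => rw [singPoint_eq_norm_mul_I]
  ring

lemma ray_div_singPoint (k : ℕ) (σ ε r : ℝ) :
    r * exp (I * ((Real.pi / 2 - σ * ε : ℝ) : ℂ)) / singPoint M k =
      ((r * ‖singPoint M k‖⁻¹ : ℝ) : ℂ) * exp (I * (-σ * ε : ℝ)) := by
  have h : (‖singPoint M k‖ : ℂ) ≠ 0 := ofReal_ne_zero.mpr (singPoint_norm_pos k).ne'
  rw [exp_I_mul_pi_half_sub]
  conv_lhs => rw [singPoint_eq_norm_mul_I]
  push_cast
  field_simp

lemma one_sub_div_singPoint_mem (hα : Real.sin (-σ * ε) ≠ 0) {ζ : ℂ}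
    (hζ : ζ ∈ rayNhd (Real.pi / 2 - σ * ε) (|Real.sin (-σ * ε)| / 2 * (Real.pi / M))) (k : ℕ) :
    1 - ζ / singPoint M k ∈ slitPlane ∧
      |Real.sin (-σ * ε)| / 2 ≤ ‖1 - ζ / singPoint M k‖ := by
  obtain ⟨r, hr, hlt⟩ := hζ
  have hk := singPoint_norm_pos (M := M) k
  have e : 1 - ζ / singPoint M k = 1 - ((r * ‖singPoint M k‖⁻¹ : ℝ) : ℂ) *
      exp (I * (-σ * ε : ℝ)) -
      (ζ - r * exp (I * ((Real.pi / 2 - σ * ε : ℝ) : ℂ))) / singPoint M k := by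
    rw [sub_div, ray_div_singPoint]
    ring
  rw [e]
  refine one_sub_ray_sub_mem hα (by positivity) ?_
  rw [norm_div, div_lt_iff₀ hk]
  refine hlt.trans_le ?_
  gcongr
  exact pi_div_le_norm_singPoint k

/-- The Borel transform of a partial theta series has a Laplace transform in every direction
transversal to the imaginary axis. -/
lemma hasBorelSum_thetaTilde (hf : Function.Periodic f (M : ℤ)) (h : OppositeParity j f)
    (hα : Real.sin (-σ * ε) ≠ 0)
    (hτ : 0 < (exp (I * ((Real.pi / 2 - σ * ε : ℝ) : ℂ)) / τ).re) :
    ∃ S : ℂ, HasSum (fun k => borelCoeff j f M k *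
        rayInt (singPoint M k / τ) (-σ * ε) (opD (singPoly j)) 1) S ∧
      HasBorelSum (Real.pi / 2 - σ * ε) (thetaTilde j f M) τ
        (PowerSeries.coeff 0 (thetaTilde j f M) + S) := by
  obtain ⟨P, hP⟩ : ∃ P, P = opD (singPoly j) := ⟨_, rfl⟩
  set θ := Real.pi / 2 - σ * ε with hθ
  set α := -σ * ε with hαdef
  have hs : 0 < |Real.sin α| := abs_pos.mpr hα
  obtain ⟨B, hB, hgerm⟩ := norm_germ_le P (c := |Real.sin α| / 2) (by positivity)
  have hsum := summable_norm_borelCoeff_div j f M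
  have hδ : 0 < |Real.sin α| / 2 * (Real.pi / M) := by
    have := cast_M_pos (M := M)
    have := Real.pi_pos
    positivity
  have hray : ∀ r : ℝ, 0 ≤ r → (r : ℂ) * exp (I * θ) ∈
      rayNhd θ (|Real.sin α| / 2 * (Real.pi / M)) := fun r hr => ⟨r, hr, by simpa using hδ⟩
  have hterm : ∀ ζ ∈ rayNhd θ (|Real.sin α| / 2 * (Real.pi / M)), ∀ k,
      ‖borelCoeff j f M k / singPoint M k * germ P 1 (1 - ζ / singPoint M k)‖ ≤
        ‖borelCoeff j f M k / singPoint M k‖ * B := by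
    intro ζ hζ k
    rw [norm_mul]
    gcongr
    exact hgerm 1 _ norm_one (one_sub_div_singPoint_mem hα hζ k).2
  -- Rescaling r by |ω_k| turns the k-th term of the Laplace integrand into the normalized `rayFun`
  -- with μ = ω_k/τ and angle measured from the imaginary axis.
  set F : ℕ → ℝ → ℂ := fun k r => borelCoeff j f M k * ((‖singPoint M k‖⁻¹ : ℝ) •
    rayFun (singPoint M k / τ) α P 1 (r * ‖singPoint M k‖⁻¹)) with hF
  have hFeq : ∀ k r, F k r = exp (-(r * exp (I * θ)) / τ) *
      (borelCoeff j f M k / singPoint M k * germ P 1 (1 - r * exp (I * θ) / singPoint M k)) *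
      exp (I * θ) := by
    intro k r
    have hk := singPoint_ne_zero (M := M) k
    have hn : (‖singPoint M k‖ : ℂ) ≠ 0 := ofReal_ne_zero.mpr (singPoint_norm_pos k).ne'
    have h1 := ray_div_singPoint (M := M) k σ ε r
    rw [← hθ, ← hαdef] at h1
    simp only [hF, rayFun, real_smul]
    rw [← h1, ofReal_one, exp_I_mul_pi_half_sub, ← hαdef]
    have e1 : -(singPoint M k / τ) * (r * (I * exp (I * α)) / singPoint M k) =
        -(r * (I * exp (I * α))) / τ := by
      field_simp
    rw [e1]
    have e2 : ((‖singPoint M k‖⁻¹ : ℝ) : ℂ) = I / singPoint M k := by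
      conv_rhs => rw [singPoint_eq_norm_mul_I]
      push_cast
      field_simp
    rw [e2]
    ring
  have hFint : ∀ k, IntegrableOn (F k) (Set.Ioi 0) := by
    intro k
    have hk := singPoint_norm_pos (M := M) k
    have hre : 0 < (singPoint M k / τ * exp (I * α)).re := by
      rw [hαdef, singPoint_div_mul_exp, re_ofReal_mul]
      positivity
    have h1 := integrableOn_rayFun hα hre P one_pos
    have h2 := (integrableOn_Ioi_comp_mul_right_iff (rayFun (singPoint M k / τ) α P 1) 0
      (inv_pos.mpr hk)).mpr (by simpa using h1)
    exact (h2.smul (‖singPoint M k‖⁻¹ : ℝ)).const_mul _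
  have hFval : ∀ k, ∫ r in Set.Ioi (0 : ℝ), F k r =
      borelCoeff j f M k * rayInt (singPoint M k / τ) α P 1 := by
    intro k
    have hk := singPoint_norm_pos (M := M) k
    simp only [hF]
    rw [integral_const_mul, integral_smul, integral_comp_mul_right_Ioi _ 0 (inv_pos.mpr hk),
      zero_mul, smul_smul, inv_inv, inv_mul_cancel₀ hk.ne', one_smul, rayInt]
  have hFnorm : ∀ k, ∀ r ∈ Set.Ioi (0 : ℝ), ‖F k r‖ ≤
      ‖borelCoeff j f M k / singPoint M k‖ * B * Real.exp (-(exp (I * θ) / τ).re * r) := by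
    intro k r hr
    rw [hFeq, norm_mul, norm_mul, norm_exp_I_mul, mul_one, norm_exp, mul_comm]
    gcongr
    · exact hterm _ (hray r (le_of_lt hr)) k
    · rw [show -((r : ℂ) * exp (I * θ)) / τ = ((-r : ℝ) : ℂ) * (exp (I * θ) / τ) by
        push_cast; ring, re_ofReal_mul]
      linarith
  have hexp := exp_neg_integrableOn_Ioi 0 hτ
  have hFsum : Summable fun k => ∫ r in Set.Ioi (0 : ℝ), ‖F k r‖ := by
    refine Summable.of_nonneg_of_le (fun k => integral_nonneg fun _ => norm_nonneg _) (fun k => ?_)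
      (hsum.mul_right (B * ∫ r in Set.Ioi (0 : ℝ), Real.exp (-(exp (I * θ) / τ).re * r)))
    rw [← mul_assoc, ← integral_const_mul]
    exact setIntegral_mono_on (hFint k).norm (hexp.const_mul _) measurableSet_Ioi (hFnorm k)
  have hS := hasSum_integral_of_summable_integral_norm hFint hFsum
  simp only [hFval] at hS
  -- The branch with all cuts pointing away from 0 is bounded on the neighbourhood of the ray, so
  -- the exponential type is 0.
  refine ⟨_, hP ▸ hS, borelBranch j f M fun _ => 1, _,
    ∑' k, ‖borelCoeff j f M k / singPoint M k‖ * B, 0, hδ, le_rfl, hτ,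
    isBorelTransform_borelBranch hf h fun _ => Or.inl rfl, ?_, ?_, ?_⟩
  · intro ζ hζ
    refine analyticAt_singSum (N := 0) _ hsum (fun _ => norm_one) (fun _ _ => rfl) fun k => ?_
    rw [one_mul]
    exact Or.inr (one_sub_div_singPoint_mem hα hζ k).1
  · intro ζ hζ
    rw [zero_mul, Real.exp_zero, mul_one, borelBranch, singSum, ← hP]
    exact tsum_of_norm_bounded (hsum.mul_right B).hasSum fun k => hterm ζ hζ k
  · congr 2
    funext r
    simp only [hFeq]
    rw [tsum_mul_right, tsum_mul_left, borelBranch, singSum, ← hP]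

lemma re_exp_div_pos {θ : ℝ} (hτ : 0 < τ.im) (h1 : θ - Real.pi / 2 < arg τ)
    (h2 : arg τ < θ + Real.pi / 2) : 0 < (exp (I * θ) / τ).re := by
  have hτ0 : τ ≠ 0 := by rintro rfl; simp at hτ
  have hn : 0 < ‖τ‖ := norm_pos_iff.mpr hτ0
  have e : exp (I * θ) / τ = ((‖τ‖⁻¹ : ℝ) : ℂ) * exp (((θ - arg τ : ℝ) : ℂ) * I) := by
    conv_lhs => rw [← norm_mul_exp_arg_mul_I τ]
    rw [show ((θ - arg τ : ℝ) : ℂ) * I = I * θ - arg τ * I by push_cast; ring, exp_sub]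
    push_cast
    field_simp
  rw [e, re_ofReal_mul, exp_ofReal_mul_I_re]
  exact mul_pos (inv_pos.mpr hn) (Real.cos_pos_of_mem_Ioo ⟨by linarith, by linarith⟩)

end

/-! ### Poisson summation on the half-line -/

section

open FourierTransform

variable {M : ℕ} {f : ℤ → ℂ} {φ : ℝ → ℂ} {s : ℂ}

lemma exists_norm_le_of_periodic [NeZero M] (hf : Function.Periodic f (M : ℤ)) :
    ∃ D : ℝ, 0 ≤ D ∧ ∀ n, ‖f n‖ ≤ D := by
  refine ⟨∑ a : ZMod M, ‖f (a.val : ℤ)‖, Finset.sum_nonneg fun _ _ => norm_nonneg _, fun n => ?_⟩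
  rw [← intCast_val_apply hf n]
  exact Finset.single_le_sum (f := fun a : ZMod M => ‖f (a.val : ℤ)‖)
    (fun _ _ => norm_nonneg _) (Finset.mem_univ _)

/-- The Fourier integral on the half-line, of frequency `n / M`, with parity `s = ±1`. -/
def halfFourier (M : ℕ) (s : ℂ) (φ : ℝ → ℂ) (n : ℤ) : ℂ :=
  ∫ x in Set.Ioi (0 : ℝ), φ x * (exp (((2 * Real.pi * n / M * x : ℝ) : ℂ) * I) +
    s * exp (-(((2 * Real.pi * n / M * x : ℝ) : ℂ) * I)))

lemma halfFourier_neg (hs : s * s = 1) (n : ℤ) :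
    halfFourier M s φ (-n) = s * halfFourier M s φ n := by
  rw [halfFourier, halfFourier, ← integral_const_mul]
  congr 1
  funext x
  have e : (((2 * Real.pi * ((-n : ℤ) : ℝ) / M * x : ℝ) : ℂ) * I) =
      -(((2 * Real.pi * n / M * x : ℝ) : ℂ) * I) := by push_cast; ring
  rw [e, neg_neg]
  linear_combination -φ x * exp (-((((2 * Real.pi * n / M * x : ℝ) : ℂ) * I))) * hs

/-- The extension of a function on the half-line with parity `s = ±1`. -/
def parityExtension (s : ℂ) (φ : ℝ → ℂ) (x : ℝ) : ℂ := if 0 ≤ x then φ x else s * φ (-x)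

lemma continuous_parityExtension (hφ : Continuous φ) (h0 : φ 0 = 0) :
    Continuous (parityExtension s φ) := by
  refine Continuous.if_le hφ (by fun_prop) continuous_const continuous_id ?_
  rintro x rfl
  simp [h0]

lemma parityExtension_of_nonneg {x : ℝ} (hx : 0 ≤ x) : parityExtension s φ x = φ x := if_pos hx

lemma parityExtension_neg {x : ℝ} (hx : 0 < x) : parityExtension s φ (-x) = s * φ x := by
  rw [parityExtension, if_neg (by linarith), neg_neg]

lemma norm_parityExtension_le (hs : ‖s‖ = 1) {C : ℝ} (hC : ∀ x, 0 < x → ‖φ x‖ ≤ C / x ^ 2)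
    {x : ℝ} (hx : x ≠ 0) : ‖parityExtension s φ x‖ ≤ C / x ^ 2 := by
  rcases lt_or_gt_of_ne hx with h | h
  · have := parityExtension_neg (s := s) (φ := φ) (x := -x) (by linarith)
    rw [neg_neg] at this
    rw [this, norm_mul, hs, one_mul, ← neg_sq x]
    exact hC _ (by linarith)
  · rw [parityExtension_of_nonneg h.le]
    exact hC x h

lemma fourier_parityExtension [NeZero M] (hφi : IntegrableOn φ (Set.Ioi 0)) (hs : s * s = 1)
    (n : ℤ) : 𝓕 (fun x : ℝ => parityExtension s φ (M * x)) (n : ℝ) =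
      s / M * halfFourier M s φ n := by
  have hM : (0 : ℝ) < M := cast_M_pos
  have hMc := cast_M_ne_zero (M := M)
  rw [Real.fourier_real_eq_integral_exp_smul]
  set E : ℝ → ℂ := fun y => exp (-(((2 * Real.pi * n / M * y : ℝ) : ℂ) * I)) with hE
  have hEn : ∀ y, ‖E y‖ ≤ 1 := by
    intro y
    simp only [hE]
    rw [show -(((2 * Real.pi * n / M * y : ℝ) : ℂ) * I) =
      ((-(2 * Real.pi * n / M * y) : ℝ) : ℂ) * I by push_cast; ring, norm_exp_ofReal_mul_I]
  have hEc : Continuous E := by fun_prop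
  have h1 : ∀ x : ℝ, exp (((-2 * Real.pi * x * n : ℝ) : ℂ) * I) • parityExtension s φ (M * x) =
      E (M * x) * parityExtension s φ (M * x) := by
    intro x
    rw [smul_eq_mul, hE]
    congr 2
    push_cast
    field_simp
  simp only [h1]
  rw [Measure.integral_comp_mul_left (fun y => E y * parityExtension s φ y) (M : ℝ)]
  have i1 : IntegrableOn (fun y => E y * parityExtension s φ y) (Set.Ioi 0) := by
    have : IntegrableOn (fun y => E y * φ y) (Set.Ioi 0) :=
      hφi.bdd_mul (c := 1) hEc.aestronglyMeasurable (Eventually.of_forall hEn)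
    refine this.congr_fun (fun y hy => ?_) measurableSet_Ioi
    simp only [parityExtension_of_nonneg (le_of_lt (Set.mem_Ioi.mp hy))]
  have i2' : IntegrableOn (fun y => E (-y) * parityExtension s φ (-y)) (Set.Ioi 0) := by
    have : IntegrableOn (fun y => E (-y) * (s * φ y)) (Set.Ioi 0) :=
      (hφi.const_mul s).bdd_mul (c := 1) (by fun_prop)
        (Eventually.of_forall fun y => hEn (-y))
    refine this.congr_fun (fun y hy => ?_) measurableSet_Ioi
    simp only [parityExtension_neg (Set.mem_Ioi.mp hy)]
  have i2 : IntegrableOn (fun y => E y * parityExtension s φ y) (Set.Iic 0) := by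
    rw [integrableOn_Iic_iff_integrableOn_Iio]
    have h := (Measure.measurePreserving_neg (volume : Measure ℝ)).integrableOn_comp_preimage
      (MeasurableEquiv.neg ℝ).measurableEmbedding
      (f := fun y => E y * parityExtension s φ y) (s := Set.Iio 0)
    rw [← h, show (Neg.neg : ℝ → ℝ) ⁻¹' Set.Iio 0 = Set.Ioi 0 by ext; simp]
    exact i2'
  rw [← intervalIntegral.integral_Iic_add_Ioi i2 i1]
  have e2 : ∫ y in Set.Iic (0 : ℝ), E y * parityExtension s φ y =
      ∫ y in Set.Ioi (0 : ℝ), E (-y) * parityExtension s φ (-y) := by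
    have := integral_comp_neg_Ioi 0 (fun y => E y * parityExtension s φ y)
    rw [neg_zero] at this
    exact this.symm
  rw [e2, ← integral_add i2' i1, halfFourier, abs_of_pos (inv_pos.mpr hM), real_smul,
    ← integral_const_mul, ← integral_const_mul]
  refine setIntegral_congr_fun measurableSet_Ioi fun y hy => ?_
  have hy' : 0 < y := hy
  simp only [parityExtension_neg hy', parityExtension_of_nonneg hy'.le, hE]
  have e3 : -(((2 * Real.pi * n / M * -y : ℝ) : ℂ) * I) =
      ((2 * Real.pi * n / M * y : ℝ) : ℂ) * I := by push_cast; ring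
  rw [e3]
  rw [ofReal_inv, ofReal_natCast]
  linear_combination -φ y * (M : ℂ)⁻¹ * exp (-(((2 * Real.pi * n / M * y : ℝ) : ℂ) * I)) * hs

/-- Poisson summation for a periodic function with parity on the half-line. -/
theorem tsum_mul_eq_tsum_dft_mul_halfFourier [NeZero M] (hf : Function.Periodic f (M : ℤ))
    (hs : s * s = 1) (hfs : ∀ n, f (-n) = s * f n) (hds : ∀ n, dft M f (-n) = s * dft M f n)
    (hd0 : dft M f 0 = 0) (hφ : Continuous φ) (h0 : φ 0 = 0) {C : ℝ}
    (hC : ∀ x, 0 < x → ‖φ x‖ ≤ C / x ^ 2) (hφi : IntegrableOn φ (Set.Ioi 0))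
    (hJ : Summable fun k : ℕ => halfFourier M s φ ((k : ℤ) + 1)) :
    ∑' k : ℕ, f ((k : ℤ) + 1) * φ ((k : ℝ) + 1) =
      ∑' k : ℕ, (Real.sqrt M : ℂ)⁻¹ * (dft M f ((k : ℤ) + 1) * halfFourier M s φ ((k : ℤ) + 1)) := by
  have hM : (0 : ℝ) < M := cast_M_pos
  have hMc := cast_M_ne_zero (M := M)
  have hsn : ‖s‖ = 1 := by
    have := congrArg norm hs
    rw [norm_mul, norm_one] at this
    nlinarith [norm_nonneg s]
  set G := parityExtension s φ with hG
  have hGc : Continuous G := continuous_parityExtension hφ h0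
  -- summability over the integers
  have hGs : Summable fun n : ℤ => G n := by
    have hz : Summable fun n : ℤ => C * (1 / (n : ℝ) ^ 2) :=
      (Real.summable_one_div_int_pow.mpr one_lt_two).mul_left C
    refine Summable.of_norm_bounded_eventually hz ?_
    filter_upwards [(Set.finite_singleton (0 : ℤ)).compl_mem_cofinite] with n hn
    have : (n : ℝ) ≠ 0 := by exact_mod_cast hn
    exact (norm_parityExtension_le hsn hC this).trans_eq (by ring)
  obtain ⟨D, -, hD⟩ := exists_norm_le_of_periodic hf
  have hfGs : Summable fun n : ℤ => f n * G n := by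
    refine Summable.of_norm_bounded (hGs.norm.mul_left D) fun n => ?_
    rw [norm_mul]
    gcongr
    exact hD n
  have hJz : Summable fun n : ℤ => s / M * halfFourier M s φ n := by
    refine Summable.mul_left _ (Summable.of_add_one_of_neg_add_one hJ ?_)
    simp only [halfFourier_neg hs]
    exact hJ.mul_left s
  -- Poisson summation on each residue class
  have hpois : ∀ l : ℕ, HasSum (fun n : ℤ => s / M * halfFourier M s φ n *
      exp (2 * Real.pi * I * n * l / M)) (∑' m : ℤ, G (m * M + l)) := by
    intro l
    have hF : ∀ n : ℤ, 𝓕 (fun x : ℝ => G (M * x)) (n : ℝ) = s / M * halfFourier M s φ n :=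
      fun n => fourier_parityExtension hφi hs n
    have hdecay : (fun x : ℝ => G (M * x)) =O[cocompact ℝ] fun x => |x| ^ (-2 : ℝ) := by
      refine Asymptotics.IsBigO.of_bound (C / (M : ℝ) ^ 2) ?_
      filter_upwards [(isCompact_singleton (x := (0 : ℝ))).compl_mem_cocompact] with x hx
      have hx0 : x ≠ 0 := hx
      refine (norm_parityExtension_le hsn hC (mul_ne_zero hM.ne' hx0)).trans_eq ?_
      have hxa : 0 < |x| := abs_pos.mpr hx0
      rw [Real.norm_eq_abs, abs_of_pos (Real.rpow_pos_of_pos hxa _), Real.rpow_neg hxa.le,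
        show (2 : ℝ) = ((2 : ℕ) : ℝ) by norm_num, Real.rpow_natCast, sq_abs, mul_pow]
      field_simp
    -- The residue class of l is reached by evaluating the Poisson formula for x ↦ G(Mx) at the
    -- point l/M.
    have hps := Real.tsum_eq_tsum_fourier_of_rpow_decay_of_summable
      (f := fun x : ℝ => G (M * x)) (by fun_prop) (b := 2) one_lt_two hdecay
      (by simpa only [hF] using hJz) ((l : ℝ) / M)
    have e1 : ∀ m : ℤ, G (M * ((l : ℝ) / M + m)) = G (m * M + l) := by
      intro m
      congr 1
      field_simp
      ring
    have e2 : ∀ n : ℤ, (_root_.fourier n) (((l : ℝ) / M : ℝ) : UnitAddCircle) =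
        exp (2 * Real.pi * I * n * l / M) := by
      intro n
      rw [fourier_coe_apply (T := 1)]
      congr 1
      push_cast
      field_simp
    simp only [hF, e1, e2] at hps
    rw [hps]
    refine Summable.hasSum (Summable.of_norm_bounded hJz.norm fun n => ?_)
    rw [norm_mul, show (2 * Real.pi * I * n * l / M : ℂ) =
      ((2 * Real.pi * n * l / M : ℝ) : ℂ) * I by push_cast; ring, norm_exp_ofReal_mul_I, mul_one]
  -- the sum over the integers, by residue classes
  have hleft : ∑' n : ℤ, f n * G n = ∑ l ∈ Finset.range M, f l * ∑' m : ℤ, G (m * M + l) := by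
    have h1 := ((Equiv.prodComm (Fin M) ℤ).trans (Int.divModEquiv M).symm).hasSum_iff.mpr
      hfGs.hasSum
    have h2 : ∀ l : Fin M, HasSum (fun m : ℤ => ((fun n : ℤ => f n * G n) ∘
        ((Equiv.prodComm (Fin M) ℤ).trans (Int.divModEquiv M).symm)) (l, m))
        (f l * ∑' m : ℤ, G (m * M + (l : ℕ))) := by
      intro l
      have h3 : ∀ m : ℤ, ((fun n : ℤ => f n * G n) ∘
          ((Equiv.prodComm (Fin M) ℤ).trans (Int.divModEquiv M).symm)) (l, m) =
          f l * G (m * M + (l : ℕ)) := by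
        intro m
        have e : f (m * M + l) = f l := by
          have := hf.zsmul m (l : ℤ)
          rw [smul_eq_mul, add_comm] at this
          exact this
        simp [Int.divModEquiv, e]
      simp only [h3]
      refine HasSum.mul_left _ (Summable.hasSum ?_)
      have hinj : Function.Injective fun m : ℤ => m * M + (l : ℕ) := by
        intro a b hab
        have : (M : ℤ) ≠ 0 := by exact_mod_cast NeZero.ne M
        exact mul_right_cancel₀ this (add_right_cancel hab)
      have := hGs.comp_injective hinj
      refine this.congr fun m => ?_
      simp
    have h4 := h1.prod_fiberwise h2
    rw [h4.unique (hasSum_fintype _), Fin.sum_univ_eq_sum_range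
      (fun l => f l * ∑' m : ℤ, G (m * M + (l : ℕ)))]
  have hright : HasSum (fun n : ℤ => (Real.sqrt M : ℂ)⁻¹ * (dft M f n * halfFourier M s φ n))
      (∑' n : ℤ, f n * G n) := by
    have h1 := hasSum_sum (s := Finset.range M) fun l _ => (hpois l).mul_left (f l)
    rw [← hleft] at h1
    convert! h1 using 1
    funext n
    -- The Poisson characters have the opposite sign to those in f̂; the parity of f̂ absorbs this
    -- and cancels the factor s of the Fourier transform.
    have e1 : dft M f n = s * dft M f (-n) := by rw [hds, ← mul_assoc, hs, one_mul]
    have hsq : (Real.sqrt M : ℂ) * Real.sqrt M = M := by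
      rw [← ofReal_mul, Real.mul_self_sqrt hM.le, ofReal_natCast]
    rw [e1, dft, Finset.mul_sum, Finset.mul_sum, Finset.sum_mul, Finset.mul_sum]
    refine Finset.sum_congr rfl fun l _ => ?_
    have e2 : -2 * I * (Real.pi : ℂ) * (l : ℂ) * ((-n : ℤ) : ℂ) / (M : ℂ) =
        2 * Real.pi * I * n * l / M := by push_cast; ring
    rw [e2, ← hsq]
    field_simp
  have hneg1 : ∀ n : ℤ, (Real.sqrt M : ℂ)⁻¹ * (dft M f (-n) * halfFourier M s φ (-n)) =
      (Real.sqrt M : ℂ)⁻¹ * (dft M f n * halfFourier M s φ n) := by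
    intro n
    rw [hds, halfFourier_neg hs]
    linear_combination (Real.sqrt M : ℂ)⁻¹ * dft M f n * halfFourier M s φ n * hs
  have hneg2 : ∀ k : ℕ, f (-((k : ℤ) + 1)) * G ((-((k : ℤ) + 1) : ℤ) : ℝ) =
      f ((k : ℤ) + 1) * φ ((k : ℝ) + 1) := by
    intro k
    have e : ((-((k : ℤ) + 1) : ℤ) : ℝ) = -((k : ℝ) + 1) := by push_cast; ring
    rw [hfs, e, hG, parityExtension_neg (by positivity)]
    linear_combination f ((k : ℤ) + 1) * φ ((k : ℝ) + 1) * hs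
  have hpos2 : ∀ k : ℕ, f ((k : ℤ) + 1) * G (((k : ℤ) + 1 : ℤ) : ℝ) =
      f ((k : ℤ) + 1) * φ ((k : ℝ) + 1) := by
    intro k
    push_cast
    rw [hG, parityExtension_of_nonneg (by positivity)]
  have inj1 : Function.Injective fun k : ℕ => (k : ℤ) + 1 := by
    intro a b h; simpa using h
  have s1 := hfGs.comp_injective inj1
  have s2 := hright.summable.comp_injective inj1
  have t1 := tsum_of_add_one_of_neg_add_one (f := fun n : ℤ => f n * G n)
    s1 (s1.congr fun k => by rw [hneg2, ← hpos2]; rfl)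
  have t2 := tsum_of_add_one_of_neg_add_one
    (f := fun n : ℤ => (Real.sqrt M : ℂ)⁻¹ * (dft M f n * halfFourier M s φ n))
    s2 (s2.congr fun k => (hneg1 _).symm)
  rw [hright.tsum_eq, t1] at t2
  simp only [hneg1, hneg2, hpos2] at t2
  have hG0 : G 0 = 0 := by rw [hG, parityExtension_of_nonneg le_rfl, h0]
  rw [Int.cast_zero, hG0, hd0] at t2
  -- By parity each sum over the integers is twice its positive half, the terms of index 0 being
  -- zero.
  linear_combination t2 / 2

end

/-! ### The Fourier integrals of the theta summands -/

lemma mul_gaussMoment (q : ℂ) (j : ℕ) {b : ℝ} (hb : 0 < b) :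
    (b : ℂ) ^ (j + 1) * gaussMoment q j b = gaussMoment (q / b ^ 2) j 1 := by
  have hbc : (b : ℂ) ≠ 0 := ofReal_ne_zero.mpr hb.ne'
  have h := integral_comp_mul_left_Ioi (gaussWave (q / b ^ 2) j j 1) 0 hb
  have e : ∀ x : ℝ, gaussWave (q / b ^ 2) j j 1 (b * x) = (b : ℂ) ^ j * gaussWave q j j b x := by
    intro x
    simp only [gaussWave]
    rw [show -(q / (b : ℂ) ^ 2) * ((b * x : ℝ) : ℂ) ^ 2 = -q * (x : ℂ) ^ 2 by
      push_cast; field_simp, show I * ((1 : ℝ) : ℂ) * ((b * x : ℝ) : ℂ) = I * b * x by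
      push_cast; ring]
    push_cast
    ring
  simp only [e] at h
  rw [integral_const_mul, mul_zero, real_smul, ofReal_inv] at h
  simp only [gaussMoment]
  rw [pow_succ, mul_right_comm, h]
  field_simp

/-- The triangle function with support `[-M, M]`, restricted to the half-line. -/
def triangle (M : ℕ) (x : ℝ) : ℂ := ((max (1 - x / M) 0 : ℝ) : ℂ)

/-- The summand of the partial theta series, made to vanish at the origin. -/
def thetaSummand (M j : ℕ) (τ : ℂ) (x : ℝ) : ℂ :=
  (x : ℂ) ^ j * exp (-(-(I * Real.pi * τ / M)) * (x : ℂ) ^ 2) - if j = 0 then triangle M x else 0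

section

variable {M : ℕ} [NeZero M] {τ : ℂ} {j : ℕ}

lemma triangle_of_le {x : ℝ} (hx : x ≤ M) : triangle M x = 1 - x / M := by
  rw [triangle, max_eq_left]
  · push_cast; rfl
  · rw [sub_nonneg, div_le_one cast_M_pos]; exact hx

lemma triangle_of_ge {x : ℝ} (hx : (M : ℝ) ≤ x) : triangle M x = 0 := by
  rw [triangle, max_eq_right, ofReal_zero]
  rw [sub_nonpos, one_le_div cast_M_pos]; exact hx

omit [NeZero M] in
lemma continuous_triangle : Continuous (triangle M) := by unfold triangle; fun_prop

lemma norm_triangle_le {x : ℝ} (hx : 0 < x) : ‖triangle M x‖ ≤ (M : ℝ) ^ 2 / x ^ 2 := by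
  rcases le_total x M with h | h
  · have h1 : ‖triangle M x‖ ≤ 1 := by
      rw [triangle, norm_real, Real.norm_eq_abs, abs_of_nonneg (le_max_right _ _)]
      refine max_le ?_ zero_le_one
      have : 0 ≤ x / M := div_nonneg hx.le M.cast_nonneg
      linarith
    refine h1.trans ?_
    rw [one_le_div (by positivity)]
    gcongr
  · rw [triangle_of_ge h, norm_zero]
    positivity

lemma integrableOn_triangle_mul {g : ℝ → ℂ} (hg : Continuous g) :
    IntegrableOn (fun x => triangle M x * g x) (Set.Ioi 0) := by
  have h : IntegrableOn (fun x => triangle M x * g x) (Set.Ioc 0 M) :=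
    (continuous_triangle.mul hg).integrableOn_Ioc
  refine h.of_forall_sdiff_eq_zero measurableSet_Ioi fun x hx => ?_
  have : (M : ℝ) ≤ x := by
    by_contra! hlt
    exact hx.2 ⟨hx.1, hlt.le⟩
  simp only [triangle_of_ge this, zero_mul]

/-- At frequencies in (2π/M)ℤ the boundary terms at M cancel and only the jump at the origin, 2i/b,
is left: this is what the triangle removes from the j = 0 moment. -/
lemma integral_triangle_mul {b : ℝ} (hb : b ≠ 0) (hbM : exp (I * b * M) = 1) :
    ∫ x in Set.Ioi (0 : ℝ), triangle M x * (exp (I * b * x) - exp (-(I * b * x))) = 2 * I / b := by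
  have hM : (0 : ℝ) < M := cast_M_pos
  have hMc := cast_M_ne_zero (M := M)
  have hbc : (b : ℂ) ≠ 0 := ofReal_ne_zero.mpr hb
  set g : ℝ → ℂ := fun x => triangle M x * (exp (I * b * x) - exp (-(I * b * x))) with hg
  have h1 : ∫ x in Set.Ioi (0 : ℝ), g x = ∫ x in (0 : ℝ)..M, g x := by
    rw [intervalIntegral.integral_of_le hM.le]
    refine (setIntegral_eq_of_subset_of_forall_sdiff_eq_zero measurableSet_Ioi
      Set.Ioc_subset_Ioi_self fun x hx => ?_)
    have : (M : ℝ) ≤ x := by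
      by_contra! hlt
      exact hx.2 ⟨hx.1, hlt.le⟩
    simp only [hg, triangle_of_ge this, zero_mul]
  set A : ℝ → ℂ := fun x => (1 - x / M) * ((exp (I * b * x) + exp (-(I * b) * x)) / (I * b)) +
    1 / M * ((exp (I * b * x) - exp (-(I * b) * x)) / (I * b) ^ 2) with hA
  have hd : ∀ x ∈ Set.uIcc (0 : ℝ) M, HasDerivAt A (g x) x := by
    intro x hx
    rw [Set.uIcc_of_le hM.le] at hx
    have d1 := hasDerivAt_cexp_mul_ofReal (I * b) x
    have d2 := hasDerivAt_cexp_mul_ofReal (-(I * b)) x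
    have d3 : HasDerivAt (fun x : ℝ => 1 - (x : ℂ) / M) (-(1 / M)) x :=
      (((hasDerivAt_id x).ofReal_comp).div_const (M : ℂ)).const_sub 1
    refine ((d3.fun_mul ((d1.fun_add d2).div_const (I * b))).fun_add
      (((d1.fun_sub d2).div_const ((I * b) ^ 2)).const_mul (1 / (M : ℂ)))).congr_deriv ?_
    simp only [hg, triangle_of_le hx.2]
    rw [neg_mul]
    field_simp
    ring
  have hcont : Continuous g := by
    have := continuous_triangle (M := M)
    fun_prop
  change ∫ x in Set.Ioi (0 : ℝ), g x = _
  rw [h1, intervalIntegral.integral_eq_sub_of_hasDerivAt hd (hcont.intervalIntegrable _ _)]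
  simp only [hA]
  rw [ofReal_natCast, div_self hMc, neg_mul, exp_neg, hbM]
  simp
  field_simp
  rw [I_sq]
  ring

lemma re_neg_I_mul_pos (hτ : 0 < τ.im) : 0 < (-(I * Real.pi * τ / M)).re := by
  have hM : (0 : ℝ) < M := cast_M_pos
  have : (-(I * Real.pi * τ / M)).re = Real.pi / M * τ.im := by
    rw [show -(I * Real.pi * τ / M) = ((Real.pi / M : ℝ) : ℂ) * (-(I * τ)) by push_cast; ring,
      re_ofReal_mul]
    simp
  rw [this]
  have := Real.pi_pos
  positivity

/-- Only one term of the exponential series is needed: exp(qx²) ≥ (qx²)^(j+2)/(j+2)!. -/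
lemma exists_norm_gaussian_le {q : ℝ} (hq : 0 < q) (j : ℕ) :
    ∃ C : ℝ, ∀ x : ℝ, 0 < x → x ^ j * Real.exp (-q * x ^ 2) ≤ C / x ^ 2 := by
  refine ⟨1 + (j + 2).factorial / q ^ (j + 2), fun x hx => ?_⟩
  rw [le_div_iff₀ (by positivity), neg_mul, Real.exp_neg]
  have h1 := Real.pow_div_factorial_le_exp (q * x ^ 2) (by positivity) (j + 2)
  have h2 : 1 ≤ Real.exp (q * x ^ 2) := Real.one_le_exp (by positivity)
  have he := Real.exp_pos (q * x ^ 2)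
  rw [show x ^ j * (Real.exp (q * x ^ 2))⁻¹ * x ^ 2 = x ^ (j + 2) / Real.exp (q * x ^ 2) by
    rw [pow_add]; field_simp, div_le_iff₀ he]
  have h3 : x ^ (j + 2) ≤ 1 + (x ^ (j + 2)) ^ 2 := by nlinarith [sq_nonneg (x ^ (j + 2) - 1)]
  have h4 : (x ^ (j + 2)) ^ 2 ≤ (j + 2).factorial / q ^ (j + 2) * Real.exp (q * x ^ 2) := by
    have hf : (0 : ℝ) < (j + 2).factorial := by positivity
    rw [div_le_iff₀ hf] at h1
    rw [div_mul_eq_mul_div, le_div_iff₀ (by positivity)]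
    refine le_of_eq_of_le ?_ (h1.trans_eq (mul_comm _ _))
    rw [mul_pow]; ring
  nlinarith

omit [NeZero M] in
lemma norm_thetaTerm (τ : ℂ) (j : ℕ) {x : ℝ} (hx : 0 < x) :
    ‖(x : ℂ) ^ j * exp (-(-(I * Real.pi * τ / M)) * (x : ℂ) ^ 2)‖ =
      x ^ j * Real.exp (-(-(I * Real.pi * τ / M)).re * x ^ 2) := by
  rw [norm_mul, norm_pow, norm_real, Real.norm_of_nonneg hx.le, norm_exp, ← ofReal_pow,
    re_mul_ofReal, neg_re]

lemma exists_norm_thetaSummand_le (hτ : 0 < τ.im) (j : ℕ) :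
    ∃ C : ℝ, ∀ x : ℝ, 0 < x → ‖thetaSummand M j τ x‖ ≤ C / x ^ 2 := by
  obtain ⟨C, hC⟩ := exists_norm_gaussian_le (re_neg_I_mul_pos (M := M) hτ) j
  refine ⟨C + M ^ 2, fun x hx => ?_⟩
  rw [thetaSummand, add_div]
  refine (norm_sub_le _ _).trans (add_le_add ((norm_thetaTerm τ j hx).trans_le (hC x hx)) ?_)
  split_ifs
  · exact norm_triangle_le hx
  · rw [norm_zero]; positivity

omit [NeZero M] in
lemma continuous_thetaSummand : Continuous (thetaSummand M j τ) := by
  have := continuous_triangle (M := M)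
  unfold thetaSummand
  split_ifs <;> fun_prop

omit [NeZero M] in
lemma thetaSummand_zero : thetaSummand M j τ 0 = 0 := by
  rcases Nat.eq_zero_or_pos j with rfl | hj
  · simp [thetaSummand, triangle]
  · simp [thetaSummand, hj.ne']

lemma integrableOn_thetaSummand (hτ : 0 < τ.im) : IntegrableOn (thetaSummand M j τ) (Set.Ioi 0) := by
  obtain ⟨C, hC⟩ := exists_norm_thetaSummand_le (M := M) hτ j
  rw [← Set.Ioc_union_Ioi_eq_Ioi zero_le_one]
  refine IntegrableOn.union (continuous_thetaSummand.integrableOn_Ioc) ?_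
  have h := (integrableOn_Ioi_rpow_of_lt (a := -2) (by norm_num) one_pos).const_mul C
  refine Integrable.mono' h continuous_thetaSummand.aestronglyMeasurable ?_
  filter_upwards [self_mem_ae_restrict measurableSet_Ioi] with x hx
  have hx0 : (0 : ℝ) < x := one_pos.trans hx
  refine (hC x hx0).trans_eq ?_
  rw [Real.rpow_neg hx0.le, show (2 : ℝ) = ((2 : ℕ) : ℝ) by norm_num, Real.rpow_natCast]
  rfl

/-- Scaling the frequency b = 2π(k+1)/M to 1 replaces q = -iπτ/M by q/b² = 1/(4μ) with μ = ω_k/τ,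
the form required by the Laplace representation. -/
lemma halfFourier_thetaSummand (hτ : 0 < τ.im) (j k : ℕ) :
    ((2 * Real.pi * ((k : ℂ) + 1) / M)) ^ (j + 1) *
      halfFourier M (-(-1) ^ j) (thetaSummand M j τ) ((k : ℤ) + 1) =
    gaussMoment (1 / (4 * (singPoint M k / τ))) j 1 - if j = 0 then 2 * I else 0 := by
  have hM : (0 : ℝ) < M := cast_M_pos
  have hMc := cast_M_ne_zero (M := M)
  have hk := natCast_add_one_ne_zero k
  have hτ0 : τ ≠ 0 := by rintro rfl; simp at hτ
  have hpi := pi_ne_zero'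
  set b : ℝ := 2 * Real.pi * ((k : ℝ) + 1) / M with hb
  have hbpos : 0 < b := by have := Real.pi_pos; positivity
  have hbc : (b : ℂ) = 2 * Real.pi * ((k : ℂ) + 1) / M := by rw [hb]; push_cast; rfl
  have hb0 : (b : ℂ) ≠ 0 := ofReal_ne_zero.mpr hbpos.ne'
  have hq := re_neg_I_mul_pos (M := M) hτ
  have hbM : exp (I * b * M) = 1 := by
    rw [hbc, show I * (2 * Real.pi * ((k : ℂ) + 1) / M) * M = ((k + 1 : ℕ) : ℂ) * (2 * Real.pi * I) by
      push_cast; field_simp, exp_nat_mul, exp_two_pi_mul_I, one_pow]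
  have hqb : -(I * Real.pi * τ / M) / (b : ℂ) ^ 2 = 1 / (4 * (singPoint M k / τ)) := by
    rw [hbc, singPoint]
    field_simp
    rw [I_sq]
    ring
  rw [← hbc, ← hqb, ← mul_gaussMoment _ j hbpos]
  have hw : ∀ x : ℝ, thetaSummand M j τ x *
      (exp (((2 * Real.pi * (((k : ℤ) + 1 : ℤ) : ℝ) / M * x : ℝ) : ℂ) * I) +
        -(-1) ^ j * exp (-(((2 * Real.pi * (((k : ℤ) + 1 : ℤ) : ℝ) / M * x : ℝ) : ℂ) * I))) =
      gaussWave (-(I * Real.pi * τ / M)) j j b x - if j = 0 then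
        triangle M x * (exp (I * b * x) - exp (-(I * b * x))) else 0 := by
    intro x
    have e : ((2 * Real.pi * (((k : ℤ) + 1 : ℤ) : ℝ) / M * x : ℝ) : ℂ) * I = I * b * x := by
      rw [hbc]; push_cast; ring
    rw [e, thetaSummand, gaussWave]
    split_ifs with hj
    · subst hj; ring
    · ring
  rw [halfFourier]
  simp only [hw]
  split_ifs with hj
  · subst hj
    rw [integral_sub (integrableOn_gaussWave hq 0 0 b), integral_triangle_mul hbpos.ne' hbM,
      gaussMoment]
    · field_simp
      ring
    · exact integrableOn_triangle_mul (by fun_prop)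
  · simp only [sub_zero]
    rfl

end

/-! ### The modular transformation -/

section

variable {M : ℕ} [NeZero M] {τ : ℂ} {j : ℕ} {f : ℤ → ℂ} {σ ε : ℝ}

lemma arg_singPoint (k : ℕ) : arg (singPoint M k) = Real.pi / 2 := by
  rw [singPoint_eq_norm_mul_I, arg_real_mul _ (singPoint_norm_pos k), arg_I]

/-- Since arg ω_k = π/2 and 0 < arg τ < π, the difference of arguments stays within π/2 of zero and
no multiple of 2πi appears. -/
lemma log_singPoint_div (hτ : 0 < τ.im) (k : ℕ) :
    log (singPoint M k / τ) = log (singPoint M k) - log τ := by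
  have hτ0 : τ ≠ 0 := by rintro rfl; simp at hτ
  have hpi := Real.pi_pos
  have h1 := arg_singPoint (M := M) k
  have h2 : 0 ≤ arg τ := arg_nonneg_iff.mpr hτ.le
  have h3 : arg τ < Real.pi := by
    rw [arg_lt_pi_iff]; exact Or.inr hτ.ne'
  conv_lhs => rw [← exp_log (singPoint_ne_zero (M := M) k), ← exp_log hτ0, ← exp_sub]
  rw [log_exp]
  · rw [sub_im, log_im, log_im, h1]; linarith
  · rw [sub_im, log_im, log_im, h1]; linarith

lemma arg_singPoint_div (hτ : 0 < τ.im) (k : ℕ) :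
    arg (singPoint M k / τ) = Real.pi / 2 - arg τ := by
  rw [← log_im, log_singPoint_div hτ, sub_im, log_im, log_im, arg_singPoint]

lemma re_I_div_pos (hτ : 0 < τ.im) : 0 < (I / τ).re := by
  have h : 0 < normSq τ := normSq_pos.mpr (by rintro rfl; simp at hτ)
  simp only [div_re, I_re, I_im, zero_mul, zero_div, zero_add, one_mul]
  positivity

omit [NeZero M] in
lemma singPoint_div_eq (k : ℕ) (τ : ℂ) : singPoint M k / τ = ‖singPoint M k‖ * (I / τ) := by
  conv_lhs => rw [singPoint_eq_norm_mul_I]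
  ring

lemma re_singPoint_div_pos (hτ : 0 < τ.im) (k : ℕ) : 0 < (singPoint M k / τ).re := by
  rw [singPoint_div_eq, re_ofReal_mul]
  exact mul_pos (singPoint_norm_pos k) (re_I_div_pos hτ)

lemma singPoint_div_cpow_half (hτ : 0 < τ.im) (k : ℕ) :
    (singPoint M k / τ) ^ (1 / 2 : ℂ) =
      ((k : ℂ) + 1) * ((Real.pi * I / M) ^ (1 / 2 : ℂ) * τ ^ (-1 / 2 : ℂ)) := by
  have hτ0 : τ ≠ 0 := by rintro rfl; simp at hτ
  rw [cpow_def_of_ne_zero (div_ne_zero (singPoint_ne_zero k) hτ0), log_singPoint_div hτ, sub_mul,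
    sub_eq_add_neg, exp_add, ← mul_assoc, cpow_def_of_ne_zero hτ0]
  have h := exp_half_log_singPoint (M := M) k
  rw [sqrtPoint] at h
  rw [← h]
  congr 2 <;> ring

lemma summable_pow_mul_exp_singPoint (hτ : 0 < τ.im) (ν : ℕ) :
    Summable fun k : ℕ => ((k : ℂ) + 1) ^ ν * exp (-(singPoint M k / τ)) := by
  have hM : (0 : ℝ) < M := cast_M_pos
  have hr : 0 < Real.pi / M * (I / τ).re := by
    have := re_I_div_pos hτ
    have := Real.pi_pos
    positivity
  have hs := (summable_nat_add_iff 1).mpr (Real.summable_pow_mul_exp_neg_nat_mul ν hr)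
  refine Summable.of_norm_bounded hs fun k => ?_
  have hk : ‖(k : ℂ) + 1‖ = (k : ℝ) + 1 := by
    rw [show (k : ℂ) + 1 = ((k + 1 : ℕ) : ℂ) by push_cast; ring, norm_natCast]
    push_cast; ring
  rw [norm_mul, norm_pow, hk, norm_exp, singPoint_div_eq, neg_re, re_ofReal_mul]
  push_cast
  gcongr
  have := norm_singPoint_ge (M := M) k
  have := mul_le_mul_of_nonneg_right this (re_I_div_pos hτ).le
  linarith

/-- The coefficient of `Θ(-1/τ; ν, f̂, M)` in the modular transformation. -/
def modularCoeff (M j : ℕ) (τ : ℂ) (ν : ℕ) : ℂ :=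
  (2 : ℂ) ^ (-((j / 2 : ℕ) : ℤ)) * I ^ (1 / 2 : ℂ) *
    (((M : ℂ) / (Real.pi * I)) ^ (((j : ℂ) - (ν : ℂ)) / 2) * ((poly j).coeff ν : ℂ) *
      τ ^ (-((j : ℂ) + (ν : ℂ) + 1) / 2))

lemma modularCoeff_eq (j : ℕ) (τ : ℂ) (ν : ℕ) :
    I ^ j * (2 * Real.pi / M) ^ (j + 1) * modularCoeff M j τ ν =
      2 * Real.sqrt Real.pi * (Real.sqrt M : ℂ)⁻¹ *
        ((Real.pi * I / M) ^ (1 / 2 : ℂ) * τ ^ (-1 / 2 : ℂ)) ^ (j + 1 + ν) *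
          (2 ^ ((j + 1) / 2) * ((poly j).coeff ν : ℂ)) := by
  have hM := cast_M_ne_zero (M := M)
  have hpi := pi_ne_zero'
  have hc := pi_mul_I_div_ne_zero (M := M)
  have ht : τ ^ (-((j : ℂ) + (ν : ℂ) + 1) / 2) = (τ ^ (-1 / 2 : ℂ)) ^ (j + 1 + ν) := by
    rw [← cpow_nat_mul]
    congr 1
    push_cast
    ring
  set g : ℂ := (Real.pi * I / M) ^ (1 / 2 : ℂ) with hg
  have hg2 : g ^ 2 = Real.pi * I / M := pi_mul_I_div_cpow_half_sq
  have hg0 : g ≠ 0 := by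
    intro h
    rw [h] at hg2
    exact hc (by simpa using hg2.symm)
  have hgI : g = Real.sqrt Real.pi / Real.sqrt M * I ^ (1 / 2 : ℂ) := pi_mul_I_div_cpow_half
  have hinv : ((M : ℂ) / (Real.pi * I)) ^ (((j : ℂ) - (ν : ℂ)) / 2) = g ^ ν / g ^ j := by
    rw [div_pi_mul_I_cpow, sub_div, cpow_sub _ _ hc, inv_div, show (j : ℂ) / 2 = j * (1 / 2) by ring,
      show (ν : ℂ) / 2 = ν * (1 / 2) by ring, cpow_nat_mul, cpow_nat_mul]
  have hM2 : (Real.sqrt M : ℂ) ≠ 0 := by simp [NeZero.ne M]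
  have hsM : (Real.sqrt M : ℂ) ^ 2 = M := by
    rw [← ofReal_pow, Real.sq_sqrt M.cast_nonneg]; simp
  have hsp : (Real.sqrt Real.pi : ℂ) ^ 2 = Real.pi := by
    rw [← ofReal_pow, Real.sq_sqrt Real.pi_pos.le]
  have hp2 : (Real.sqrt Real.pi : ℂ) ≠ 0 := by
    intro h
    rw [h] at hsp
    exact hpi (by simpa using hsp.symm)
  have hI : I ^ (1 / 2 : ℂ) = g * Real.sqrt M / Real.sqrt Real.pi := by
    rw [hgI]; field_simp
  have hK : I ^ j * (2 * Real.pi / M) ^ (j + 1) = 2 ^ j * (g ^ j * g ^ j) * (2 * Real.pi / M) := by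
    rw [← mul_pow g g, ← sq, hg2, ← mul_pow, pow_succ, ← mul_assoc, ← mul_pow]
    congr 2
    ring
  rw [modularCoeff, hK, ht, hinv, ← two_pow_ceil_div, hI, ← hsM, ← hsp]
  generalize τ ^ (-1 / 2 : ℂ) = t
  rw [mul_pow g t, pow_add g, pow_succ g]
  field_simp

/-- One frequency of the identity: the Laplace part carries the constant of the Borel transform, and
the Hermite part expands through `poly` into the summands of the theta series at -1/τ. -/
lemma halfFourier_thetaSummand_eq (hτ : 0 < τ.im) (hσ : σ = 1 ∨ σ = -1) (h0 : 0 < ε)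
    (h1 : ε < Real.pi) (h2 : -(σ * ε) < arg τ) (h3 : arg τ < Real.pi - σ * ε) (j k : ℕ) :
    (Real.sqrt M : ℂ)⁻¹ * halfFourier M (-(-1) ^ j) (thetaSummand M j τ) ((k : ℤ) + 1) =
      borelConst j M / ((k : ℂ) + 1) ^ (j + 1) * ((if j = 0 then 0 else (singPoly j).eval 1) +
        rayInt (singPoint M k / τ) (-σ * ε) (opD (singPoly j)) 1) -
      σ * ∑ ν ∈ (Finset.range (j + 1)).filter (fun ν => ν ≡ j [MOD 2]),
        modularCoeff M j τ ν * (((k : ℂ) + 1) ^ ν * exp (-(singPoint M k / τ))) := by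
  have hM := cast_M_ne_zero (M := M)
  have hpi := pi_ne_zero'
  have hk := natCast_add_one_ne_zero k
  have hM2 : (Real.sqrt M : ℂ) ≠ 0 := by simp [NeZero.ne M]
  have hsM : (Real.sqrt M : ℂ) ^ 2 = M := by
    rw [← ofReal_pow, Real.sq_sqrt M.cast_nonneg]; simp
  have harg := arg_singPoint_div (M := M) hτ k
  have hα := sin_ne_zero_of_sign hσ h0 h1
  have a1 : -(Real.pi / 2) < arg (singPoint M k / τ) + -σ * ε := by rw [harg]; linarith
  have a2 : arg (singPoint M k / τ) + -σ * ε < Real.pi / 2 := by rw [harg]; linarith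
  have hre := re_singPoint_div_pos (M := M) hτ k
  have hcre := (cpow_half_mul_exp hre a1 a2).2.2
  have hJ := halfFourier_thetaSummand (M := M) hτ j k
  have hgm := I_pow_mul_gaussMoment hre hσ h0 h1 a1 a2 j
  have hri := mul_rayInt hα hcre (singPoly j) one_pos
  rw [ofReal_one, germ_one_one] at hri
  rw [hri, singPoint_div_cpow_half hτ, signedHermite_eq_poly, map_mul, map_pow, map_ofNat,
    aeval_poly_eq_sum] at hgm
  set y : ℂ := (Real.pi * I / M) ^ (1 / 2 : ℂ) * τ ^ (-1 / 2 : ℂ) with hy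
  set J := halfFourier M (-(-1) ^ j) (thetaSummand M j τ) ((k : ℤ) + 1) with hJdef
  set E := exp (-(singPoint M k / τ)) with hE
  set R := rayInt (singPoint M k / τ) (-σ * ε) (opD (singPoly j)) 1 with hR
  set b : ℂ := I ^ j * (2 * Real.pi * ((k : ℂ) + 1) / M) ^ (j + 1) with hb
  have hb0 : b ≠ 0 := by
    rw [hb]
    simp [hM, hpi, hk]
  have hsum : b * ∑ ν ∈ (Finset.range (j + 1)).filter (fun ν => ν ≡ j [MOD 2]),
      modularCoeff M j τ ν * (((k : ℂ) + 1) ^ ν * E) =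
      (Real.sqrt M : ℂ)⁻¹ * (2 * Real.sqrt Real.pi * (((k : ℂ) + 1) * y) * E *
        ((((k : ℂ) + 1) * y) ^ j * (2 ^ ((j + 1) / 2) *
          ∑ ν ∈ (Finset.range (j + 1)).filter (fun ν => ν ≡ j [MOD 2]),
            ((poly j).coeff ν : ℂ) * (((k : ℂ) + 1) * y) ^ ν))) := by
    simp only [Finset.mul_sum]
    refine Finset.sum_congr rfl fun ν _ => ?_
    have h4 := modularCoeff_eq (M := M) j τ ν
    rw [← hy] at h4
    rw [hb, show (2 * Real.pi * ((k : ℂ) + 1) / M) ^ (j + 1) =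
      (2 * Real.pi / M) ^ (j + 1) * ((k : ℂ) + 1) ^ (j + 1) by rw [← mul_pow]; ring]
    have h5 : (((k : ℂ) + 1) * y) ^ ν = ((k : ℂ) + 1) ^ ν * y ^ ν := mul_pow _ _ _
    have h6 : (((k : ℂ) + 1) * y) ^ j = ((k : ℂ) + 1) ^ j * y ^ j := mul_pow _ _ _
    rw [h5, h6]
    rw [pow_add y, pow_succ y] at h4
    linear_combination ((k : ℂ) + 1) ^ (j + 1) * ((k : ℂ) + 1) ^ ν * E * h4
  have hconst : b * (borelConst j M / ((k : ℂ) + 1) ^ (j + 1)) = (Real.sqrt M : ℂ)⁻¹ * (2 * I) := by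
    have e : b = ((2 * Real.pi * I) / M) ^ j * (2 * Real.pi / M) * ((k : ℂ) + 1) ^ (j + 1) := by
      rw [hb, show 2 * Real.pi * ((k : ℂ) + 1) / M = (2 * Real.pi / M) * ((k : ℂ) + 1) by ring,
        mul_pow, pow_succ (2 * Real.pi / M : ℂ), ← mul_assoc, ← mul_assoc, ← mul_pow]
      congr 3
      ring
    have e2 : ((2 * Real.pi * I) / M : ℂ) ^ j * (M / (2 * Real.pi * I)) ^ j = 1 := by
      rw [← mul_pow, div_mul_div_cancel₀ hM, div_self (by simp [hpi]), one_pow]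
    rw [e, borelConst]
    have e3 : ((2 * Real.pi * I) / M : ℂ) ^ j * (2 * Real.pi / M) * ((k : ℂ) + 1) ^ (j + 1) *
        (I * Real.sqrt M / Real.pi * (M / (2 * Real.pi * I)) ^ j / ((k : ℂ) + 1) ^ (j + 1)) =
        (((2 * Real.pi * I) / M : ℂ) ^ j * (M / (2 * Real.pi * I)) ^ j) *
          (2 * I * Real.sqrt M / M) := by
      generalize ((2 * Real.pi * I) / M : ℂ) ^ j = u
      generalize ((M : ℂ) / (2 * Real.pi * I)) ^ j = v
      field_simp
    rw [e3, e2, ← hsM]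
    field_simp
  have hbJ : b * J = 2 * I * ((if j = 0 then 0 else (singPoly j).eval 1) + R) -
      σ * (2 * Real.sqrt Real.pi * (((k : ℂ) + 1) * y) * E *
        ((((k : ℂ) + 1) * y) ^ j * (2 ^ ((j + 1) / 2) *
          ∑ ν ∈ (Finset.range (j + 1)).filter (fun ν => ν ≡ j [MOD 2]),
            ((poly j).coeff ν : ℂ) * (((k : ℂ) + 1) * y) ^ ν))) := by
    rw [hb, mul_assoc, hJ, mul_sub, hgm]
    split_ifs with hj
    · subst hj
      -- For j = 0 the contribution 2i of the triangle cancels the boundary value of the integration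
      -- by parts, which is why the constant is absent in this case.
      simp only [singPoly, eval_one, pow_zero]
      ring
    · ring
  apply mul_left_cancel₀ hb0
  linear_combination (Real.sqrt M : ℂ)⁻¹ * hbJ -
    ((if j = 0 then 0 else (singPoly j).eval 1) + R) * hconst + σ * hsum

end

/-! ### Resummation of the partial theta series -/

section

variable {M : ℕ} [NeZero M] {τ : ℂ} {j : ℕ} {f : ℤ → ℂ} {σ ε : ℝ}

lemma summable_one_div_add_one_sq : Summable fun k : ℕ => 1 / ((k : ℝ) + 1) ^ 2 := by
  have := (summable_nat_add_iff 1).mpr (Real.summable_one_div_nat_pow.mpr (one_lt_two))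
  simpa using this

lemma norm_natCast_add_one (k : ℕ) : ‖(k : ℂ) + 1‖ = (k : ℝ) + 1 := by
  rw [show (k : ℂ) + 1 = ((k + 1 : ℕ) : ℂ) by push_cast; ring, norm_natCast]
  push_cast; ring

/-- The Laplace integrals are O(1/|ω_k|) = O(k⁻²). The constant term decays like k^(-j-1), which
suffices because it is absent for j = 0. -/
lemma summable_halfFourier_thetaSummand (hτ : 0 < τ.im) (hσ : σ = 1 ∨ σ = -1) (h0 : 0 < ε)
    (h1 : ε < Real.pi) (h2 : -(σ * ε) < arg τ) (h3 : arg τ < Real.pi - σ * ε) (j : ℕ) :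
    Summable fun k : ℕ => halfFourier M (-(-1) ^ j) (thetaSummand M j τ) ((k : ℤ) + 1) := by
  have hM : (0 : ℝ) < M := cast_M_pos
  have hM2 : (Real.sqrt M : ℂ)⁻¹ ≠ 0 := by simp [NeZero.ne M]
  have hα := sin_ne_zero_of_sign hσ h0 h1
  refine (summable_mul_left_iff hM2).mp ?_
  simp only [halfFourier_thetaSummand_eq hτ hσ h0 h1 h2 h3]
  refine Summable.sub ?_ (Summable.mul_left _ (summable_sum fun ν _ =>
    (summable_pow_mul_exp_singPoint hτ ν).mul_left _))
  simp only [mul_add]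
  have hk1 : ∀ k : ℕ, (1 : ℝ) ≤ (k : ℝ) + 1 := fun k => by linarith [k.cast_nonneg (α := ℝ)]
  refine Summable.add ?_ ?_
  · split_ifs with hj
    · simp
    · refine Summable.of_norm_bounded (summable_one_div_add_one_sq.mul_left
        (‖borelConst j M‖ * ‖(singPoly j).eval 1‖)) fun k => ?_
      rw [norm_mul, norm_div, norm_pow, norm_natCast_add_one, div_mul_eq_mul_div, div_eq_mul_one_div]
      have h := hk1 k
      gcongr
      omega
  · obtain ⟨B, hB, hle⟩ := exists_norm_rayInt_le hα (opD (singPoly j))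
    have hc : 0 < (exp (I * ((Real.pi / 2 - σ * ε : ℝ) : ℂ)) / τ).re :=
      re_exp_div_pos hτ (by linarith) (by linarith)
    set c := (exp (I * ((Real.pi / 2 - σ * ε : ℝ) : ℂ)) / τ).re with hcdef
    refine Summable.of_norm_bounded (summable_one_div_add_one_sq.mul_left
        (‖borelConst j M‖ * (B * M / (Real.pi * c)))) fun k => ?_
    have hre : (singPoint M k / τ * exp (I * ((-σ * ε : ℝ) : ℂ))).re =
        Real.pi * ((k : ℝ) + 1) ^ 2 / M * c := by
      rw [singPoint_div_mul_exp, re_ofReal_mul, norm_singPoint]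
    have hk := hk1 k
    have hpi := Real.pi_pos
    have hle' := hle (singPoint M k / τ) (by rw [hre]; positivity)
    rw [hre] at hle'
    rw [norm_mul, norm_div, norm_pow, norm_natCast_add_one, mul_assoc]
    refine mul_le_mul (div_le_self (norm_nonneg _) (one_le_pow₀ hk)) (hle'.trans_eq ?_)
      (norm_nonneg _) (norm_nonneg _)
    field_simp

lemma hasSum_theta (hτ : 0 < τ.im) (hf : Function.Periodic f (M : ℤ)) (j : ℕ) :
    HasSum (fun k : ℕ => f ((k : ℤ) + 1) * ((((k : ℝ) + 1 : ℝ) : ℂ) ^ j *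
      exp (-(-(I * Real.pi * τ / M)) * (((k : ℝ) + 1 : ℝ) : ℂ) ^ 2))) (theta τ j f M) := by
  obtain ⟨D, hD0, hD⟩ := exists_norm_le_of_periodic hf
  obtain ⟨C, hC⟩ := exists_norm_gaussian_le (re_neg_I_mul_pos (M := M) hτ) j
  have hs : Summable fun k : ℕ => f ((k : ℤ) + 1) * ((((k : ℝ) + 1 : ℝ) : ℂ) ^ j *
      exp (-(-(I * Real.pi * τ / M)) * (((k : ℝ) + 1 : ℝ) : ℂ) ^ 2)) := by
    refine Summable.of_norm_bounded (summable_one_div_add_one_sq.mul_left (D * C)) fun k => ?_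
    have hk : (0 : ℝ) < (k : ℝ) + 1 := by positivity
    rw [norm_mul, norm_thetaTerm τ j hk]
    exact (mul_le_mul (hD _) (hC _ hk) (by positivity) hD0).trans_eq (by ring)
  convert! hs.hasSum using 1
  rw [theta]
  refine tsum_congr fun k => ?_
  rw [neg_neg]
  push_cast
  rw [show I * Real.pi * ((k : ℂ) + 1) ^ 2 * τ / M = I * Real.pi * τ / M * ((k : ℂ) + 1) ^ 2 by ring]
  ring

lemma coeff_zero_thetaTilde_zero : PowerSeries.coeff 0 (thetaTilde 0 f M) = Lfun M f 0 := by
  rw [thetaTilde, PowerSeries.coeff_mk]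
  simp

lemma tsum_mul_thetaSummand (hτ : 0 < τ.im) (hf : Function.Periodic f (M : ℤ))
    (h0 : mean M f = 0) (j : ℕ) :
    ∑' k : ℕ, f ((k : ℤ) + 1) * thetaSummand M j τ ((k : ℝ) + 1) =
      theta τ j f M - if j = 0 then PowerSeries.coeff 0 (thetaTilde j f M) else 0 := by
  have h1 := hasSum_theta hτ hf j
  split_ifs with hj
  · subst hj
    have h2 : HasSum (fun k : ℕ => f ((k : ℤ) + 1) * triangle M ((k : ℝ) + 1)) (Lfun M f 0) := by
      rw [Lfun_zero hf h0]
      have h3 : ∀ k ∉ Finset.range M, f ((k : ℤ) + 1) * triangle M ((k : ℝ) + 1) = 0 := by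
        intro k hk
        rw [triangle_of_ge, mul_zero]
        have : M ≤ k := by simpa using hk
        exact_mod_cast (by omega : M ≤ k + 1)
      have h4 := hasSum_sum_of_ne_finset_zero (L := .unconditional ℕ) h3
      convert! h4 using 1
      refine Finset.sum_congr rfl fun k hk => ?_
      rw [triangle_of_le]
      · push_cast; rfl
      · have : k < M := by simpa using hk
        exact_mod_cast (by omega : k + 1 ≤ M)
    rw [coeff_zero_thetaTilde_zero, ← (h1.sub h2).tsum_eq]
    refine tsum_congr fun k => ?_
    rw [thetaSummand, if_pos rfl, mul_sub]
  · rw [sub_zero, ← h1.tsum_eq]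
    refine tsum_congr fun k => ?_
    rw [thetaSummand, if_neg hj, sub_zero]

lemma hasSum_modular (hτ : 0 < τ.im) (f : ℤ → ℂ) (ν : ℕ) :
    HasSum (fun k : ℕ => dft M f ((k : ℤ) + 1) *
      (((k : ℂ) + 1) ^ ν * exp (-(singPoint M k / τ)))) (theta (-τ⁻¹) ν (dft M f) M) := by
  obtain ⟨B, hB, hle⟩ := exists_norm_dft_le M f
  have hs : Summable (fun k : ℕ => dft M f ((k : ℤ) + 1) *
      (((k : ℂ) + 1) ^ ν * exp (-(singPoint M k / τ)))) := by
    refine Summable.of_norm_bounded ((summable_pow_mul_exp_singPoint (M := M) hτ ν).norm.mul_left B)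
      fun k => ?_
    rw [norm_mul]
    gcongr
    exact hle _
  convert! hs.hasSum using 1
  rw [theta]
  refine tsum_congr fun k => ?_
  rw [show I * Real.pi * ((k : ℂ) + 1) ^ 2 * -τ⁻¹ / M = -(singPoint M k / τ) by
    rw [singPoint]; ring]
  ring

/-- Poisson summation, with each frequency replaced by its Laplace part and its Gaussian part,
followed by summation of the two parts separately. -/
theorem theta_eq_borelSum_sub (hf : Function.Periodic f (M : ℤ)) (h : OppositeParity j f)
    (hmean : mean M f = 0) (hτ : 0 < τ.im) (hσ : σ = 1 ∨ σ = -1) (h0 : 0 < ε)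
    (h1 : ε < Real.pi) (h2 : -(σ * ε) < arg τ) (h3 : arg τ < Real.pi - σ * ε) :
    ∃ B : ℂ, HasBorelSum (Real.pi / 2 - σ * ε) (thetaTilde j f M) τ B ∧
      theta τ j f M = B - σ * ∑ ν ∈ (Finset.range (j + 1)).filter (fun ν => ν ≡ j [MOD 2]),
        modularCoeff M j τ ν * theta (-τ⁻¹) ν (dft M f) M := by
  have hα := sin_ne_zero_of_sign hσ h0 h1
  obtain ⟨S, hS, hB⟩ := hasBorelSum_thetaTilde hf h hα
    (re_exp_div_pos hτ (θ := Real.pi / 2 - σ * ε) (by linarith) (by linarith))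
  refine ⟨_, hB, ?_⟩
  obtain ⟨C, hC⟩ := exists_norm_thetaSummand_le (M := M) hτ j
  have hss : (-(-1 : ℂ) ^ j) * -(-1) ^ j = 1 := by
    rw [neg_mul_neg, ← mul_pow]; simp
  have hP := tsum_mul_eq_tsum_dft_mul_halfFourier hf hss h.apply_neg (dft_neg hf h)
    (dft_zero hf hmean) continuous_thetaSummand thetaSummand_zero hC (integrableOn_thetaSummand hτ)
    (summable_halfFourier_thetaSummand hτ hσ h0 h1 h2 h3 j)
  rw [tsum_mul_thetaSummand hτ hf hmean] at hP
  -- For j ≥ 1 the constant term of the formal series arises from the boundary values; for j = 0 it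
  -- has already come from the triangle on the other side.
  have hc : HasSum (fun k : ℕ => borelCoeff j f M k * if j = 0 then 0 else (singPoly j).eval 1)
      (if j = 0 then 0 else PowerSeries.coeff 0 (thetaTilde j f M)) := by
    split_ifs with hj
    · simp
    · have := hasSum_coeff_thetaTilde (p := 0) hf h (by omega)
      simpa using this
  have hm := (hasSum_sum (s := (Finset.range (j + 1)).filter (fun ν => ν ≡ j [MOD 2]))
    fun ν _ => (hasSum_modular (M := M) hτ f ν).mul_left (modularCoeff M j τ ν)).mul_left (σ : ℂ)
  have htot := (hc.add hS).sub hm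
  have hterm : ∀ k : ℕ, (Real.sqrt M : ℂ)⁻¹ * (dft M f ((k : ℤ) + 1) *
      halfFourier M (-(-1) ^ j) (thetaSummand M j τ) ((k : ℤ) + 1)) =
      borelCoeff j f M k * (if j = 0 then 0 else (singPoly j).eval 1) +
        borelCoeff j f M k * rayInt (singPoint M k / τ) (-σ * ε) (opD (singPoly j)) 1 -
      σ * ∑ ν ∈ (Finset.range (j + 1)).filter (fun ν => ν ≡ j [MOD 2]), modularCoeff M j τ ν *
        (dft M f ((k : ℤ) + 1) * (((k : ℂ) + 1) ^ ν * exp (-(singPoint M k / τ)))) := by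
    intro k
    rw [mul_left_comm, halfFourier_thetaSummand_eq hτ hσ h0 h1 h2 h3, mul_sub, borelCoeff]
    congr 1
    · ring
    · rw [mul_left_comm, Finset.mul_sum]
      congr 1
      exact Finset.sum_congr rfl fun ν _ => mul_left_comm _ _ _
  simp only [hterm] at hP
  rw [htot.tsum_eq] at hP
  rw [sub_eq_iff_eq_add.mp hP]
  split_ifs <;> ring

end

end PartialTheta

end

/-! ### The theorem. -/

open Polynomial in
theorem mainTheorem7 :
    -- the recursion, the form of the polynomials and their leading coefficients
    (PartialTheta.poly 0 = 1 ∧ PartialTheta.poly 1 = -X ∧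
      ∀ j : ℕ, 2 ≤ j → PartialTheta.poly j =
        (2 * X ^ 2 - C ((j : ℤ) - 1)) * PartialTheta.poly (j - 2) -
          X * derivative (PartialTheta.poly (j - 2))) ∧
    (∀ j : ℕ,
      PartialTheta.poly j =
        ∑ ν ∈ (Finset.range (j + 1)).filter (fun ν => ν ≡ j [MOD 2]),
          C ((PartialTheta.poly j).coeff ν) * X ^ ν ∧
      (PartialTheta.poly j).coeff j = (-1) ^ j * 2 ^ (j / 2)) ∧
    ∀ (M : ℕ) [NeZero M] (j : ℕ) (f : ℤ → ℂ), Function.Periodic f (M : ℤ) →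
      PartialTheta.OppositeParity j f →
      -- the alien derivatives
      (∀ n : ℕ, 1 ≤ n →
        PartialTheta.HasAlienDerivative (Real.pi * Complex.I * (n : ℂ) ^ 2 / (M : ℂ))
          (PartialTheta.thetaTilde j f M)
          (((2 : ℂ) ^ (1 - ((j / 2 : ℕ) : ℤ)) * Complex.I ^ (1 / 2 : ℂ) *
              ((M : ℂ) / (Real.pi * Complex.I)) ^ ((j : ℂ) / 2) *
              PartialTheta.dft M f (n : ℤ)) •
            (PartialTheta.mono (-((j : ℚ) + 1) / 2) 1 *
              aeval (PartialTheta.mono (-1 / 2)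
                ((n : ℂ) * (Real.pi * Complex.I / (M : ℂ)) ^ (1 / 2 : ℂ)))
                (PartialTheta.poly j)))) ∧
      -- the two identities, `σ = 1` for the upper sign and `σ = -1` for the lower sign
      (PartialTheta.mean M f = 0 →
        ∀ σ : ℝ, σ = 1 ∨ σ = -1 →
        ∀ τ : ℂ, 0 < τ.im →
        ∀ ε : ℝ, 0 < ε → ε < Real.pi →
          Real.pi / 2 - σ * ε - Real.pi / 2 < Complex.arg τ →
          Complex.arg τ < Real.pi / 2 - σ * ε + Real.pi / 2 →
          ∃ B : ℂ, PartialTheta.HasBorelSum (Real.pi / 2 - σ * ε)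
              (PartialTheta.thetaTilde j f M) τ B ∧
            PartialTheta.theta τ j f M = B -
              (σ : ℂ) * ((2 : ℂ) ^ (-((j / 2 : ℕ) : ℤ)) * Complex.I ^ (1 / 2 : ℂ) *
                ∑ ν ∈ (Finset.range (j + 1)).filter (fun ν => ν ≡ j [MOD 2]),
                  ((M : ℂ) / (Real.pi * Complex.I)) ^ (((j : ℂ) - (ν : ℂ)) / 2) *
                  ((PartialTheta.poly j).coeff ν : ℂ) *
                  τ ^ (-((j : ℂ) + (ν : ℂ) + 1) / 2) *
                  PartialTheta.theta (-τ⁻¹) ν (PartialTheta.dft M f) M)) := by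
  refine ⟨⟨rfl, rfl, fun j hj => ?_⟩, fun j => ⟨PartialTheta.poly_eq_sum j,
    PartialTheta.coeff_poly_self j⟩, fun M _ j f hf h => ⟨fun n hn =>
    PartialTheta.hasAlienDerivative_thetaTilde hf h hn, fun hmean σ hσ τ hτ ε h0 h1 h2 h3 => ?_⟩⟩
  · obtain ⟨k, rfl⟩ : ∃ k, j = k + 2 := ⟨j - 2, by omega⟩
    rw [PartialTheta.poly, Nat.add_sub_cancel]
    congr 4
    push_cast
    ring
  · obtain ⟨B, hB, hθ⟩ := PartialTheta.theta_eq_borelSum_sub hf h hmean hτ hσ h0 h1 (by linarith)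
      (by linarith)
    refine ⟨B, hB, hθ.trans ?_⟩
    congr 2
    rw [Finset.mul_sum]
    refine Finset.sum_congr rfl fun ν _ => ?_
    rw [PartialTheta.modularCoeff]
    ring
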